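/- Let $d\ge 2$, let $\mathcal O_d$ be the Cuntz algebra with generators $s_1,\dots,s_d$ ($s_i^*s_j=\delta_{ij}1$, $\sum_i s_is_i^*=1$), and let $\lambda(x)=\sum_i s_ixs_i^*$. For a finite sequence $I=(i_1,\dots,i_m)$ (possibly empty) write $s_I=s_{i_1}\cdots s_{i_m}$, and similarly for other families. For operators $v_1,\dots,v_d$ on a Hilbert space $\mathcal K$ put $\tau(x)=\sum_k v_kxv_k^*$ and $\mathcal B_\tau(\mathcal K)=\{x\in\mathcal B(\mathcal K):\tau(x)=x\}$. A state is called ergodic for a map if it is an extremal point of the convex set of states invariant under the map; a positive functional on a von Neumann algebra is normal if it is of the form $\sum_n\langle\xi_n,\,\cdot\,\xi_n\rangle$ with $\sum_n\|\xi_n\|^2<\infty$. **Direct part.** Let $\psi$ be a $\lambda$-invariant state on $\mathcal O_d$ with GNS representation $(\mathcal H,\pi,\Omega)$, let $P$ be the support projection of $\psi_\Omega(X)=\langle\Omega,X\Omega\rangle$ in $\pi(\mathcal O_d)''$ (the smallest projection $p\in\pi(\mathcal O_d)''$ with $\psi_\Omega(p)=1$), and let $\mathcal K=P\mathcal H$,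 $S_k=\pi(s_k)$, $v_k=PS_kP$ (seen as an operator on $\mathcal K$), $\Lambda(X)=\sum_kS_kXS_k^*$, $\mathcal M=\{v_k,v_k^*:1\le k\le d\}''\subseteq\mathcal B(\mathcal K)$. Then $\Omega\in\mathcal K$, and with $\phi_0(x)=\langle\Omega,x\Omega\rangle$ on $\mathcal M$ the following hold. (a) $P\in\pi(\mathcal O_d)''$ is sub-harmonic, $\Lambda(P)\ge P$, and (i) $\Lambda^n(P)$ is increasing in $n$ and converges strongly to $I$; (ii) $PS_k^*P=S_k^*P$ for all $k$; (iii) $\sum_kv_kv_k^*=I_{\mathcal K}$. (b) $\psi(s_Is_J^*)=\langle\Omega,v_Iv_J^*\Omega\rangle$ for all finite $I,J$, and the vectors $S_If$ ($f\in\mathcal K$, $I$ finite) are total in $\mathcal H$. (c) $P\pi(\mathcal O_d)''P$, acting on $\mathcal K$, equals $\mathcal M$, and $\phi_0$ is faithful on $\mathcal M$. (d) $X'\mapsto PX'P$ is a bijection of the self-adjoint part of $\pi(\mathcal O_d)'$ onto the self-adjoint part of $\mathcal B_\tau(\mathcal K)$ which preserves the norm and preserves the order in both directions; moreover $\mathcal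 M'=\mathcal B_\tau(\mathcal K)$. (e) $\phi_0$ is a faithful normal $\tau$-invariant state on $\mathcal M$, and the following are equivalent: (i) $(\mathcal O_d,\lambda,\psi)$ is ergodic; (ii) $(\mathcal M,\tau,\phi_0)$ is ergodic; (iii) $\mathcal M$ is a factor. **Converse.** Let $v_1,\dots,v_d$ be bounded operators on a Hilbert space $\mathcal K$ with $\sum_kv_kv_k^*=I$, let $\mathcal M=\{v_k,v_k^*\}''$, and suppose that $\mathcal M'=\mathcal B_\tau(\mathcal K)$. (i) For the Popescu dilation of $(v_k)$, i.e. operators $S_1,\dots,S_d$ satisfying the Cuntz relations on a Hilbert space $\mathcal H\supseteq\mathcal K$, with projection $P$ onto $\mathcal K$, such that $PS_k^*P=S_k^*P=v_k^*$ and the vectors $S_If$ ($f\in\mathcal K$) are total in $\mathcal H$, one has $P\in\{S_k,S_k^*:1\le k\le d\}''$. (ii) Let $\phi_0$ be a faithful normal $\tau$-invariant state on $\mathcal M$. There is a unique state $\psi$ on $\mathcal O_d$ with $\psi(s_Is_J^*)=\phi_0(v_Iv_J^*)$ for all finite $I,J$; it is $\lambda$-invariant. If $(\mathcal H,\pi,\Omega)$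 is the GNS representation of $\psi$ and $(\mathcal L,\rho,\xi)$ that of $(\mathcal M,\phi_0)$, then there is an isometry $V:\mathcal L\to\mathcal H$ with $V\xi=\Omega$ whose range projection $VV^*$ is the support projection of $\psi_\Omega$ in $\pi(\mathcal O_d)''$; $\rho(v_k)=V^*\pi(s_k)V$; $\rho(\mathcal M)=\{\rho(v_k),\rho(v_k)^*\}''$; and, with $\mathcal L$ identified with $V\mathcal L$, the system $(\mathcal L,\rho(\mathcal M),\rho(v_k),\langle\xi,\cdot\,\xi\rangle)$ satisfies (a)-(d). **Uniqueness.** For a $\lambda$-invariant state $\psi$, the system $(\mathcal K,\mathcal M,(v_k),\phi_0)$ satisfying (a)-(d) is unique up to unitary conjugation. Precisely: for $j=1,2$ let $(\mathcal H_j,\pi_j,\Omega_j)$ be GNS representations of $\psi$, let $P_j$ be a projection on $\mathcal H_j$ with range $\mathcal K_j\ni\Omega_j$, and let $v_k^{(j)}=P_j\pi_j(s_k)P_j$, $\mathcal M_j=\{v^{(j)}_k,v^{(j)*}_k\}''$ and $\phi_0^{(j)}=\langle\Omega_j,\cdot\,\Omega_j\rangle$ on $\mathcal M_j$ be such that (a)-(d)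 hold. Then there is a unitary $U:\mathcal K_1\to\mathcal K_2$ with $Uv^{(1)}_kU^*=v^{(2)}_k$ for all $k$, $U\mathcal M_1U^*=\mathcal M_2$ and $\phi_0^{(2)}(UxU^*)=\phi_0^{(1)}(x)$ for $x\in\mathcal M_1$. -/

import Mathlib

open scoped InnerProductSpace ComplexOrder ENNReal Topology
open Filter

universe u₁ u₂ u₃ u₄

noncomputable section

/-! ### Cuntz families and the Cuntz algebra -/

/-- A family `w₁, …, w_d` in a unital `*`-algebra satisfies the Cuntz relations
`w_i^* w_j = δ_{ij} 1` and `∑ w_i w_i^* = 1`. -/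
def IsCuntzFamily {A : Type*} [Ring A] [StarRing A] {d : ℕ} (w : Fin d → A) : Prop :=
  (∀ i j, star (w i) * w j = if i = j then 1 else 0) ∧ ∑ i, w i * star (w i) = 1

/-- The map `x ↦ ∑_k w_k x w_k^*` attached to a family `w`. -/
def conjSum {A : Type*} [Ring A] [StarRing A] {d : ℕ} (w : Fin d → A) (x : A) : A :=
  ∑ k, w k * x * star (w k)

/-- `w_I = w_{i_1} ⋯ w_{i_m}` for a finite sequence `I = (i_1, …, i_m)`, with `w_∅ = 1`. -/
def word {A : Type*} [Ring A] {d : ℕ} (w : Fin d → A) (I : List (Fin d)) : A :=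
  (I.map w).prod

/-- The separable infinite-dimensional Hilbert space `ℓ²(ℕ)`. -/
abbrev SeqHilbert : Type := lp (fun _ : ℕ => ℂ) 2

instance : Nontrivial SeqHilbert :=
  ⟨⟨lp.single 2 0 (1 : ℂ), 0, fun h => by
    have := congrArg (fun f : SeqHilbert => f 0) h
    simp at this⟩⟩

/-- All Cuntz families of length `d` of operators on `ℓ²(ℕ)`. -/
def CuntzTuple (d : ℕ) : Type :=
  {t : Fin d → (SeqHilbert →L[ℂ] SeqHilbert) // IsCuntzFamily t}

lemma CuntzTuple.norm_le_one {d : ℕ} (t : CuntzTuple d) (k : Fin d) : ‖t.1 k‖ ≤ 1 := by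
  have h := t.2.1 k k
  rw [if_pos rfl] at h
  have h2 := CStarRing.norm_star_mul_self (x := t.1 k)
  rw [h, norm_one] at h2
  nlinarith [norm_nonneg (t.1 k)]

/-- The `C^*`-algebra of all bounded families of operators on `ℓ²(ℕ)` indexed by the Cuntz tuples,
with the supremum norm and pointwise operations. -/
def CuntzProduct (d : ℕ) : Type :=
  lp (fun _ : CuntzTuple d => SeqHilbert →L[ℂ] SeqHilbert) ∞

/-- The `C^*`-algebra structure of a bounded product of `C^*`-algebras. -/
def lpCStarAlgebra {ι : Type*} (A : ι → Type*) [∀ i, CStarAlgebra (A i)] [∀ i, Nontrivial (A i)] :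
    CStarAlgebra (lp A ∞) where

instance (d : ℕ) : CStarAlgebra (CuntzProduct d) :=
  lpCStarAlgebra fun _ : CuntzTuple d => SeqHilbert →L[ℂ] SeqHilbert

/-- The universal Cuntz family: its component at the Cuntz tuple `t` is `t` itself. -/
def universalTuple (d : ℕ) (k : Fin d) : CuntzProduct d :=
  ⟨fun t => t.1 k, memℓp_infty ⟨1, by rintro _ ⟨t, rfl⟩; exact t.norm_le_one k⟩⟩

/-- The closed `*`-subalgebra generated by the universal Cuntz family. -/
def cuntzSubalgebra (d : ℕ) : StarSubalgebra ℂ (CuntzProduct d) :=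
  (StarAlgebra.adjoin ℂ (Set.range (universalTuple d))).topologicalClosure

/-- The Cuntz algebra `O_d` (for `d ≥ 2`): the `C^*`-algebra generated by the universal Cuntz
family, so that the norm of a `*`-polynomial in the generators is the supremum of its norms over
all Cuntz families on `ℓ²(ℕ)`. This is the universal `C^*`-norm: every nonzero cyclic
representation of the Cuntz relations with `d ≥ 2` acts on a separable Hilbert space of infinite
dimension, and the norm of an operator in a representation is the supremum of the norms of its
restrictions to cyclic subspaces. -/
def CuntzAlgebra (d : ℕ) : Type := cuntzSubalgebra d

instance (d : ℕ) : CStarAlgebra (CuntzAlgebra d) :=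
  StarSubalgebra.cstarAlgebra (cuntzSubalgebra d)
    (h_closed := StarSubalgebra.isClosed_topologicalClosure _)

/-- The generators `s_1, …, s_d` of `O_d`. -/
def cuntzGen (d : ℕ) (k : Fin d) : CuntzAlgebra d :=
  ⟨universalTuple d k, StarSubalgebra.le_topologicalClosure _
    (StarAlgebra.subset_adjoin ℂ _ ⟨k, rfl⟩)⟩

/-- The generators of `O_d` satisfy the Cuntz relations. -/
theorem isCuntzFamily_cuntzGen (d : ℕ) : IsCuntzFamily (cuntzGen d) := by
  have h : IsCuntzFamily (universalTuple d) := by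
    constructor
    · intro i j
      refine Subtype.ext (funext fun t => ?_)
      have h := t.2.1 i j
      split_ifs at h ⊢ <;> exact h
    · refine Subtype.ext (funext fun t => ?_)
      have h := t.2.2
      have e : ∀ u : Finset (Fin d), (∑ i ∈ u, universalTuple d i * star (universalTuple d i) : CuntzProduct d).1 t
          = ∑ i ∈ u, t.1 i * star (t.1 i) := by
        intro u
        induction u using Finset.cons_induction with
        | empty => rfl
        | cons a s ha ih => rw [Finset.sum_cons, Finset.sum_cons, ← ih]; rfl
      exact (e _).trans h
  refine ⟨fun i j => Subtype.ext ?_, Subtype.ext ?_⟩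
  · refine (h.1 i j).trans ?_
    split_ifs <;> rfl
  · refine Eq.trans ?_ h.2
    exact map_sum (cuntzSubalgebra d).subtype (fun i => (cuntzGen d i * star (cuntzGen d i) : CuntzAlgebra d)) Finset.univ

/-- Every Cuntz family on `ℓ²(ℕ)` comes from a representation of `O_d`. -/
theorem exists_cuntzRep {d : ℕ} (t : Fin d → (SeqHilbert →L[ℂ] SeqHilbert))
    (ht : IsCuntzFamily t) : ∃ π : CuntzAlgebra d →⋆ₐ[ℂ] (SeqHilbert →L[ℂ] SeqHilbert),
      ∀ k, π (cuntzGen d k) = t k := by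
  let ev : CuntzProduct d →⋆ₐ[ℂ] (SeqHilbert →L[ℂ] SeqHilbert) :=
    { toFun := fun f => f.1 ⟨t, ht⟩
      map_one' := rfl
      map_mul' := fun _ _ => rfl
      map_zero' := rfl
      map_add' := fun _ _ => rfl
      commutes' := fun _ => rfl
      map_star' := fun _ => rfl }
  exact ⟨ev.comp (cuntzSubalgebra d).subtype, fun k => rfl⟩

/-- The canonical endomorphism `λ(x) = ∑ s_i x s_i^*` of `O_d`. -/
def cuntzEndo (d : ℕ) : CuntzAlgebra d → CuntzAlgebra d := conjSum (cuntzGen d)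

/-! ### States -/

section States

variable {A : Type*} [Ring A] [StarRing A] [Algebra ℂ A]

/-- A state: a positive linear functional taking the value `1` at the unit. -/
def IsState (φ : A →ₗ[ℂ] ℂ) : Prop := φ 1 = 1 ∧ ∀ a, 0 ≤ φ (star a * a)

/-- `φ` is invariant under `T`. -/
def IsInvariantUnder (T : A → A) (φ : A →ₗ[ℂ] ℂ) : Prop := ∀ a, φ (T a) = φ a

def IsFaithful (φ : A →ₗ[ℂ] ℂ) : Prop := ∀ a, φ (star a * a) = 0 → a = 0

/-- `(A, T, φ)` is ergodic: `φ` is an extremal point of the convex set of `T`-invariant states.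
(When `A` is a von Neumann algebra and `φ` is normal, all states occurring in a convex
decomposition of `φ` are normal, so it makes no difference whether only normal states are used.) -/
def IsErgodic (T : A → A) (φ : A →ₗ[ℂ] ℂ) : Prop :=
  φ ∈ Set.extremePoints ℝ {ω : A →ₗ[ℂ] ℂ | IsState ω ∧ IsInvariantUnder T ω}

/-- `(H, π, Ω)` is a GNS triple of `φ`: `Ω` is cyclic for `π` and `φ = ⟨Ω, π(·) Ω⟩`. -/
def IsGNS {H : Type*} [NormedAddCommGroup H] [InnerProductSpace ℂ H] [CompleteSpace H]
    (φ : A →ₗ[ℂ] ℂ) (π : A →⋆ₐ[ℂ] (H →L[ℂ] H)) (Ω : H) : Prop :=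
  (∀ a, ⟪Ω, π a Ω⟫_ℂ = φ a) ∧ DenseRange fun a => π a Ω

end States

/-! ### von Neumann algebras -/

section VN

variable {H : Type*} [NormedAddCommGroup H] [InnerProductSpace ℂ H] [CompleteSpace H]

/-- The von Neumann algebra `(s ∪ s^*)''` generated by a set of operators. -/
def vnGenerated (s : Set (H →L[ℂ] H)) : VonNeumannAlgebra H where
  toStarSubalgebra :=
    StarSubalgebra.centralizer ℂ (StarSubalgebra.centralizer ℂ s : Set (H →L[ℂ] H))
  centralizer_centralizer' := by
    simp

lemma subset_vnGenerated (s : Set (H →L[ℂ] H)) : s ⊆ vnGenerated s := by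
  intro x hx
  change x ∈ (StarSubalgebra.centralizer ℂ
    (StarSubalgebra.centralizer ℂ s : Set (H →L[ℂ] H)) : Set (H →L[ℂ] H))
  rw [StarSubalgebra.coe_centralizer_centralizer]
  exact Set.subset_centralizer_centralizer (Or.inl hx)

/-- The elements of a von Neumann algebra, as a `*`-algebra. -/
abbrev VonNeumannAlgebra.Elem (M : VonNeumannAlgebra H) : Type _ := M.toStarSubalgebra

/-- The functional `x ↦ ⟨ξ, x ξ⟩` on a von Neumann algebra. -/
def vectorFunctional (M : VonNeumannAlgebra H) (ξ : H) : M.Elem →ₗ[ℂ] ℂ where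
  toFun x := ⟪ξ, (x : H →L[ℂ] H) ξ⟫_ℂ
  map_add' x y := by simp
  map_smul' c x := by simp

/-- Normality of a positive functional on a von Neumann algebra: it is a countable sum
`∑ ⟨ξ_n, · ξ_n⟩` of vector functionals with `∑ ‖ξ_n‖² < ∞`. -/
def IsNormalFunctional (M : VonNeumannAlgebra H) (φ : M.Elem →ₗ[ℂ] ℂ) : Prop :=
  ∃ ξ : ℕ → H, (Summable fun n => ‖ξ n‖ ^ 2) ∧
    ∀ x : M.Elem, HasSum (fun n => ⟪ξ n, (x : H →L[ℂ] H) (ξ n)⟫_ℂ) (φ x)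

/-- `P` is the support projection in `M` of the state `φ`: the smallest projection `p` of `M`
with `φ(p) = φ(1)`. -/
def IsSupportProjection (M : VonNeumannAlgebra H) (φ : M.Elem →ₗ[ℂ] ℂ) (P : H →L[ℂ] H) : Prop :=
  ∃ p : M.Elem, (p : H →L[ℂ] H) = P ∧ IsStarProjection p ∧ φ p = φ 1 ∧
    ∀ q : M.Elem, IsStarProjection q → φ q = φ 1 → P ≤ (q : H →L[ℂ] H)

/-- The support projection of a vector functional exists. -/
theorem exists_supportProjection (M : VonNeumannAlgebra H) (ξ : H) :
    ∃ (K : Submodule ℂ H) (_ : CompleteSpace K), IsSupportProjection M (vectorFunctional M ξ) K.starProjection := by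
  let K : Submodule ℂ H := (Submodule.span ℂ {x | ∃ y ∈ M.commutant, x = y ξ}).topologicalClosure
  have hc : CompleteSpace K := (Submodule.isClosed_topologicalClosure _).completeSpace_coe
  have hsub : ∀ y ∈ M.commutant, y ξ ∈ K := fun y hy =>
    Submodule.le_topologicalClosure _ (Submodule.subset_span ⟨y, hy, rfl⟩)
  have hξ : ξ ∈ K := by simpa using hsub 1 (one_mem _)
  have hmem : K.starProjection ∈ M := by
    rw [VonNeumannAlgebra.IsStarProjection.mem_iff isStarProjection_starProjection]
    intro y hy
    rw [Submodule.range_starProjection, Module.End.mem_invtSubmodule]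
    intro x hx
    have hm : Set.MapsTo y (Submodule.span ℂ {x | ∃ y ∈ M.commutant, x = y ξ} : Set H) (Submodule.span ℂ {x | ∃ y ∈ M.commutant, x = y ξ} : Set H) := by
      intro z hz
      induction hz using Submodule.span_induction with
      | mem z hz => obtain ⟨w, hw, rfl⟩ := hz; exact Submodule.subset_span ⟨y * w, mul_mem hy hw, rfl⟩
      | zero => simp
      | add a b _ _ ha hb => simpa using add_mem ha hb
      | smul c a _ ha => simpa using Submodule.smul_mem _ c ha
    exact hm.closure y.continuous hx
  have key : ∀ q : H →L[ℂ] H, IsStarProjection q → ⟪ξ, q ξ⟫_ℂ = ⟪ξ, ξ⟫_ℂ → q ξ = ξ := by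
    intro q hq h
    have h1 : ⟪q ξ, q ξ⟫_ℂ = ⟪ξ, q ξ⟫_ℂ := by
      have := ContinuousLinearMap.adjoint_inner_right q ξ (q ξ)
      rw [← ContinuousLinearMap.star_eq_adjoint, hq.isSelfAdjoint.star_eq] at this
      rw [← this]; congr 1
      exact congrArg (fun f : H →L[ℂ] H => f ξ) hq.isIdempotentElem
    have h2 : ⟪q ξ, ξ⟫_ℂ = ⟪ξ, ξ⟫_ℂ := by
      rw [← inner_conj_symm, h, inner_conj_symm]
    have : ⟪q ξ - ξ, q ξ - ξ⟫_ℂ = 0 := by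
      rw [inner_sub_left, inner_sub_right, inner_sub_right, h1, h, h2]; ring
    exact sub_eq_zero.1 (inner_self_eq_zero.1 this)
  refine ⟨K, hc, ⟨K.starProjection, hmem⟩, rfl, ?_, ?_, ?_⟩
  · exact ⟨Subtype.ext isStarProjection_starProjection.isIdempotentElem, Subtype.ext isStarProjection_starProjection.isSelfAdjoint⟩
  · show ⟪ξ, K.starProjection ξ⟫_ℂ = ⟪ξ, ξ⟫_ℂ
    rw [Submodule.starProjection_eq_self_iff.2 hξ]
  · intro q hq h
    have hq' : IsStarProjection (q : H →L[ℂ] H) := ⟨congrArg Subtype.val hq.isIdempotentElem, congrArg Subtype.val hq.isSelfAdjoint⟩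
    have hqξ := key q hq' h
    have hfix : ∀ x ∈ K, (q : H →L[ℂ] H) x = x := by
      intro x hx
      have hcl : IsClosed {x | (q : H →L[ℂ] H) x = x} := isClosed_eq (by fun_prop) continuous_id
      refine closure_minimal (s := (Submodule.span ℂ {x | ∃ y ∈ M.commutant, x = y ξ} : Set H)) ?_ hcl hx
      intro z hz
      induction hz using Submodule.span_induction with
      | mem z hz =>
        obtain ⟨w, hw, rfl⟩ := hz
        have := VonNeumannAlgebra.mem_commutant_iff.1 hw q q.2
        calc (q : H →L[ℂ] H) (w ξ) = w ((q : H →L[ℂ] H) ξ) := congrArg (fun f : H →L[ℂ] H => f ξ) this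
          _ = w ξ := by rw [hqξ]
      | zero => simp
      | add a b _ _ ha hb => simp_all
      | smul c a _ ha => simp_all
    rw [isStarProjection_starProjection.le_iff_mul_eq_right hq']
    ext x
    exact hfix _ (Submodule.coe_mem _)

/-- `M` is a factor: its centre `M ∩ M'` is trivial. -/
def VonNeumannAlgebra.IsFactor (M : VonNeumannAlgebra H) : Prop :=
  ∀ x ∈ M, x ∈ M.commutant → ∃ c : ℂ, x = c • (1 : H →L[ℂ] H)

/-- The von Neumann algebra `π(A)''` of a representation. -/
def repVN {A : Type*} [Ring A] [StarRing A] [Algebra ℂ A] (π : A →⋆ₐ[ℂ] (H →L[ℂ] H)) :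
    VonNeumannAlgebra H := vnGenerated (Set.range π)

/-- The von Neumann algebra `{v_k, v_k^* : k}''` generated by a family of operators. -/
def familyVN {d : ℕ} (v : Fin d → (H →L[ℂ] H)) : VonNeumannAlgebra H :=
  vnGenerated (Set.range v)

/-- `v_k` as an element of `{v_k, v_k^* : k}''`. -/
def famElem {d : ℕ} (v : Fin d → (H →L[ℂ] H)) (k : Fin d) : (familyVN v).Elem :=
  ⟨v k, subset_vnGenerated _ ⟨k, rfl⟩⟩

/-- The Markov map `τ(x) = ∑ v_k x v_k^*` on `{v_k, v_k^* : k}''`. -/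
def markovMap {d : ℕ} (v : Fin d → (H →L[ℂ] H)) : (familyVN v).Elem → (familyVN v).Elem :=
  conjSum (famElem v)

end VN

/-! ### Compression to a subspace -/

section Compression

variable {H : Type*} [NormedAddCommGroup H] [InnerProductSpace ℂ H] [CompleteSpace H]
  {K : Type*} [NormedAddCommGroup K] [InnerProductSpace ℂ K] [CompleteSpace K]

/-- The projection `V V^*` of `H` onto the range of an isometric embedding `V : K → H`. -/
def rangeProj (V : K →ₗᵢ[ℂ] H) : H →L[ℂ] H :=
  V.toContinuousLinearMap ∘L V.toContinuousLinearMap.adjoint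

/-- The operator `V^* X V` on `K`. If `V` is the inclusion of the range `K` of a projection `P`, it
is `P X P` seen as an operator on `K`. -/
def compress (V : K →ₗᵢ[ℂ] H) (X : H →L[ℂ] H) : K →L[ℂ] K :=
  V.toContinuousLinearMap.adjoint ∘L X ∘L V.toContinuousLinearMap

/-- `K` (embedded in `H` by `V`) and the family `S` form a Popescu dilation of the family `v` on
`K`: `S` satisfies the Cuntz relations, `S_k^* V = V v_k^*`, that is `P S_k^* P = S_k^* P = v_k^*`
for the projection `P` onto `K`, and the vectors `S_I f`, `f ∈ K`, are total in `H`. -/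
structure IsPopescuDilation {d : ℕ} (v : Fin d → (K →L[ℂ] K)) (V : K →ₗᵢ[ℂ] H)
    (S : Fin d → (H →L[ℂ] H)) : Prop where
  cuntz : IsCuntzFamily S
  intertwine : ∀ k f, star (S k) (V f) = V (star (v k) f)
  total : Dense (Submodule.span ℂ {x : H | ∃ I f, x = word S I (V f)} : Set H)

/-- The defining properties of a system `(K, M, v, φ₀)` for a state `ψ` of `O_d`, where `K` is embedded by `V` in the Hilbert space `H`
of a GNS triple `(H, π, Ω)` of `ψ`. Here `S_k = π(s_k)`, `P = V V^*` is the projection onto `K`,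
`Λ(X) = ∑ S_k X S_k^*`, `M = {v_k, v_k^*}''`, `φ₀ = ⟨ω, · ω⟩` on `M`, and `ω` is
`Ω` regarded as a vector of `K`. -/
structure IsSupportSystem {d : ℕ} (ψ : CuntzAlgebra d →ₗ[ℂ] ℂ)
    (π : CuntzAlgebra d →⋆ₐ[ℂ] (H →L[ℂ] H)) (Ω : H)
    (V : K →ₗᵢ[ℂ] H) (v : Fin d → (K →L[ℂ] K)) (ω : K) : Prop where
  embed : V ω = Ω
  v_eq : ∀ k, v k = compress V (π (cuntzGen d k))
  /-- `P ∈ π(O_d)''` is sub-harmonic, `Λ(P) ≥ P`. -/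
  proj_mem : rangeProj V ∈ repVN π
  subharmonic : rangeProj V ≤ conjSum (fun k => π (cuntzGen d k)) (rangeProj V)
  /-- `Λⁿ(P) ↑ I`: the sequence is increasing and converges strongly to `I`. -/
  iterate_mono : Monotone fun n : ℕ =>
    (conjSum fun k => π (cuntzGen d k))^[n] (rangeProj V)
  iterate_tendsto : ∀ x : H, Tendsto
    (fun n : ℕ => (conjSum fun k => π (cuntzGen d k))^[n] (rangeProj V) x) atTop (𝓝 x)
  /-- `P S_k^* P = S_k^* P`. -/
  coinvariant : ∀ k, rangeProj V * star (π (cuntzGen d k)) * rangeProj V =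
    star (π (cuntzGen d k)) * rangeProj V
  sum_eq_one : ∑ k, v k * star (v k) = 1
  moments : ∀ I J, ψ (word (cuntzGen d) I * star (word (cuntzGen d) J)) =
    ⟪ω, (word v I * star (word v J)) ω⟫_ℂ
  total : Dense (Submodule.span ℂ
    {x : H | ∃ I f, x = word (fun k => π (cuntzGen d k)) I (V f)} : Set H)
  /-- `P π(O_d)'' P`, as a set of operators on `K`, is the von Neumann algebra `M`
  generated by the `v_k`, and `φ₀` is faithful on `M`. -/
  corner : compress V '' (repVN π : Set (H →L[ℂ] H)) = (familyVN v : Set (K →L[ℂ] K))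
  faithful : IsFaithful (vectorFunctional (familyVN v) ω)
  /-- `X ↦ P X P` maps the self-adjoint part of `π(O_d)'` bijectively onto the self-adjoint
  part of `{x ∈ B(K) : ∑ v_k x v_k^* = x}`, preserving the norm and the order in both
  directions; and the latter space is `M'`. -/
  lift_bij : Set.BijOn (compress V)
    {X | X ∈ Set.centralizer (Set.range π) ∧ IsSelfAdjoint X}
    {D | conjSum v D = D ∧ IsSelfAdjoint D}
  lift_norm : ∀ X ∈ Set.centralizer (Set.range π), IsSelfAdjoint X → ‖compress V X‖ = ‖X‖
  lift_order : ∀ X ∈ Set.centralizer (Set.range π), ∀ Y ∈ Set.centralizer (Set.range π),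
    IsSelfAdjoint X → IsSelfAdjoint Y → (compress V X ≤ compress V Y ↔ X ≤ Y)
  commutant_eq : ((familyVN v).commutant : Set (K →L[ℂ] K)) = {x | conjSum v x = x}

end Compression

end

/-!
The converse part and the structure theory rest on one mechanism. If `V : K → H` is a Popescu
dilation of `(v_k)` to a Cuntz family `(S_k)`, with projection `P = V V^*`, then `Λⁿ(P)` increases
strongly to `1`, so that a fixed point `X` of `Λ` is the strong limit of `Λⁿ(P X P)` and is determined,
with its norm and its order, by its compression to `K`. Conversely each fixed point `D` of `τ` is the
compression of a weak limit point of `Λⁿ(V D V^*)` (`IsPopescuDilation.exists_lift`). As the fixed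
points of `Λ` are the commutant of the `S_k`, compression is a bijection of `{S_k, S_k^*}'` onto the
fixed points `B_τ(K)`. The condition `P ∈ {S_k, S_k^*}''` is then equivalent to `M' = B_τ(K)`
(`IsPopescuDilation.commutant_eq`, `IsPopescuDilation.rangeProj_mem`), and implies that the corner of
`{S_k, S_k^*}''` is `M` (`IsPopescuDilation.corner_eq`).

For the direct part, invariance of `ψ` extends to `π(O_d)''`: by invariance, `π(a) Ω ↦ π(a) S_k^* Ω`
is contractive and defines an operator of the commutant (`exists_commutant_apply_eq`). So `Λ(P)` has
full expectation and dominates the support projection `P`, which says that `S_k^*` leaves `P H`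
invariant (`isCuntzDilation_of_isSupportProjection`); cyclicity of `Ω` makes the dilation minimal.
Being a factor is the same as having only scalar fixed points of `Λ` in `π(O_d)''`, or of `τ` in
`M`. Scalar fixed points give extremality, since an invariant state dominated by `φ` is computed from
weak limits of Cesàro means, which are scalars (`eq_of_dominated`); conversely a nontrivial central
element perturbs the state (`inner_eq_zero_of_isErgodic`).

For the converse, the GNS representation `ρ` of the normal faithful state `φ₀` is a subrepresentation
of a multiple of the identity representation. Intertwiners carry the identity `M' = B_τ` over to
`ρ` (`commutant_gns_eq`), show that `ρ(M)` is a von Neumann algebra (`range_eq_repVN`), and make the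
GNS space `L` separable. Hence `(ρ(v_k))` dilates to a Cuntz family on `ℓ²(ℕ)`
(`exists_isCuntzDilation_seqHilbert`), which is a representation of the Cuntz algebra, and its vector
state is the required `ψ`. The projection onto the cyclic subspace of `ψ` in this model compresses on
`L` to a fixed point of the Markov map, that is, to an element of `ρ(M)'` fixing the cyclic vector, hence
to `1`; so `L` lies in the GNS space of `ψ` (`exists_isometry_isCuntzDilation`), and the first
paragraph applies. Uniqueness holds because the small space of any such system is the range of the
support projection of `ψ` (`IsSupportSystem.isSupportProjection`).
-/

/-! ### Extension of maps defined on total families -/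

section Extension

variable {A : Type*} [AddCommGroup A] [Module ℂ A]
  {E : Type*} [NormedAddCommGroup E] [InnerProductSpace ℂ E]
  {F : Type*} [NormedAddCommGroup F] [InnerProductSpace ℂ F]

/-- A linear map `g` dominated by a linear map `f` into a Hilbert space factors through `f` by a
bounded operator; off the closure of the range of `f` it is extended by zero. -/
theorem exists_clm_comp_eq [CompleteSpace E] [CompleteSpace F] (f : A →ₗ[ℂ] E) (g : A →ₗ[ℂ] F) (C : ℝ)
    (h : ∀ a, ‖g a‖ ≤ C * ‖f a‖) : ∃ W : E →L[ℂ] F, ∀ a, W (f a) = g a := by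
  let R : Submodule ℂ E := (LinearMap.range f).topologicalClosure
  have hRc : IsClosed (R : Set E) := Submodule.isClosed_topologicalClosure _
  have : CompleteSpace R := hRc.completeSpace_coe
  have hfR : ∀ a, f a ∈ R := fun a => Submodule.le_topologicalClosure _ ⟨a, rfl⟩
  let f' : A →ₗ[ℂ] R := f.codRestrict R hfR
  have hd : DenseRange f' := by
    intro x
    have hx : (x : E) ∈ closure (Set.range f) := x.2
    rw [Metric.mem_closure_iff] at hx ⊢
    intro ε hε
    obtain ⟨_, ⟨a, rfl⟩, ha⟩ := hx ε hε
    exact ⟨f' a, ⟨a, rfl⟩, ha⟩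
  refine ⟨(LinearMap.extendOfNorm g f') ∘L R.orthogonalProjectionOnto, fun a => ?_⟩
  have h1 : R.orthogonalProjectionOnto (f a) = f' a :=
    Submodule.orthogonalProjectionOnto_mem_subspace_eq_self (f' a)
  rw [ContinuousLinearMap.comp_apply, h1]
  exact LinearMap.extendOfNorm_eq hd ⟨C, h⟩ a

theorem inner_linearCombination {ι : Type*} (e : ι → E) (g : ι → F)
    (h : ∀ i j, ⟪e i, e j⟫_ℂ = ⟪g i, g j⟫_ℂ) (c c' : ι →₀ ℂ) :
    ⟪Finsupp.linearCombination ℂ e c, Finsupp.linearCombination ℂ e c'⟫_ℂ =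
      ⟪Finsupp.linearCombination ℂ g c, Finsupp.linearCombination ℂ g c'⟫_ℂ := by
  simp only [Finsupp.linearCombination_apply, Finsupp.sum_inner, Finsupp.inner_sum,
    inner_smul_left, inner_smul_right, h]

theorem dense_of_dense_subset_range {ι : Type*} (e : ι → E)
    (he : Dense (Submodule.span ℂ (Set.range e) : Set E)) :
    DenseRange (Finsupp.linearCombination ℂ e) := by
  rw [← Finsupp.range_linearCombination] at he
  exact he

/-- Two families with the same Gram matrix, the first one total, are related by an isometry. -/
theorem exists_linearIsometry_of_gram [CompleteSpace E] [CompleteSpace F] {ι : Type*} (e : ι → E) (g : ι → F)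
    (h : ∀ i j, ⟪e i, e j⟫_ℂ = ⟪g i, g j⟫_ℂ)
    (he : Dense (Submodule.span ℂ (Set.range e) : Set E)) :
    ∃ V : E →ₗᵢ[ℂ] F, ∀ i, V (e i) = g i := by
  have hn : ∀ c, ‖Finsupp.linearCombination ℂ g c‖ = ‖Finsupp.linearCombination ℂ e c‖ := by
    intro c
    have := inner_linearCombination e g h c c
    rw [inner_self_eq_norm_sq_to_K, inner_self_eq_norm_sq_to_K] at this
    have h2 : ‖Finsupp.linearCombination ℂ e c‖ ^ 2 = ‖Finsupp.linearCombination ℂ g c‖ ^ 2 := by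
      exact_mod_cast this
    exact ((sq_eq_sq₀ (norm_nonneg _) (norm_nonneg _)).1 h2).symm
  obtain ⟨W, hW⟩ := exists_clm_comp_eq (Finsupp.linearCombination ℂ e)
    (Finsupp.linearCombination ℂ g) 1 (fun c => by rw [one_mul, hn])
  have hWn : ∀ x, ‖W x‖ = ‖x‖ := by
    intro x
    refine isClosed_property (dense_of_dense_subset_range e he)
      (isClosed_eq (f := fun x => ‖W x‖) (g := fun x => ‖x‖) (by fun_prop) (by fun_prop))
      (fun c => ?_) x
    rw [hW, hn]
  refine ⟨⟨W.toLinearMap, hWn⟩, fun i => ?_⟩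
  have := hW (Finsupp.single i 1)
  simpa using this

/-- Two total families with the same Gram matrix are related by a unitary. -/
theorem exists_linearIsometryEquiv_of_gram [CompleteSpace E] [CompleteSpace F] {ι : Type*} (e : ι → E) (g : ι → F)
    (h : ∀ i j, ⟪e i, e j⟫_ℂ = ⟪g i, g j⟫_ℂ)
    (he : Dense (Submodule.span ℂ (Set.range e) : Set E))
    (hg : Dense (Submodule.span ℂ (Set.range g) : Set F)) :
    ∃ V : E ≃ₗᵢ[ℂ] F, ∀ i, V (e i) = g i := by
  obtain ⟨V, hV⟩ := exists_linearIsometry_of_gram e g h he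
  have hs : Function.Surjective V := by
    have hcl : IsClosed (Set.range V) := V.isometry.isClosedEmbedding.isClosed_range
    have hsub : (Submodule.span ℂ (Set.range g) : Set F) ⊆ Set.range V := by
      have : Submodule.span ℂ (Set.range g) ≤ LinearMap.range V.toLinearMap := by
        rw [Submodule.span_le]
        rintro _ ⟨i, rfl⟩
        exact ⟨e i, hV i⟩
      exact fun x hx => this hx
    exact Set.range_eq_univ.1 (Set.eq_univ_of_univ_subset
      (hg.closure_eq ▸ hcl.closure_subset_iff.2 hsub))
  exact ⟨LinearIsometryEquiv.ofSurjective V hs, hV⟩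

/-- Two isometries with the same range differ by a unitary of their domains. -/
theorem exists_linearIsometryEquiv_of_range_eq
    {G : Type*} [NormedAddCommGroup G] [InnerProductSpace ℂ G]
    (V : E →ₗᵢ[ℂ] G) (W : F →ₗᵢ[ℂ] G) (h : Set.range V = Set.range W) :
    ∃ U : E ≃ₗᵢ[ℂ] F, ∀ x, W (U x) = V x := by
  have hx : ∀ x, ∃ y, W y = V x := fun x => by
    have : V x ∈ Set.range W := h ▸ ⟨x, rfl⟩
    exact this
  choose u hu using hx
  have hs : Function.Surjective u := fun y => by
    obtain ⟨x, hx⟩ : W y ∈ Set.range V := h ▸ ⟨y, rfl⟩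
    exact ⟨x, W.injective (by rw [hu, hx])⟩
  let U : E →ₗᵢ[ℂ] F :=
    { toFun := u
      map_add' := fun x y => W.injective (by simp [hu])
      map_smul' := fun c x => W.injective (by simp [hu])
      norm_map' := fun x => by
        show ‖u x‖ = ‖x‖
        rw [← W.norm_map, hu, V.norm_map] }
  exact ⟨LinearIsometryEquiv.ofSurjective U hs, hu⟩

end Extension

/-! ### Weak limits of bounded sequences of operators -/

section WeakLimit

variable {H : Type*} [NormedAddCommGroup H] [InnerProductSpace ℂ H] [CompleteSpace H]

/-- A bounded sequence of operators converges along an ultrafilter in the weak operator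
topology. -/
theorem exists_weak_limit (U : Ultrafilter ℕ) (a : ℕ → (H →L[ℂ] H)) (C : ℝ)
    (ha : ∀ n, ‖a n‖ ≤ C) :
    ∃ z : H →L[ℂ] H, ∀ x y, Tendsto (fun n => ⟪x, a n y⟫_ℂ) U (𝓝 ⟪x, z y⟫_ℂ) := by
  have hC : 0 ≤ C := (norm_nonneg _).trans (ha 0)
  have hb : ∀ n x y, ‖⟪a n x, y⟫_ℂ‖ ≤ C * ‖x‖ * ‖y‖ := fun n x y =>
    (norm_inner_le_norm _ _).trans (by
      gcongr
      exact (a n).le_of_opNorm_le (ha n) x)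
  have hlim : ∀ x y, ∃ l : ℂ, ‖l‖ ≤ C * ‖x‖ * ‖y‖ ∧
      Tendsto (fun n => ⟪a n x, y⟫_ℂ) U (𝓝 l) := by
    intro x y
    have hK : IsCompact (Metric.closedBall (0 : ℂ) (C * ‖x‖ * ‖y‖)) := isCompact_closedBall _ _
    obtain ⟨l, hl, hle⟩ := hK.ultrafilter_le_nhds (U.map fun n => ⟪a n x, y⟫_ℂ) (by
      rw [Filter.le_principal_iff]
      refine Filter.mem_map.2 (Filter.univ_mem' fun n => ?_)
      simpa using hb n x y)
    exact ⟨l, by simpa using hl, hle⟩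
  choose l hl hlt using hlim
  let B₀ : H →ₗ⋆[ℂ] H →ₗ[ℂ] ℂ := LinearMap.mk₂'ₛₗ (starRingEnd ℂ) (RingHom.id ℂ) l
    (fun x x' y => tendsto_nhds_unique (hlt (x + x') y) (by
      simpa [inner_add_left] using (hlt x y).add (hlt x' y)))
    (fun c x y => tendsto_nhds_unique (hlt (c • x) y) (by
      simpa [inner_smul_left, mul_comm] using (hlt x y).const_mul (starRingEnd ℂ c)))
    (fun x y y' => tendsto_nhds_unique (hlt x (y + y')) (by
      simpa [inner_add_right] using (hlt x y).add (hlt x y')))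
    (fun c x y => tendsto_nhds_unique (hlt x (c • y)) (by
      simpa [inner_smul_right] using (hlt x y).const_mul c))
  let B : H →L⋆[ℂ] H →L[ℂ] ℂ := B₀.mkContinuous₂ C hl
  refine ⟨InnerProductSpace.continuousLinearMapOfBilin B, fun x y => ?_⟩
  have h1 : ⟪InnerProductSpace.continuousLinearMapOfBilin B y, x⟫_ℂ = l y x :=
    InnerProductSpace.continuousLinearMapOfBilin_apply B y x
  rw [← inner_conj_symm, h1]
  exact ((Complex.continuous_conj.tendsto _).comp (hlt y x)).congr fun n => inner_conj_symm _ _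

end WeakLimit

/-! ### Words and the conjugation map -/

section Words

variable {A : Type*} [Ring A] {d : ℕ}

@[simp] theorem word_nil (w : Fin d → A) : word w [] = 1 := by simp [word]

@[simp] theorem word_cons (w : Fin d → A) (k : Fin d) (I : List (Fin d)) :
    word w (k :: I) = w k * word w I := by simp [word]

theorem word_append (w : Fin d → A) (I J : List (Fin d)) :
    word w (I ++ J) = word w I * word w J := by simp [word]

theorem map_word {B F : Type*} [Ring B] [FunLike F A B] [MonoidHomClass F A B]
    (π : F) (w : Fin d → A) (I : List (Fin d)) :
    π (word w I) = word (fun k => π (w k)) I := by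
  simp [word, map_list_prod, Function.comp_def]

variable [StarRing A]

theorem map_conjSum [Algebra ℂ A] {B : Type*} [Ring B] [StarRing B] [Algebra ℂ B] (π : A →⋆ₐ[ℂ] B)
    (w : Fin d → A) (x : A) : π (conjSum w x) = conjSum (fun k => π (w k)) (π x) := by
  simp [conjSum, map_star]

theorem conjSum_add (w : Fin d → A) (x y : A) :
    conjSum w (x + y) = conjSum w x + conjSum w y := by
  simp [conjSum, mul_add, add_mul, Finset.sum_add_distrib]

theorem conjSum_sub (w : Fin d → A) (x y : A) :
    conjSum w (x - y) = conjSum w x - conjSum w y := by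
  simp [conjSum, mul_sub, sub_mul, Finset.sum_sub_distrib]

theorem conjSum_smul [Algebra ℂ A] (w : Fin d → A) (c : ℂ) (x : A) :
    conjSum w (c • x) = c • conjSum w x := by
  simp [conjSum, Finset.smul_sum]

theorem star_conjSum (w : Fin d → A) (x : A) : star (conjSum w x) = conjSum w (star x) := by
  simp [conjSum, mul_assoc]

theorem conjSum_one {w : Fin d → A} (h : ∑ k, w k * star (w k) = 1) : conjSum w 1 = 1 := by
  simpa [conjSum] using h

theorem conjSum_word_mul_star_word (w : Fin d → A) (I J : List (Fin d)) :
    conjSum w (word w I * star (word w J)) = ∑ k, word w (k :: I) * star (word w (k :: J)) := by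
  simp only [conjSum, word_cons, star_mul, mul_assoc]

theorem conjSum_eq_self_of_commute {w : Fin d → A} (h : ∑ k, w k * star (w k) = 1) {x : A}
    (hx : ∀ k, w k * x = x * w k) : conjSum w x = x := by
  simp only [conjSum, hx]
  simp only [mul_assoc, ← Finset.mul_sum, h, mul_one]

theorem conjSum_mul_left {w : Fin d → A} {x : A} (hx : ∀ k, w k * x = x * w k) (y : A) :
    conjSum w (x * y) = x * conjSum w y := by
  simp only [conjSum, Finset.mul_sum, ← mul_assoc, hx]

namespace IsCuntzFamily

variable {w : Fin d → A} (hw : IsCuntzFamily w)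
include hw

theorem star_mul_conjSum (k : Fin d) (x : A) : star (w k) * conjSum w x = x * star (w k) := by
  simp only [conjSum, Finset.mul_sum, ← mul_assoc, hw.1]
  simp

theorem conjSum_mul_gen (k : Fin d) (x : A) : conjSum w x * w k = w k * x := by
  simp only [conjSum, Finset.sum_mul, mul_assoc, hw.1]
  simp

theorem conjSum_mul (x y : A) : conjSum w (x * y) = conjSum w x * conjSum w y := by
  conv_rhs => rw [conjSum, Finset.sum_mul]
  simp only [mul_assoc, hw.star_mul_conjSum]
  simp [conjSum, mul_assoc]

end IsCuntzFamily

variable [Algebra ℂ A]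

/-- The linear span of the elements `w_I w_J^*`. -/
def wordSpan (w : Fin d → A) : Submodule ℂ A :=
  Submodule.span ℂ {x | ∃ I J, x = word w I * star (word w J)}

theorem gen_mul_mem_wordSpan (w : Fin d → A) (k : Fin d) {x : A} (hx : x ∈ wordSpan w) :
    w k * x ∈ wordSpan w := by
  induction hx using Submodule.span_induction with
  | mem x h =>
    obtain ⟨I, J, rfl⟩ := h
    exact Submodule.subset_span ⟨k :: I, J, by simp [mul_assoc]⟩
  | zero => simp
  | add x y _ _ hx hy => rw [mul_add]; exact add_mem hx hy
  | smul c x _ hx => rw [mul_smul_comm]; exact Submodule.smul_mem _ c hx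

namespace IsCuntzFamily

variable {w : Fin d → A} (hw : IsCuntzFamily w)
include hw

theorem star_gen_mul_mem_wordSpan (k : Fin d) {x : A} (hx : x ∈ wordSpan w) :
    star (w k) * x ∈ wordSpan w := by
  induction hx using Submodule.span_induction with
  | mem x h =>
    obtain ⟨I, J, rfl⟩ := h
    cases I with
    | nil => exact Submodule.subset_span ⟨[], J ++ [k], by simp [word_append]⟩
    | cons i I =>
      rw [word_cons, ← mul_assoc, ← mul_assoc, hw.1]
      split_ifs
      · exact Submodule.subset_span ⟨I, J, by simp⟩
      · simp
  | zero => simp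
  | add x y _ _ hx hy => rw [mul_add]; exact add_mem hx hy
  | smul c x _ hx => rw [mul_smul_comm]; exact Submodule.smul_mem _ c hx

theorem adjoin_le_wordSpan [StarModule ℂ A] {x : A}
    (hx : x ∈ StarAlgebra.adjoin ℂ (Set.range w)) : x ∈ wordSpan w := by
  have key : ∀ y ∈ wordSpan w, x * y ∈ wordSpan w := by
    refine Algebra.adjoin_induction (p := fun x _ => ∀ y ∈ wordSpan w, x * y ∈ wordSpan w)
      ?_ ?_ ?_ ?_ hx
    · rintro x (⟨k, rfl⟩ | hx)
      · exact fun y hy => gen_mul_mem_wordSpan w k hy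
      · obtain ⟨k, hk⟩ := hx
        obtain rfl : star (w k) = x := by rw [hk, star_star]
        exact fun y hy => hw.star_gen_mul_mem_wordSpan k hy
    · intro r y hy
      rw [← Algebra.smul_def]
      exact Submodule.smul_mem _ r hy
    · intro a b _ _ ha hb y hy; rw [add_mul]; exact add_mem (ha y hy) (hb y hy)
    · intro a b _ _ ha hb y hy; rw [mul_assoc]; exact ha _ (hb y hy)
  simpa using key 1 (Submodule.subset_span ⟨[], [], by simp⟩)

end IsCuntzFamily

end Words

/-! ### Density of the words in the Cuntz algebra -/

section CuntzAlgebra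

variable {d : ℕ}

/-- The words `s_I s_J^*` span a dense subspace of the Cuntz algebra, by the Cuntz relations and
the definition of the algebra as a closed `*`-subalgebra. -/
theorem CuntzAlgebra.mem_of_isClosed (T : Submodule ℂ (CuntzAlgebra d))
    (hT : IsClosed (T : Set (CuntzAlgebra d))) (h : wordSpan (cuntzGen d) ≤ T) (a : CuntzAlgebra d) :
    a ∈ T := by
  let ι : CuntzAlgebra d →⋆ₐ[ℂ] CuntzProduct d := (cuntzSubalgebra d).subtype
  have hι : ∀ x y, dist (ι x) (ι y) = dist x y := fun x y => rfl
  have hgen : ∀ k, ι (cuntzGen d k) = universalTuple d k := fun k => rfl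
  have hu : IsCuntzFamily (universalTuple d) := by
    have h0 := isCuntzFamily_cuntzGen d
    refine ⟨fun i j => ?_, ?_⟩
    · rw [← hgen, ← hgen, ← map_star, ← map_mul, h0.1]
      split_ifs <;> simp
    · simp_rw [← hgen, ← map_star, ← map_mul, ← map_sum, h0.2, map_one]
  have hspan : ∀ y ∈ wordSpan (universalTuple d), ∃ t ∈ wordSpan (cuntzGen d), ι t = y := by
    intro y hy
    have hle : wordSpan (universalTuple d) ≤
        (wordSpan (cuntzGen d)).map ι.toAlgHom.toLinearMap := by
      rw [wordSpan, Submodule.span_le]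
      rintro _ ⟨I, J, rfl⟩
      refine ⟨_, Submodule.subset_span ⟨I, J, rfl⟩, ?_⟩
      have : ι (word (cuntzGen d) I * star (word (cuntzGen d) J)) =
          word (universalTuple d) I * star (word (universalTuple d) J) := by
        rw [map_mul, map_star, map_word, map_word]
        rfl
      exact this
    exact hle hy
  have ha : ι a ∈ closure ((StarAlgebra.adjoin ℂ (Set.range (universalTuple d)) :
      StarSubalgebra ℂ (CuntzProduct d)) : Set (CuntzProduct d)) := a.2
  rw [← SetLike.mem_coe, ← hT.closure_eq]
  rw [Metric.mem_closure_iff] at ha ⊢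
  intro ε hε
  obtain ⟨y, hy, hlt⟩ := ha ε hε
  obtain ⟨t, ht, rfl⟩ := hspan y (hu.adjoin_le_wordSpan hy)
  exact ⟨t, h ht, hι a t ▸ hlt⟩

/-- Positivity alone makes a state continuous, since the order of a `C^*`-algebra is given by the
elements `a^* a`. -/
theorem IsState.continuous {A : Type*} [CStarAlgebra A] {ψ : A →ₗ[ℂ] ℂ} (hψ : IsState ψ) :
    Continuous ψ := by
  let _ : PartialOrder A := CStarAlgebra.spectralOrder A
  have : StarOrderedRing A := CStarAlgebra.spectralOrderedRing A
  let f : A →ₚ[ℂ] ℂ := PositiveLinearMap.mk₀ ψ (by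
    intro a ha
    obtain ⟨b, rfl⟩ := CStarAlgebra.nonneg_iff_eq_star_mul_self.1 ha
    exact hψ.2 b)
  have : Continuous f := map_continuous f
  exact this

/-- A continuous linear map on the Cuntz algebra is determined by its values on `s_I s_J^*`. -/
theorem CuntzAlgebra.ext_of_continuous {F : Type*} [AddCommGroup F] [Module ℂ F]
    [TopologicalSpace F] [T2Space F]
    {f g : CuntzAlgebra d →ₗ[ℂ] F} (hf : Continuous f) (hg : Continuous g)
    (h : ∀ I J, f (word (cuntzGen d) I * star (word (cuntzGen d) J)) =
      g (word (cuntzGen d) I * star (word (cuntzGen d) J))) : f = g := by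
  ext a
  refine CuntzAlgebra.mem_of_isClosed (LinearMap.eqLocus f g) (isClosed_eq hf hg) ?_ a
  rw [wordSpan, Submodule.span_le]
  rintro _ ⟨I, J, rfl⟩
  exact h I J

end CuntzAlgebra

/-! ### Generated von Neumann algebras -/

section Generated

variable {H : Type*} [NormedAddCommGroup H] [InnerProductSpace ℂ H] [CompleteSpace H]

theorem mem_commutant_vnGenerated {s : Set (H →L[ℂ] H)} {y : H →L[ℂ] H} :
    y ∈ (vnGenerated s).commutant ↔ ∀ a ∈ s, a * y = y * a ∧ star a * y = y * star a := by
  have h : ((vnGenerated s).commutant : Set (H →L[ℂ] H)) =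
      (StarSubalgebra.centralizer ℂ s : Set (H →L[ℂ] H)) := by
    rw [VonNeumannAlgebra.coe_commutant]
    change Set.centralizer (StarSubalgebra.centralizer ℂ
      (StarSubalgebra.centralizer ℂ s : Set (H →L[ℂ] H)) : Set (H →L[ℂ] H)) = _
    rw [StarSubalgebra.coe_centralizer_centralizer, Set.centralizer_centralizer_centralizer]
    rfl
  rw [← SetLike.mem_coe, h, SetLike.mem_coe, StarSubalgebra.mem_centralizer_iff]

theorem VonNeumannAlgebra.mem_iff_forall_commutant {M : VonNeumannAlgebra H} {x : H →L[ℂ] H} :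
    x ∈ M ↔ ∀ y ∈ M.commutant, y * x = x * y := by
  conv_lhs => rw [← M.commutant_commutant]
  exact VonNeumannAlgebra.mem_commutant_iff

theorem mem_commutant_familyVN {d : ℕ} {v : Fin d → (H →L[ℂ] H)} {y : H →L[ℂ] H} :
    y ∈ (familyVN v).commutant ↔ ∀ k, v k * y = y * v k ∧ star (v k) * y = y * star (v k) := by
  rw [familyVN, mem_commutant_vnGenerated, Set.forall_mem_range]

theorem mem_commutant_repVN {A : Type*} [Ring A] [StarRing A] [Algebra ℂ A]
    {π : A →⋆ₐ[ℂ] (H →L[ℂ] H)} {y : H →L[ℂ] H} :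
    y ∈ (repVN π).commutant ↔ ∀ a, π a * y = y * π a := by
  rw [repVN, mem_commutant_vnGenerated, Set.forall_mem_range]
  exact ⟨fun h a => (h a).1, fun h a => ⟨h a, by rw [← map_star]; exact h _⟩⟩

theorem rep_mem_repVN {A : Type*} [Ring A] [StarRing A] [Algebra ℂ A]
    (π : A →⋆ₐ[ℂ] (H →L[ℂ] H)) (a : A) : π a ∈ repVN π := subset_vnGenerated _ ⟨a, rfl⟩

theorem isCuntzFamily_rep {d : ℕ} (π : CuntzAlgebra d →⋆ₐ[ℂ] (H →L[ℂ] H)) :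
    IsCuntzFamily fun k => π (cuntzGen d k) := by
  refine ⟨fun i j => ?_, ?_⟩
  · rw [← map_star, ← map_mul, (isCuntzFamily_cuntzGen d).1]
    split_ifs <;> simp
  · simp_rw [← map_star, ← map_mul, ← map_sum, (isCuntzFamily_cuntzGen d).2, map_one]

theorem StarAlgHom.norm_apply_le_norm {A B : Type*} [CStarAlgebra A] [CStarAlgebra B]
    (π : A →⋆ₐ[ℂ] B) (a : A) : ‖π a‖ ≤ ‖a‖ := NonUnitalStarAlgHom.norm_apply_le π a

theorem rep_continuous {A B : Type*} [CStarAlgebra A] [CStarAlgebra B]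
    (π : A →⋆ₐ[ℂ] B) : Continuous π :=
  AddMonoidHomClass.continuous_of_bound π 1 fun a => by
    simpa using StarAlgHom.norm_apply_le_norm π a

theorem repVN_commutant_eq {d : ℕ} (π : CuntzAlgebra d →⋆ₐ[ℂ] (H →L[ℂ] H)) :
    (repVN π).commutant = (familyVN fun k => π (cuntzGen d k)).commutant := by
  ext y
  rw [mem_commutant_repVN, mem_commutant_familyVN]
  constructor
  · intro h k
    exact ⟨h _, by rw [← map_star]; exact h _⟩
  · intro h a
    let L : CuntzAlgebra d →ₗ[ℂ] (H →L[ℂ] H) := (LinearMap.mulRight ℂ y) ∘ₗ π.toAlgHom.toLinearMap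
    let R : CuntzAlgebra d →ₗ[ℂ] (H →L[ℂ] H) := (LinearMap.mulLeft ℂ y) ∘ₗ π.toAlgHom.toLinearMap
    have hw : ∀ I, Commute (word (fun k => π (cuntzGen d k)) I) y := by
      intro I
      induction I with
      | nil => simp
      | cons k I ih => rw [word_cons]; exact Commute.mul_left (h k).1 ih
    have hw' : ∀ I, Commute (star (word (fun k => π (cuntzGen d k)) I)) y := by
      intro I
      induction I with
      | nil => simp
      | cons k I ih => rw [word_cons, star_mul]; exact Commute.mul_left ih (h k).2
    have : L = R := CuntzAlgebra.ext_of_continuous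
      ((rep_continuous π).mul continuous_const) (continuous_const.mul (rep_continuous π))
      (fun I J => by
        show π _ * y = y * π _
        rw [map_mul, map_star, map_word, map_word]
        exact (hw I).mul_left (hw' J))
    exact congrArg (fun f => f a) this

theorem repVN_eq_familyVN {d : ℕ} (π : CuntzAlgebra d →⋆ₐ[ℂ] (H →L[ℂ] H)) :
    repVN π = familyVN fun k => π (cuntzGen d k) := by
  rw [← (repVN π).commutant_commutant, repVN_commutant_eq, VonNeumannAlgebra.commutant_commutant]

end Generated

/-! ### Compressions along an isometry -/

section Compress

variable {H : Type*} [NormedAddCommGroup H] [InnerProductSpace ℂ H] [CompleteSpace H]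
  {K : Type*} [NormedAddCommGroup K] [InnerProductSpace ℂ K] [CompleteSpace K]
  (V : K →ₗᵢ[ℂ] H)

theorem inner_star_left (X : H →L[ℂ] H) (x y : H) : ⟪star X x, y⟫_ℂ = ⟪x, X y⟫_ℂ := by
  rw [ContinuousLinearMap.star_eq_adjoint, ContinuousLinearMap.adjoint_inner_left]

theorem inner_star_right (X : H →L[ℂ] H) (x y : H) : ⟪x, star X y⟫_ℂ = ⟪X x, y⟫_ℂ := by
  rw [ContinuousLinearMap.star_eq_adjoint, ContinuousLinearMap.adjoint_inner_right]

theorem adjoint_apply_self (f : K) : V.toContinuousLinearMap.adjoint (V f) = f := by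
  refine ext_inner_left ℂ fun g => ?_
  rw [ContinuousLinearMap.adjoint_inner_right]
  exact V.inner_map_map g f

theorem compress_apply (X : H →L[ℂ] H) (f : K) :
    compress V X f = V.toContinuousLinearMap.adjoint (X (V f)) := rfl

theorem rangeProj_apply (x : H) :
    rangeProj V x = V (V.toContinuousLinearMap.adjoint x) := rfl

@[simp] theorem rangeProj_apply_self (f : K) : rangeProj V (V f) = V f := by
  rw [rangeProj_apply, adjoint_apply_self]

theorem inner_compress (X : H →L[ℂ] H) (f g : K) :
    ⟪f, compress V X g⟫_ℂ = ⟪V f, X (V g)⟫_ℂ := by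
  rw [compress_apply, ContinuousLinearMap.adjoint_inner_right]; rfl

theorem star_compress (X : H →L[ℂ] H) : star (compress V X) = compress V (star X) := by
  ext g
  refine ext_inner_left ℂ fun f => ?_
  rw [inner_star_right, inner_compress, inner_star_right, ← inner_conj_symm, inner_compress,
    inner_conj_symm]

theorem compress_sub (X Y : H →L[ℂ] H) : compress V (X - Y) = compress V X - compress V Y := by
  ext; simp [compress_apply]

@[simp] theorem compress_one : compress V 1 = 1 := by
  ext f; simp [compress_apply, adjoint_apply_self]

theorem norm_compress_le (X : H →L[ℂ] H) : ‖compress V X‖ ≤ ‖X‖ := by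
  have hV : ‖V.toContinuousLinearMap‖ ≤ 1 := V.norm_toContinuousLinearMap_le
  have hV' : ‖V.toContinuousLinearMap.adjoint‖ ≤ 1 := by
    rw [LinearIsometryEquiv.norm_map]; exact hV
  calc ‖compress V X‖ ≤ ‖V.toContinuousLinearMap.adjoint‖ * (‖X‖ * ‖V.toContinuousLinearMap‖) :=
        (ContinuousLinearMap.opNorm_comp_le _ _).trans
          (by gcongr; exact ContinuousLinearMap.opNorm_comp_le _ _)
    _ ≤ 1 * (‖X‖ * 1) := by gcongr
    _ = ‖X‖ := by ring

/-- The operator `V x V^*`, which is `x` on the range of `V` and zero on its complement. -/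
noncomputable def inflate (x : K →L[ℂ] K) : H →L[ℂ] H :=
  V.toContinuousLinearMap ∘L x ∘L V.toContinuousLinearMap.adjoint

theorem inflate_apply (x : K →L[ℂ] K) (y : H) :
    inflate V x y = V (x (V.toContinuousLinearMap.adjoint y)) := rfl

@[simp] theorem inflate_apply_self (x : K →L[ℂ] K) (f : K) : inflate V x (V f) = V (x f) := by
  rw [inflate_apply, adjoint_apply_self]

@[simp] theorem compress_inflate (x : K →L[ℂ] K) : compress V (inflate V x) = x := by
  ext f; rw [compress_apply, inflate_apply_self, adjoint_apply_self]

theorem inflate_compress (X : H →L[ℂ] H) :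
    inflate V (compress V X) = rangeProj V * X * rangeProj V := rfl

@[simp] theorem inflate_zero : inflate V 0 = 0 := by ext; simp [inflate_apply]

theorem norm_inflate_le (x : K →L[ℂ] K) : ‖inflate V x‖ ≤ ‖x‖ := by
  have hV : ‖V.toContinuousLinearMap‖ ≤ 1 := V.norm_toContinuousLinearMap_le
  have hV' : ‖V.toContinuousLinearMap.adjoint‖ ≤ 1 := by
    rw [LinearIsometryEquiv.norm_map]; exact hV
  calc ‖inflate V x‖ ≤ ‖V.toContinuousLinearMap‖ * (‖x‖ * ‖V.toContinuousLinearMap.adjoint‖) :=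
        (ContinuousLinearMap.opNorm_comp_le _ _).trans
          (by gcongr; exact ContinuousLinearMap.opNorm_comp_le _ _)
    _ ≤ 1 * (‖x‖ * 1) := by gcongr
    _ = ‖x‖ := by ring

theorem isStarProjection_rangeProj : IsStarProjection (rangeProj V) where
  isIdempotentElem := by ext x; exact rangeProj_apply_self V _
  isSelfAdjoint := by
    ext y
    refine ext_inner_left ℂ fun x => ?_
    rw [inner_star_right, rangeProj_apply, rangeProj_apply]
    have h1 := ContinuousLinearMap.adjoint_inner_right V.toContinuousLinearMap
      (V.toContinuousLinearMap.adjoint x) y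
    have h2 := ContinuousLinearMap.adjoint_inner_left V.toContinuousLinearMap
      (V.toContinuousLinearMap.adjoint y) x
    exact h1.symm.trans h2

theorem mem_range_iff_rangeProj (x : H) : x ∈ Set.range V ↔ rangeProj V x = x :=
  ⟨by rintro ⟨f, rfl⟩; exact rangeProj_apply_self V f, fun h => ⟨_, h⟩⟩

theorem compress_nonneg {X : H →L[ℂ] H} (hX : 0 ≤ X) : 0 ≤ compress V X := by
  rw [ContinuousLinearMap.nonneg_iff_isPositive] at hX ⊢
  exact hX.adjoint_conj _

theorem inflate_nonneg {x : K →L[ℂ] K} (hx : 0 ≤ x) : 0 ≤ inflate V x := by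
  rw [ContinuousLinearMap.nonneg_iff_isPositive] at hx ⊢
  exact hx.conj_adjoint _

variable {V}

/-- Compression is multiplicative as soon as the left factor commutes with the projection. -/
theorem compress_mul_of_commute_left {X : H →L[ℂ] H} (hX : Commute X (rangeProj V))
    (Y : H →L[ℂ] H) : compress V (X * Y) = compress V X * compress V Y := by
  ext f
  have h : X (rangeProj V (Y (V f))) = rangeProj V (X (Y (V f))) :=
    congrArg (fun Z : H →L[ℂ] H => Z (Y (V f))) hX.eq
  show V.toContinuousLinearMap.adjoint (X (Y (V f))) =
    V.toContinuousLinearMap.adjoint (X (rangeProj V (Y (V f))))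
  rw [h, rangeProj_apply, adjoint_apply_self]

theorem compress_mul_of_commute_right {X : H →L[ℂ] H} (hX : Commute X (rangeProj V))
    (Y : H →L[ℂ] H) : compress V (Y * X) = compress V Y * compress V X := by
  ext f
  have h : X (V f) = rangeProj V (X (V f)) := by
    conv_lhs => rw [← rangeProj_apply_self V f]
    exact congrArg (fun Z : H →L[ℂ] H => Z (V f)) hX.eq
  show V.toContinuousLinearMap.adjoint (Y (X (V f))) =
    V.toContinuousLinearMap.adjoint (Y (rangeProj V (X (V f))))
  rw [← h]

end Compress

/-! ### Positivity and contractivity of the conjugation map -/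

section ConjSum

variable {H : Type*} [NormedAddCommGroup H] [InnerProductSpace ℂ H] [CompleteSpace H]
  {d : ℕ} {S : Fin d → (H →L[ℂ] H)}

theorem conjSum_apply (S : Fin d → (H →L[ℂ] H)) (X : H →L[ℂ] H) (x : H) :
    conjSum S X x = ∑ k, S k (X (star (S k) x)) := by
  simp [conjSum]

theorem inner_conjSum (S : Fin d → (H →L[ℂ] H)) (X : H →L[ℂ] H) (x y : H) :
    ⟪x, conjSum S X y⟫_ℂ = ∑ k, ⟪star (S k) x, X (star (S k) y)⟫_ℂ := by
  rw [conjSum_apply, inner_sum]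
  exact Finset.sum_congr rfl fun k _ => (inner_star_left _ _ _).symm

theorem conjSum_nonneg {X : H →L[ℂ] H} (hX : 0 ≤ X) : 0 ≤ conjSum S X := by
  refine Finset.sum_nonneg fun k _ => ?_
  have := star_left_conjugate_nonneg hX (star (S k))
  rwa [star_star] at this

theorem conjSum_mono {X Y : H →L[ℂ] H} (h : X ≤ Y) : conjSum S X ≤ conjSum S Y := by
  rw [← sub_nonneg, ← conjSum_sub]
  exact conjSum_nonneg (sub_nonneg.2 h)

theorem conjSum_iterate_nonneg {X : H →L[ℂ] H} (hX : 0 ≤ X) (n : ℕ) :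
    0 ≤ (conjSum S)^[n] X := by
  induction n with
  | zero => exact hX
  | succ n ih => rw [Function.iterate_succ_apply']; exact conjSum_nonneg ih

theorem sum_norm_star_sq (hS : ∑ k, S k * star (S k) = 1) (x : H) :
    ∑ k, ‖star (S k) x‖ ^ 2 = ‖x‖ ^ 2 := by
  have h := inner_conjSum S 1 x x
  rw [conjSum_one hS] at h
  simp only [one_apply_eq_self, inner_self_eq_norm_sq_to_K] at h
  exact_mod_cast h.symm

theorem norm_conjSum_le (hS : ∑ k, S k * star (S k) = 1) (X : H →L[ℂ] H) :
    ‖conjSum S X‖ ≤ ‖X‖ := by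
  refine ContinuousLinearMap.opNorm_le_of_re_inner_le (norm_nonneg _) fun x y hx hy => ?_
  have h1 : ⟪conjSum S X x, y⟫_ℂ = ∑ k, ⟪X (star (S k) x), star (S k) y⟫_ℂ := by
    rw [conjSum_apply, sum_inner]
    exact Finset.sum_congr rfl fun k _ => (inner_star_right _ _ _).symm
  have h2 : ∀ k, RCLike.re ⟪X (star (S k) x), star (S k) y⟫_ℂ ≤
      ‖X‖ * ((‖star (S k) x‖ ^ 2 + ‖star (S k) y‖ ^ 2) / 2) := fun k =>
    calc RCLike.re ⟪X (star (S k) x), star (S k) y⟫_ℂ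
        ≤ ‖X (star (S k) x)‖ * ‖star (S k) y‖ := re_inner_le_norm _ _
      _ ≤ ‖X‖ * ‖star (S k) x‖ * ‖star (S k) y‖ := by gcongr; exact X.le_opNorm _
      _ = ‖X‖ * (‖star (S k) x‖ * ‖star (S k) y‖) := by ring
      _ ≤ _ := by
        gcongr
        nlinarith [sq_nonneg (‖star (S k) x‖ - ‖star (S k) y‖)]
  rw [h1, map_sum]
  refine (Finset.sum_le_sum fun k _ => h2 k).trans ?_
  rw [← Finset.mul_sum, ← Finset.sum_div, Finset.sum_add_distrib, sum_norm_star_sq hS,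
    sum_norm_star_sq hS, hx, hy]
  norm_num

theorem norm_conjSum_iterate_le (hS : ∑ k, S k * star (S k) = 1) (X : H →L[ℂ] H) (n : ℕ) :
    ‖(conjSum S)^[n] X‖ ≤ ‖X‖ := by
  induction n with
  | zero => exact le_rfl
  | succ n ih => rw [Function.iterate_succ_apply']; exact (norm_conjSum_le hS _).trans ih

/-- Weak limits commute with the conjugation map. -/
theorem tendsto_inner_conjSum {l : Filter ℕ} {a : ℕ → (H →L[ℂ] H)} {z : H →L[ℂ] H}
    (h : ∀ x y, Tendsto (fun n => ⟪x, a n y⟫_ℂ) l (𝓝 ⟪x, z y⟫_ℂ)) (x y : H) :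
    Tendsto (fun n => ⟪x, conjSum S (a n) y⟫_ℂ) l (𝓝 ⟪x, conjSum S z y⟫_ℂ) := by
  simp only [inner_conjSum]
  exact tendsto_finsetSum _ fun k _ => h _ _

namespace IsCuntzFamily

variable (hS : IsCuntzFamily S)
include hS

/-- The powers of the canonical endomorphism as `*`-homomorphisms. -/
theorem exists_starAlgHom_iterate (n : ℕ) : ∃ Φ : (H →L[ℂ] H) →⋆ₐ[ℂ] (H →L[ℂ] H),
    ∀ X, Φ X = (conjSum S)^[n] X := by
  let Λ : (H →L[ℂ] H) →⋆ₐ[ℂ] (H →L[ℂ] H) :=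
    { toFun := conjSum S
      map_one' := conjSum_one hS.2
      map_mul' := hS.conjSum_mul
      map_zero' := by simp [conjSum]
      map_add' := conjSum_add S
      commutes' := fun r => by
        rw [Algebra.algebraMap_eq_smul_one, conjSum_smul, conjSum_one hS.2]
      map_star' := fun x => (star_conjSum S x).symm }
  induction n with
  | zero => exact ⟨StarAlgHom.id ℂ _, fun X => rfl⟩
  | succ n ih =>
    obtain ⟨Φ, hΦ⟩ := ih
    refine ⟨Λ.comp Φ, fun X => ?_⟩
    rw [Function.iterate_succ_apply', ← hΦ]; rfl

theorem conjSum_iterate_mul (n : ℕ) (X Y : H →L[ℂ] H) :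
    (conjSum S)^[n] (X * Y) = (conjSum S)^[n] X * (conjSum S)^[n] Y := by
  obtain ⟨Φ, hΦ⟩ := hS.exists_starAlgHom_iterate n
  simp only [← hΦ, map_mul]

theorem conjSum_iterate_sub (n : ℕ) (X Y : H →L[ℂ] H) :
    (conjSum S)^[n] (X - Y) = (conjSum S)^[n] X - (conjSum S)^[n] Y := by
  obtain ⟨Φ, hΦ⟩ := hS.exists_starAlgHom_iterate n
  simp only [← hΦ, map_sub]

theorem conjSum_iterate_zero (n : ℕ) : (conjSum S)^[n] 0 = 0 := by
  obtain ⟨Φ, hΦ⟩ := hS.exists_starAlgHom_iterate n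
  simp only [← hΦ, map_zero]

theorem isStarProjection_conjSum {p : H →L[ℂ] H} (hp : IsStarProjection p) :
    IsStarProjection (conjSum S p) where
  isIdempotentElem := by
    rw [IsIdempotentElem, ← hS.conjSum_mul, hp.isIdempotentElem.eq]
  isSelfAdjoint := by
    rw [IsSelfAdjoint, star_conjSum, hp.isSelfAdjoint.star_eq]

/-- The fixed points of the canonical endomorphism form the commutant of the family. -/
theorem conjSum_eq_self_iff {X : H →L[ℂ] H} :
    conjSum S X = X ↔ X ∈ (familyVN S).commutant := by
  rw [mem_commutant_familyVN]
  constructor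
  · intro h k
    have h1 := hS.conjSum_mul_gen k X
    have h2 := hS.star_mul_conjSum k X
    rw [h] at h1 h2
    exact ⟨h1.symm, h2⟩
  · exact fun h => conjSum_eq_self_of_commute hS.2 fun k => (h k).1

theorem conjSum_iterate_word (X : H →L[ℂ] H) (I : List (Fin d)) (n : ℕ) :
    (conjSum S)^[n + I.length] X * word S I = word S I * (conjSum S)^[n] X := by
  induction I with
  | nil => simp
  | cons k I ih =>
    rw [List.length_cons, ← add_assoc, Function.iterate_succ_apply', word_cons, ← mul_assoc,
      hS.conjSum_mul_gen, mul_assoc, ih, mul_assoc]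

end IsCuntzFamily

end ConjSum

/-! ### Coisometric dilations -/

section Dilation

variable {H : Type*} [NormedAddCommGroup H] [InnerProductSpace ℂ H] [CompleteSpace H]
  {K : Type*} [NormedAddCommGroup K] [InnerProductSpace ℂ K] [CompleteSpace K]
  {d : ℕ}

/-- The family `S` satisfies the Cuntz relations and dilates `v` along `V`, without any
minimality requirement. -/
structure IsCuntzDilation (v : Fin d → (K →L[ℂ] K)) (V : K →ₗᵢ[ℂ] H)
    (S : Fin d → (H →L[ℂ] H)) : Prop where
  cuntz : IsCuntzFamily S
  intertwine : ∀ k f, star (S k) (V f) = V (star (v k) f)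

/-- The span of the vectors `S_I f` with `f` in the dilated space. -/
def dilationSpan (V : K →ₗᵢ[ℂ] H) (S : Fin d → (H →L[ℂ] H)) : Submodule ℂ H :=
  Submodule.span ℂ {x : H | ∃ I f, x = word S I (V f)}

theorem IsPopescuDilation.isCuntzDilation {v : Fin d → (K →L[ℂ] K)} {V : K →ₗᵢ[ℂ] H}
    {S : Fin d → (H →L[ℂ] H)} (h : IsPopescuDilation v V S) : IsCuntzDilation v V S :=
  ⟨h.cuntz, h.intertwine⟩

namespace IsCuntzDilation

variable {v : Fin d → (K →L[ℂ] K)} {V : K →ₗᵢ[ℂ] H} {S : Fin d → (H →L[ℂ] H)}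
  (h : IsCuntzDilation v V S)
include h

theorem adjoint_gen (k : Fin d) (x : H) :
    V.toContinuousLinearMap.adjoint (S k x) = v k (V.toContinuousLinearMap.adjoint x) := by
  refine ext_inner_left ℂ fun f => ?_
  rw [ContinuousLinearMap.adjoint_inner_right, ← inner_star_left, ← inner_star_left,
    ContinuousLinearMap.adjoint_inner_right]
  exact congrArg (fun y => ⟪y, x⟫_ℂ) (h.intertwine k f)

theorem compress_gen (k : Fin d) : compress V (S k) = v k := by
  ext f
  rw [compress_apply, h.adjoint_gen, adjoint_apply_self]

theorem compress_conjSum (X : H →L[ℂ] H) :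
    compress V (conjSum S X) = conjSum v (compress V X) := by
  ext f
  simp only [compress_apply, conjSum_apply, map_sum, h.adjoint_gen, h.intertwine]

theorem sum_eq_one : ∑ k, v k * star (v k) = 1 := by
  have := h.compress_conjSum 1
  rw [conjSum_one h.cuntz.2, compress_one] at this
  simpa [conjSum] using this.symm

theorem star_word_apply (I : List (Fin d)) (f : K) :
    star (word S I) (V f) = V (star (word v I) f) := by
  induction I generalizing f with
  | nil => simp
  | cons k I ih =>
    rw [word_cons, word_cons, star_mul, star_mul, mul_apply_eq_comp, mul_apply_eq_comp,
      h.intertwine, ih]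

theorem inner_word (I J : List (Fin d)) (f g : K) :
    ⟪V f, (word S I * star (word S J)) (V g)⟫_ℂ = ⟪f, (word v I * star (word v J)) g⟫_ℂ := by
  rw [mul_apply_eq_comp, mul_apply_eq_comp, ← inner_star_left, h.star_word_apply,
    h.star_word_apply, V.inner_map_map, inner_star_left]

theorem coinvariant (k : Fin d) :
    rangeProj V * star (S k) * rangeProj V = star (S k) * rangeProj V := by
  ext x
  simp only [mul_apply_eq_comp]
  rw [rangeProj_apply V x, h.intertwine, rangeProj_apply_self]

theorem conjSum_rangeProj_mul : conjSum S (rangeProj V) * rangeProj V = rangeProj V := by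
  have : ∀ k, S k * rangeProj V * star (S k) * rangeProj V =
      (S k * star (S k)) * rangeProj V := fun k => by
    rw [mul_assoc, mul_assoc, ← mul_assoc (rangeProj V), h.coinvariant, mul_assoc]
  rw [conjSum, Finset.sum_mul, Finset.sum_congr rfl fun k _ => this k, ← Finset.sum_mul,
    h.cuntz.2, one_mul]

theorem subharmonic : rangeProj V ≤ conjSum S (rangeProj V) := by
  rw [(isStarProjection_rangeProj V).le_iff_mul_eq_right
    (h.cuntz.isStarProjection_conjSum (isStarProjection_rangeProj V))]
  exact h.conjSum_rangeProj_mul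

theorem iterate_mono : Monotone fun n : ℕ => (conjSum S)^[n] (rangeProj V) := by
  refine monotone_nat_of_le_succ fun n => ?_
  induction n with
  | zero => exact h.subharmonic
  | succ n ih =>
    rw [Function.iterate_succ_apply', Function.iterate_succ_apply']
    exact conjSum_mono ih

theorem iterate_rangeProj_apply_self (n : ℕ) (f : K) :
    (conjSum S)^[n] (rangeProj V) (V f) = V f := by
  induction n generalizing f with
  | zero => exact rangeProj_apply_self V f
  | succ n ih =>
    rw [Function.iterate_succ_apply', conjSum_apply]
    simp only [h.intertwine, ih]
    simp only [← h.intertwine]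
    have := congrArg (fun Z : H →L[ℂ] H => Z (V f)) h.cuntz.2
    simpa using this

theorem norm_iterate_rangeProj_le (n : ℕ) (x : H) :
    ‖(conjSum S)^[n] (rangeProj V) x‖ ≤ ‖x‖ := by
  have h1 : ‖rangeProj V‖ ≤ 1 :=
    ContinuousLinearMap.opNorm_le_bound _ zero_le_one fun y => by
      rw [rangeProj_apply, V.norm_map, one_mul]
      have h2 : ‖V.toContinuousLinearMap.adjoint‖ ≤ 1 := by
        rw [LinearIsometryEquiv.norm_map]; exact V.norm_toContinuousLinearMap_le
      simpa using V.toContinuousLinearMap.adjoint.le_of_opNorm_le h2 y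
  simpa using ((conjSum S)^[n] (rangeProj V)).le_of_opNorm_le
    ((norm_conjSum_iterate_le h.cuntz.2 _ n).trans h1) x

/-- `Λⁿ(P)` converges strongly to the identity on the closed span of the vectors `S_I f`: on each
of these vectors the sequence is eventually constant. -/
theorem tendsto_iterate_rangeProj {x : H} (hx : x ∈ closure (dilationSpan V S : Set H)) :
    Tendsto (fun n => (conjSum S)^[n] (rangeProj V) x) atTop (𝓝 x) := by
  have hev : ∀ y ∈ dilationSpan V S, ∀ᶠ n in atTop, (conjSum S)^[n] (rangeProj V) y = y := by
    intro y hy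
    induction hy using Submodule.span_induction with
    | mem y hy =>
      obtain ⟨I, f, rfl⟩ := hy
      filter_upwards [eventually_ge_atTop I.length] with n hn
      obtain ⟨m, rfl⟩ := Nat.exists_eq_add_of_le' hn
      rw [← mul_apply_eq_comp, h.cuntz.conjSum_iterate_word, mul_apply_eq_comp,
        h.iterate_rangeProj_apply_self]
    | zero => simp
    | add a b _ _ ha hb => filter_upwards [ha, hb] with n h1 h2; rw [map_add, h1, h2]
    | smul c a _ ha => filter_upwards [ha] with n h1; rw [map_smul, h1]
  rw [Metric.tendsto_atTop']
  intro ε hε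
  obtain ⟨y, hy, hxy⟩ := Metric.mem_closure_iff.1 hx (ε / 2) (half_pos hε)
  obtain ⟨N, hN⟩ := eventually_atTop.1 (hev y hy)
  refine ⟨N, fun n hn => ?_⟩
  have h1 := h.norm_iterate_rangeProj_le n (x - y)
  rw [map_sub, hN n hn.le] at h1
  rw [dist_eq_norm] at hxy ⊢
  calc ‖(conjSum S)^[n] (rangeProj V) x - x‖
      = ‖((conjSum S)^[n] (rangeProj V) x - y) - (x - y)‖ := by congr 1; abel
    _ ≤ ‖(conjSum S)^[n] (rangeProj V) x - y‖ + ‖x - y‖ := norm_sub_le _ _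
    _ < ε := by linarith

/-- If `Y` commutes with the dilation and its compression `D` commutes with `v`, and `Y` maps the
small space into the closed span of the vectors `S_I f`, then `Y` restricts to `D`. The reason is
that `Λⁿ(V D V^*)` restricts to `D` for every `n`, and equals `Λⁿ(P) Y Λⁿ(P)`. -/
theorem apply_eq_of_compress_mem_commutant {Y : H →L[ℂ] H} (hY : Y ∈ (familyVN S).commutant)
    (hD : compress V Y ∈ (familyVN v).commutant)
    {f : K} (hf : Y (V f) ∈ closure (dilationSpan V S : Set H)) :
    Y (V f) = V (compress V Y f) := by
  have hfix : conjSum S Y = Y := h.cuntz.conjSum_eq_self_iff.2 hY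
  have h1 : ∀ n g, (conjSum S)^[n] (inflate V (compress V Y)) (V g) = V (compress V Y g) := by
    intro n
    induction n with
    | zero => intro g; exact inflate_apply_self V _ g
    | succ n ih =>
      intro g
      rw [Function.iterate_succ_apply', conjSum_apply]
      simp only [h.intertwine, ih]
      have hc : ∀ k, compress V Y (star (v k) g) = star (v k) (compress V Y g) := fun k =>
        (congrArg (fun Z : K →L[ℂ] K => Z g) (mem_commutant_familyVN.1 hD k).2).symm
      simp only [hc, ← h.intertwine]
      have := congrArg (fun Z : H →L[ℂ] H => Z (V (compress V Y g))) h.cuntz.2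
      simpa using this
  have h2 : ∀ n, (conjSum S)^[n] (inflate V (compress V Y)) (V f) =
      (conjSum S)^[n] (rangeProj V) (Y (V f)) := by
    intro n
    rw [inflate_compress, h.cuntz.conjSum_iterate_mul, h.cuntz.conjSum_iterate_mul,
      Function.iterate_fixed hfix, mul_apply_eq_comp, mul_apply_eq_comp,
      h.iterate_rangeProj_apply_self]
  refine tendsto_nhds_unique (h.tendsto_iterate_rangeProj hf) ?_
  simp only [← h2, h1]
  exact tendsto_const_nhds

end IsCuntzDilation

/-! ### Lifting fixed points to the commutant of a minimal dilation -/

namespace IsPopescuDilation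

variable {v : Fin d → (K →L[ℂ] K)} {V : K →ₗᵢ[ℂ] H} {S : Fin d → (H →L[ℂ] H)}
  (h : IsPopescuDilation v V S)
include h

theorem mem_closure_dilationSpan (x : H) : x ∈ closure (dilationSpan V S : Set H) :=
  h.total x

theorem iterate_tendsto (x : H) :
    Tendsto (fun n => (conjSum S)^[n] (rangeProj V) x) atTop (𝓝 x) :=
  h.isCuntzDilation.tendsto_iterate_rangeProj (h.mem_closure_dilationSpan x)

/-- A fixed point of `Λ` is recovered from its compression. -/
theorem tendsto_iterate_inflate {X : H →L[ℂ] H} (hX : conjSum S X = X) (x : H) :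
    Tendsto (fun n => (conjSum S)^[n] (inflate V (compress V X)) x) atTop (𝓝 (X x)) := by
  have h2 : ∀ n, (conjSum S)^[n] (inflate V (compress V X)) x =
      (conjSum S)^[n] (rangeProj V) (X ((conjSum S)^[n] (rangeProj V) x - x)) +
        (conjSum S)^[n] (rangeProj V) (X x) := by
    intro n
    rw [inflate_compress, h.cuntz.conjSum_iterate_mul, h.cuntz.conjSum_iterate_mul,
      Function.iterate_fixed hX, mul_apply_eq_comp, mul_apply_eq_comp, map_sub, map_sub]
    abel
  simp only [h2]
  have h3 : Tendsto (fun n => (conjSum S)^[n] (rangeProj V)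
      (X ((conjSum S)^[n] (rangeProj V) x - x))) atTop (𝓝 0) := by
    have h4 : Tendsto (fun n => X ((conjSum S)^[n] (rangeProj V) x - x)) atTop (𝓝 0) := by
      have := (X.continuous.tendsto _).comp ((h.iterate_tendsto x).sub_const x)
      simpa [Function.comp_def] using this
    exact squeeze_zero_norm (fun n => h.isCuntzDilation.norm_iterate_rangeProj_le n _)
      (by simpa using h4.norm)
  simpa using h3.add (h.iterate_tendsto (X x))

theorem norm_compress_eq {X : H →L[ℂ] H} (hX : conjSum S X = X) : ‖compress V X‖ = ‖X‖ := by
  refine le_antisymm (norm_compress_le V X) ?_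
  refine ContinuousLinearMap.opNorm_le_bound _ (norm_nonneg _) fun x => ?_
  refine le_of_tendsto (h.tendsto_iterate_inflate hX x).norm (Eventually.of_forall fun n => ?_)
  exact ContinuousLinearMap.le_of_opNorm_le _
    ((norm_conjSum_iterate_le h.cuntz.2 _ n).trans (norm_inflate_le V _)) x

theorem eq_of_compress_eq {X Y : H →L[ℂ] H} (hX : conjSum S X = X) (hY : conjSum S Y = Y)
    (hXY : compress V X = compress V Y) : X = Y := by
  have h1 := h.norm_compress_eq (X := X - Y) (by rw [conjSum_sub, hX, hY])
  rw [compress_sub, hXY, sub_self, norm_zero] at h1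
  exact sub_eq_zero.1 (norm_eq_zero.1 h1.symm)

/-- A fixed point of `Λ` is the strong limit of `Λⁿ(V D V^*)` with `D` its compression, and `Λ`
preserves positivity. -/
theorem nonneg_of_compress_nonneg {X : H →L[ℂ] H} (hX : conjSum S X = X)
    (h0 : 0 ≤ compress V X) : 0 ≤ X := by
  have key : ∀ x, 0 ≤ ⟪X x, x⟫_ℂ := by
    intro x
    have h1 := (h.tendsto_iterate_inflate hX x).inner (tendsto_const_nhds (x := x)) (𝕜 := ℂ)
    refine ge_of_tendsto h1 (Eventually.of_forall fun n => ?_)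
    exact ((ContinuousLinearMap.nonneg_iff_isPositive _).1
      (conjSum_iterate_nonneg (inflate_nonneg V h0) n)).inner_nonneg_left x
  rw [ContinuousLinearMap.nonneg_iff_isPositive, ContinuousLinearMap.isPositive_iff_complex]
  intro x
  have := key x
  exact ⟨by
    rw [Complex.nonneg_iff] at this
    exact Complex.ext (by simp) (by simpa using this.2), (Complex.nonneg_iff.1 this).1⟩

theorem compress_le_iff {X Y : H →L[ℂ] H} (hX : conjSum S X = X) (hY : conjSum S Y = Y) :
    compress V X ≤ compress V Y ↔ X ≤ Y := by
  rw [← sub_nonneg, ← compress_sub, ← sub_nonneg (a := Y)]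
  exact ⟨h.nonneg_of_compress_nonneg (by rw [conjSum_sub, hX, hY]), compress_nonneg V⟩

/-- Every fixed point `D` of `τ` lifts to a fixed point of `Λ`: a weak limit point of the
sequence `Λⁿ(V D V^*)`, all of whose members compress to `D`. -/
theorem exists_lift {D : K →L[ℂ] K} (hD : conjSum v D = D) :
    ∃ X : H →L[ℂ] H, conjSum S X = X ∧ compress V X = D := by
  let a : ℕ → (H →L[ℂ] H) := fun n => (conjSum S)^[n] (inflate V D)
  have ha : ∀ n, ‖a n‖ ≤ ‖D‖ := fun n =>
    (norm_conjSum_iterate_le h.cuntz.2 _ n).trans (norm_inflate_le V D)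
  have hc : ∀ n, compress V (a n) = D := by
    intro n
    induction n with
    | zero => exact compress_inflate V D
    | succ n ih =>
      show compress V ((conjSum S)^[n + 1] _) = D
      rw [Function.iterate_succ_apply', h.isCuntzDilation.compress_conjSum]
      exact (congrArg _ ih).trans hD
  obtain ⟨z, hz⟩ := exists_weak_limit (hyperfilter ℕ) a ‖D‖ ha
  refine ⟨z, ?_, ?_⟩
  · -- the difference `Λⁿ⁺¹(VDV^*) - Λⁿ(VDV^*)` vanishes between the projections `Λⁿ(P)`
    have hE : ∀ x y, Tendsto (fun n => ⟪x, (a (n + 1) - a n) y⟫_ℂ) atTop (𝓝 0) := by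
      intro x y
      have hzero : ∀ n, (conjSum S)^[n] (rangeProj V) * (a (n + 1) - a n) *
          (conjSum S)^[n] (rangeProj V) = 0 := by
        intro n
        have : a (n + 1) - a n = (conjSum S)^[n] (a 1 - a 0) := by
          rw [h.cuntz.conjSum_iterate_sub]
          show (conjSum S)^[n + 1] _ - _ = _
          rw [Function.iterate_succ_apply]
          rfl
        rw [this, ← h.cuntz.conjSum_iterate_mul, ← h.cuntz.conjSum_iterate_mul,
          ← inflate_compress, compress_sub, hc, hc, sub_self, inflate_zero,
          h.cuntz.conjSum_iterate_zero]
      have hsplit : ∀ n, ⟪x, (a (n + 1) - a n) y⟫_ℂ =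
          ⟪x - (conjSum S)^[n] (rangeProj V) x, (a (n + 1) - a n) y⟫_ℂ +
          ⟪(conjSum S)^[n] (rangeProj V) x,
            (a (n + 1) - a n) (y - (conjSum S)^[n] (rangeProj V) y)⟫_ℂ := by
        intro n
        have hsa : star ((conjSum S)^[n] (rangeProj V)) = (conjSum S)^[n] (rangeProj V) := by
          obtain ⟨Φ, hΦ⟩ := h.cuntz.exists_starAlgHom_iterate n
          rw [← hΦ, ← map_star, (isStarProjection_rangeProj V).isSelfAdjoint.star_eq]
        have h0 : ⟪(conjSum S)^[n] (rangeProj V) x,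
            (a (n + 1) - a n) ((conjSum S)^[n] (rangeProj V) y)⟫_ℂ = 0 := by
          rw [← hsa, inner_star_left, hsa, ← mul_apply_eq_comp, ← mul_apply_eq_comp, hzero]
          simp
        rw [map_sub, inner_sub_right, h0, inner_sub_left]
        ring
      have hb : ∀ n w, ‖(a (n + 1) - a n) w‖ ≤ 2 * ‖D‖ * ‖w‖ := fun n w =>
        ContinuousLinearMap.le_of_opNorm_le _
          ((norm_sub_le _ _).trans (by linarith [ha n, ha (n + 1)])) w
      have hlim : ∀ w, Tendsto (fun n => ‖w - (conjSum S)^[n] (rangeProj V) w‖) atTop (𝓝 0) :=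
        fun w => by
          have := ((h.iterate_tendsto w).const_sub w).norm
          simpa using this
      have hB : Tendsto (fun n => ‖x - (conjSum S)^[n] (rangeProj V) x‖ * (2 * ‖D‖ * ‖y‖) +
          ‖x‖ * (2 * ‖D‖ * ‖y - (conjSum S)^[n] (rangeProj V) y‖)) atTop (𝓝 0) := by
        have := ((hlim x).mul_const (2 * ‖D‖ * ‖y‖)).add
          (((hlim y).const_mul (2 * ‖D‖)).const_mul ‖x‖)
        simpa using this
      refine squeeze_zero_norm (fun n => ?_) hB
      rw [hsplit]
      refine (norm_add_le _ _).trans (add_le_add ?_ ?_)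
      · exact (norm_inner_le_norm _ _).trans (by gcongr; exact hb n y)
      · refine (norm_inner_le_norm _ _).trans ?_
        gcongr
        · exact h.isCuntzDilation.norm_iterate_rangeProj_le n x
        · exact hb n _
    ext y
    refine ext_inner_left ℂ fun x => ?_
    have h1 := tendsto_inner_conjSum (S := S) hz x y
    have h2 := (hz x y).add ((hE x y).mono_left Nat.hyperfilter_le_atTop)
    rw [add_zero] at h2
    refine tendsto_nhds_unique h1 (h2.congr fun n => ?_)
    rw [← inner_add_right, ← add_apply, add_sub_cancel]
    show ⟪x, (conjSum S)^[n + 1] _ y⟫_ℂ = _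
    rw [Function.iterate_succ_apply']
  · ext g
    refine ext_inner_left ℂ fun f => ?_
    rw [inner_compress]
    refine tendsto_nhds_unique (hz (V f) (V g)) ?_
    simp only [← inner_compress, hc]
    exact tendsto_const_nhds

/-- If every fixed point of `τ` commutes with `v`, the projection onto the small space lies in the
von Neumann algebra generated by the dilation. -/
theorem rangeProj_mem
    (hM : ((familyVN v).commutant : Set (K →L[ℂ] K)) = {x | conjSum v x = x}) :
    rangeProj V ∈ familyVN S := by
  have key : ∀ Y ∈ (familyVN S).commutant, ∀ f, Y (V f) = V (compress V Y f) := by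
    intro Y hY f
    refine h.isCuntzDilation.apply_eq_of_compress_mem_commutant hY ?_
      (h.mem_closure_dilationSpan _)
    rw [← SetLike.mem_coe, hM, Set.mem_ofPred_eq, ← h.isCuntzDilation.compress_conjSum,
      h.cuntz.conjSum_eq_self_iff.2 hY]
  rw [VonNeumannAlgebra.IsStarProjection.mem_iff (isStarProjection_rangeProj V)]
  intro Y hY
  rw [Module.End.mem_invtSubmodule]
  rintro _ ⟨x, rfl⟩
  refine ⟨V (compress V Y (V.toContinuousLinearMap.adjoint x)), ?_⟩
  exact (rangeProj_apply_self V _).trans (key Y hY _).symm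

variable (hP : rangeProj V ∈ familyVN S)
include hP

omit h in
theorem commute_rangeProj {X : H →L[ℂ] H} (hX : X ∈ (familyVN S).commutant) :
    Commute X (rangeProj V) :=
  (VonNeumannAlgebra.mem_commutant_iff.1 hX _ hP).symm

omit hP in
theorem compress_star_gen (k : Fin d) : compress V (star (S k)) = star (v k) := by
  rw [← star_compress, h.isCuntzDilation.compress_gen]

theorem compress_mem_commutant {X : H →L[ℂ] H} (hX : X ∈ (familyVN S).commutant) :
    compress V X ∈ (familyVN v).commutant := by
  rw [mem_commutant_familyVN]
  intro k
  have hc := commute_rangeProj hP hX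
  obtain ⟨h1, h2⟩ := mem_commutant_familyVN.1 hX k
  rw [← h.compress_star_gen, ← h.isCuntzDilation.compress_gen k,
    ← compress_mul_of_commute_left hc, ← compress_mul_of_commute_left hc,
    ← compress_mul_of_commute_right hc, ← compress_mul_of_commute_right hc, h1, h2]
  exact ⟨rfl, rfl⟩

/-- If the projection onto the small space lies in the von Neumann algebra of the dilation, the fixed
points of `τ` form the commutant of the `v_k`: they lift to fixed points of `Λ`, that is, to the
commutant of the `S_k`. -/
theorem commutant_eq :
    ((familyVN v).commutant : Set (K →L[ℂ] K)) = {x | conjSum v x = x} := by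
  ext D
  constructor
  · intro hD
    exact conjSum_eq_self_of_commute h.isCuntzDilation.sum_eq_one
      fun k => (mem_commutant_familyVN.1 hD k).1
  · intro hD
    obtain ⟨X, hX, rfl⟩ := h.exists_lift hD
    exact h.compress_mem_commutant hP (h.cuntz.conjSum_eq_self_iff.1 hX)

/-- It suffices to commute with the commutant of the `S_k`, which is known after compression. -/
theorem inflate_mem {x : K →L[ℂ] K} (hx : x ∈ familyVN v) : inflate V x ∈ familyVN S := by
  rw [VonNeumannAlgebra.mem_iff_forall_commutant] at hx ⊢
  intro Y hY
  have hc := hx _ (h.compress_mem_commutant hP hY)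
  have hYc := commute_rangeProj hP hY
  have h1 : compress V (Y * inflate V x) = compress V (inflate V x * Y) := by
    rw [compress_mul_of_commute_left hYc, compress_mul_of_commute_right hYc, compress_inflate, hc]
  have h2 := congrArg (inflate V) h1
  rw [inflate_compress, inflate_compress] at h2
  have hPx : rangeProj V * inflate V x = inflate V x := by
    ext y; exact rangeProj_apply_self V _
  have hxP : inflate V x * rangeProj V = inflate V x := by
    ext y
    show V (x (V.toContinuousLinearMap.adjoint (rangeProj V y))) = _
    rw [rangeProj_apply, adjoint_apply_self]; rfl
  calc Y * inflate V x = Y * (rangeProj V * inflate V x * rangeProj V) := by rw [hPx, hxP]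
    _ = rangeProj V * (Y * inflate V x) * rangeProj V := by
      rw [← mul_assoc, ← mul_assoc, hYc.eq, mul_assoc (rangeProj V)]
    _ = rangeProj V * (inflate V x * Y) * rangeProj V := h2
    _ = (rangeProj V * inflate V x * rangeProj V) * Y := by
      rw [mul_assoc, mul_assoc, mul_assoc, mul_assoc, hYc.eq]
    _ = inflate V x * Y := by rw [hPx, hxP]

/-- Every operator commuting with the `v_k` is the compression of one commuting with the `S_k`. -/
theorem compress_mem {X : H →L[ℂ] H} (hX : X ∈ familyVN S) : compress V X ∈ familyVN v := by
  rw [VonNeumannAlgebra.mem_iff_forall_commutant] at hX ⊢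
  intro D hD
  rw [← SetLike.mem_coe, h.commutant_eq hP] at hD
  obtain ⟨Y, hY, rfl⟩ := h.exists_lift hD
  have hY' := h.cuntz.conjSum_eq_self_iff.1 hY
  have hc := commute_rangeProj hP hY'
  rw [← compress_mul_of_commute_left hc, ← compress_mul_of_commute_right hc, hX Y hY']

/-- The corner of the von Neumann algebra of the dilation is that of the compressed family. -/
theorem corner_eq :
    compress V '' (familyVN S : Set (H →L[ℂ] H)) = (familyVN v : Set (K →L[ℂ] K)) := by
  ext x
  constructor
  · rintro ⟨X, hX, rfl⟩
    exact h.compress_mem hP hX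
  · intro hx
    exact ⟨inflate V x, h.inflate_mem hP hx, compress_inflate V x⟩

end IsPopescuDilation

end Dilation

/-! ### Support projections of vector states -/

section Support

variable {H : Type*} [NormedAddCommGroup H] [InnerProductSpace ℂ H] [CompleteSpace H]
  {K : Type*} [NormedAddCommGroup K] [InnerProductSpace ℂ K] [CompleteSpace K]
  {d : ℕ}

theorem vectorFunctional_apply (M : VonNeumannAlgebra H) (ξ : H) (x : M.Elem) :
    vectorFunctional M ξ x = ⟪ξ, (x : H →L[ℂ] H) ξ⟫_ℂ := rfl

theorem inner_star_mul_self (X : H →L[ℂ] H) (ξ : H) :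
    ⟪ξ, (star X * X) ξ⟫_ℂ = (‖X ξ‖ ^ 2 : ℝ) := by
  rw [mul_apply_eq_comp, inner_star_right, inner_self_eq_norm_sq_to_K]
  norm_cast

/-- Faithfulness of a vector state means that the vector is separating. -/
theorem isFaithful_vectorFunctional_iff {M : VonNeumannAlgebra H} {ξ : H} :
    IsFaithful (vectorFunctional M ξ) ↔ ∀ x ∈ M, x ξ = 0 → x = 0 := by
  have key : ∀ x : M.Elem, vectorFunctional M ξ (star x * x) = 0 ↔ (x : H →L[ℂ] H) ξ = 0 := by
    intro x
    have h1 : vectorFunctional M ξ (star x * x) = _ := inner_star_mul_self (x : H →L[ℂ] H) ξ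
    rw [h1]
    norm_cast
    rw [sq_eq_zero_iff, norm_eq_zero]
  constructor
  · intro h x hx h0
    exact congrArg Subtype.val (h ⟨x, hx⟩ ((key ⟨x, hx⟩).2 h0))
  · intro h x h0
    exact Subtype.ext (h x x.2 ((key x).1 h0))

theorem IsStarProjection.apply_eq_self_of_inner {q : H →L[ℂ] H} (hq : IsStarProjection q) {ξ : H}
    (h : ⟪ξ, q ξ⟫_ℂ = ⟪ξ, ξ⟫_ℂ) : q ξ = ξ := by
  have h1 : ⟪ξ, (star (1 - q) * (1 - q)) ξ⟫_ℂ = 0 := by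
    rw [hq.one_sub.isSelfAdjoint.star_eq, hq.one_sub.isIdempotentElem.eq]
    simp [h]
  rw [inner_star_mul_self] at h1
  have h2 : ‖(1 - q) ξ‖ = 0 := by exact_mod_cast (pow_eq_zero_iff two_ne_zero).1 (by exact_mod_cast h1)
  have h3 : ξ - q ξ = 0 := by simpa using h2
  exact (sub_eq_zero.1 h3).symm

theorem isSupportProjection_iff {M : VonNeumannAlgebra H} {ξ : H} {P : H →L[ℂ] H} :
    IsSupportProjection M (vectorFunctional M ξ) P ↔
      P ∈ M ∧ IsStarProjection P ∧ P ξ = ξ ∧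
        ∀ q ∈ M, IsStarProjection q → q ξ = ξ → P ≤ q := by
  have h1 : ∀ q : H →L[ℂ] H, IsStarProjection q → (⟪ξ, q ξ⟫_ℂ = ⟪ξ, ξ⟫_ℂ ↔ q ξ = ξ) :=
    fun q hq => ⟨hq.apply_eq_self_of_inner, fun h => by rw [h]⟩
  have hco : ∀ q : M.Elem, IsStarProjection q ↔ IsStarProjection (q : H →L[ℂ] H) := fun q =>
    ⟨fun h => ⟨congrArg Subtype.val h.isIdempotentElem, congrArg Subtype.val h.isSelfAdjoint⟩,
      fun h => ⟨Subtype.ext h.isIdempotentElem, Subtype.ext h.isSelfAdjoint⟩⟩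
  constructor
  · rintro ⟨p, rfl, hp, hp1, hmin⟩
    refine ⟨p.2, (hco p).1 hp, (h1 _ ((hco p).1 hp)).1 hp1, fun q hqM hq hqξ => ?_⟩
    exact hmin ⟨q, hqM⟩ ((hco ⟨q, hqM⟩).2 hq) ((h1 q hq).2 hqξ)
  · rintro ⟨hPM, hP, hPξ, hmin⟩
    refine ⟨⟨P, hPM⟩, rfl, (hco ⟨P, hPM⟩).2 hP, (h1 P hP).2 hPξ, fun q hq hqξ => ?_⟩
    exact hmin q q.2 ((hco q).1 hq) ((h1 _ ((hco q).1 hq)).1 hqξ)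

/-- The projection onto a closed subspace invariant under the commutant. -/
theorem starProjection_mem_of_invariant {M : VonNeumannAlgebra H} (E : Submodule ℂ H)
    [E.HasOrthogonalProjection] (hE : ∀ y ∈ M.commutant, ∀ x ∈ E, y x ∈ E) :
    E.starProjection ∈ M := by
  rw [VonNeumannAlgebra.IsStarProjection.mem_iff isStarProjection_starProjection]
  intro y hy
  rw [Submodule.range_starProjection, Module.End.mem_invtSubmodule]
  exact fun x hx => hE y hy x hx

/-- A projection under which a vector is supported absorbs every operator of the algebra that
annihilates the vector. -/
theorem IsSupportProjection.mul_eq_zero {M : VonNeumannAlgebra H} {ξ : H} {P X : H →L[ℂ] H}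
    (hP : IsSupportProjection M (vectorFunctional M ξ) P) (hX : X ∈ M) (h0 : X ξ = 0) :
    X * P = 0 := by
  rw [isSupportProjection_iff] at hP
  obtain ⟨-, hPs, -, hmin⟩ := hP
  let E : Submodule ℂ H := LinearMap.ker X.toLinearMap
  have hEc : IsClosed (E : Set H) := ContinuousLinearMap.isClosed_ker X
  have : CompleteSpace E := hEc.completeSpace_coe
  have hmem : E.starProjection ∈ M := starProjection_mem_of_invariant E fun y hy x hx => by
    have hx' : X x = 0 := hx
    have hc := congrArg (fun Z : H →L[ℂ] H => Z x) (VonNeumannAlgebra.mem_commutant_iff.1 hy X hX)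
    have hc' : X (y x) = y (X x) := hc
    show X (y x) = 0
    rw [hc', hx', map_zero]
  have hle := hmin _ hmem isStarProjection_starProjection
    (Submodule.starProjection_eq_self_iff.2 (show X ξ = 0 from h0))
  rw [hPs.le_iff_mul_eq_right isStarProjection_starProjection] at hle
  ext x
  have h2 : E.starProjection (P x) = P x := congrArg (fun Z : H →L[ℂ] H => Z x) hle
  have h3 : P x ∈ E := Submodule.starProjection_eq_self_iff.1 h2
  exact h3

variable {ψ : CuntzAlgebra d →ₗ[ℂ] ℂ} {π : CuntzAlgebra d →⋆ₐ[ℂ] (H →L[ℂ] H)} {Ω : H}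
  {V : K →ₗᵢ[ℂ] H} {v : Fin d → (K →L[ℂ] K)} {ω : K}

/-- The closed span of the vectors `S_I f` contains the cyclic subspace of each vector of the
small space. -/
theorem IsCuntzDilation.rep_apply_mem_closure
    (h : IsCuntzDilation v V fun k => π (cuntzGen d k)) (f : K) (a : CuntzAlgebra d) :
    π a (V f) ∈ closure (dilationSpan V fun k => π (cuntzGen d k) : Set H) := by
  let E := dilationSpan V fun k => π (cuntzGen d k)
  let L : CuntzAlgebra d →ₗ[ℂ] H :=
    (ContinuousLinearMap.apply ℂ H (V f)).toLinearMap ∘ₗ π.toAlgHom.toLinearMap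
  have hL : Continuous L :=
    (ContinuousLinearMap.apply ℂ H (V f)).continuous.comp (rep_continuous π)
  refine CuntzAlgebra.mem_of_isClosed (E.topologicalClosure.comap L)
    ((Submodule.isClosed_topologicalClosure _).preimage hL) ?_ a
  rw [wordSpan, Submodule.span_le]
  rintro _ ⟨I, J, rfl⟩
  refine Submodule.le_topologicalClosure _ (Submodule.subset_span ⟨I, star (word v J) f, ?_⟩)
  show π _ (V f) = _
  rw [map_mul, map_star, map_word, map_word, mul_apply_eq_comp, h.star_word_apply]

/-- A dilation containing the cyclic vector in its small space is minimal. -/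
theorem IsCuntzDilation.isPopescuDilation_of_isGNS
    (h : IsCuntzDilation v V fun k => π (cuntzGen d k)) (hG : IsGNS ψ π Ω) (hω : V ω = Ω) :
    IsPopescuDilation v V fun k => π (cuntzGen d k) where
  cuntz := h.cuntz
  intertwine := h.intertwine
  total := fun x => closure_minimal
    (by rintro _ ⟨a, rfl⟩; rw [← hω]; exact h.rep_apply_mem_closure ω a) isClosed_closure (hG.2 x)

theorem commutant_rep_iff {X : H →L[ℂ] H} :
    X ∈ Set.centralizer (Set.range π) ↔ X ∈ (familyVN fun k => π (cuntzGen d k)).commutant := by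
  rw [← repVN_commutant_eq, mem_commutant_repVN, Set.mem_centralizer_iff, Set.forall_mem_range]

/-- A dilation of a GNS representation whose projection lies in the von Neumann algebra of the
representation, and whose cyclic vector is separating below, has all the properties of the
support system. -/
theorem IsCuntzDilation.isSupportSystem (h : IsCuntzDilation v V fun k => π (cuntzGen d k))
    (hG : IsGNS ψ π Ω) (hω : V ω = Ω) (hP : rangeProj V ∈ repVN π)
    (hf : IsFaithful (vectorFunctional (familyVN v) ω)) : IsSupportSystem ψ π Ω V v ω := by
  have hp := h.isPopescuDilation_of_isGNS hG hω
  have hP' := hP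
  rw [repVN_eq_familyVN] at hP'
  have hfix : ∀ {X : H →L[ℂ] H}, X ∈ Set.centralizer (Set.range π) →
      conjSum (fun k => π (cuntzGen d k)) X = X := fun hX =>
    h.cuntz.conjSum_eq_self_iff.2 (commutant_rep_iff.1 hX)
  refine
    { embed := hω
      v_eq := fun k => (h.compress_gen k).symm
      proj_mem := hP
      subharmonic := h.subharmonic
      iterate_mono := h.iterate_mono
      iterate_tendsto := hp.iterate_tendsto
      coinvariant := h.coinvariant
      sum_eq_one := h.sum_eq_one
      moments := fun I J => ?_
      total := hp.total
      corner := ?_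
      faithful := hf
      lift_bij := ?_
      lift_norm := fun X hX _ => hp.norm_compress_eq (hfix hX)
      lift_order := fun X hX Y hY _ _ => hp.compress_le_iff (hfix hX) (hfix hY)
      commutant_eq := hp.commutant_eq hP' }
  · rw [← hG.1, map_mul, map_star, map_word, map_word, ← hω, h.inner_word]
  · rw [repVN_eq_familyVN]
    exact hp.corner_eq hP'
  · refine ⟨?_, ?_, ?_⟩
    · rintro X ⟨hX, hXs⟩
      refine ⟨?_, ?_⟩
      · rw [← h.compress_conjSum, hfix hX]
      · rw [IsSelfAdjoint, star_compress, hXs.star_eq]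
    · rintro X ⟨hX, -⟩ Y ⟨hY, -⟩ hXY
      exact hp.eq_of_compress_eq (hfix hX) (hfix hY) hXY
    · rintro D ⟨hD, hDs⟩
      obtain ⟨X, hX, rfl⟩ := hp.exists_lift hD
      refine ⟨X, ⟨commutant_rep_iff.2 (h.cuntz.conjSum_eq_self_iff.1 hX), ?_⟩, rfl⟩
      refine hp.eq_of_compress_eq (by rw [← star_conjSum, hX]) hX ?_
      rw [← star_compress, hDs.star_eq]

theorem IsSupportSystem.intertwine (h : IsSupportSystem ψ π Ω V v ω) :
    IsCuntzDilation v V fun k => π (cuntzGen d k) where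
  cuntz := isCuntzFamily_rep π
  intertwine := fun k f => by
    have h1 := congrArg (fun Z : H →L[ℂ] H => Z (V f)) (h.coinvariant k)
    simp only [mul_apply_eq_comp, rangeProj_apply_self] at h1
    rw [← h1, h.v_eq, star_compress, rangeProj_apply]
    rfl

/-- The subspace of a support system is the support of the state. -/
theorem IsSupportSystem.isSupportProjection (h : IsSupportSystem ψ π Ω V v ω) :
    IsSupportProjection (repVN π) (vectorFunctional (repVN π) Ω) (rangeProj V) := by
  rw [isSupportProjection_iff]
  refine ⟨h.proj_mem, isStarProjection_rangeProj V, by rw [← h.embed, rangeProj_apply_self],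
    fun q hqM hq hqΩ => ?_⟩
  rw [(isStarProjection_rangeProj V).le_iff_mul_eq_right hq]
  have hmem : compress V (1 - q) ∈ familyVN v := by
    rw [← SetLike.mem_coe, ← h.corner]
    exact ⟨_, sub_mem (one_mem _) hqM, rfl⟩
  have h0 : compress V (1 - q) = 0 := by
    refine isFaithful_vectorFunctional_iff.1 h.faithful _ hmem ?_
    rw [compress_apply, h.embed]
    simp [hqΩ]
  ext x
  rw [mul_apply_eq_comp, rangeProj_apply]
  set f := V.toContinuousLinearMap.adjoint x
  refine hq.apply_eq_self_of_inner ?_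
  have h1 := inner_compress V (1 - q) f f
  rw [h0] at h1
  simp only [zero_apply, inner_zero_right, sub_apply, one_apply_eq_self, inner_sub_right] at h1
  exact (sub_eq_zero.1 h1.symm).symm

/-- In the GNS representation of an invariant state, the operators `S_k^*` act on the cyclic
vector as elements of the commutant. -/
theorem exists_commutant_apply_eq (hinv : IsInvariantUnder (cuntzEndo d) ψ) (hG : IsGNS ψ π Ω)
    (k : Fin d) : ∃ W ∈ (repVN π).commutant, W Ω = star (π (cuntzGen d k)) Ω := by
  let ev : H → CuntzAlgebra d →ₗ[ℂ] H := fun x =>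
    (ContinuousLinearMap.apply ℂ H x).toLinearMap ∘ₗ π.toAlgHom.toLinearMap
  have hev : ∀ x a, ev x a = π a x := fun x a => rfl
  have hsum : ∀ a, ∑ j, ‖π a (star (π (cuntzGen d j)) Ω)‖ ^ 2 = ‖π a Ω‖ ^ 2 := by
    intro a
    have h1 := inner_conjSum (fun k => π (cuntzGen d k)) (π (star a * a)) Ω Ω
    have h2 : conjSum (fun k => π (cuntzGen d k)) (π (star a * a)) =
      π (cuntzEndo d (star a * a)) := (map_conjSum π _ _).symm
    rw [h2, hG.1, hinv, ← hG.1, map_mul, map_star, inner_star_mul_self] at h1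
    simp only [inner_star_mul_self] at h1
    exact_mod_cast h1.symm
  have hle : ∀ a, ‖ev (star (π (cuntzGen d k)) Ω) a‖ ≤ 1 * ‖ev Ω a‖ := by
    intro a
    rw [one_mul, ← sq_le_sq₀ (norm_nonneg _) (norm_nonneg _), hev, hev, ← hsum a]
    exact Finset.single_le_sum (f := fun j => ‖π a (star (π (cuntzGen d j)) Ω)‖ ^ 2)
      (fun _ _ => sq_nonneg _) (Finset.mem_univ k)
  obtain ⟨W, hW⟩ := exists_clm_comp_eq _ _ 1 hle
  have hW : ∀ a, W (π a Ω) = π a (star (π (cuntzGen d k)) Ω) := hW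
  refine ⟨W, mem_commutant_repVN.2 fun a => ?_, by simpa using hW 1⟩
  ext x
  refine isClosed_property hG.2 (isClosed_eq (f := fun x => (π a * W) x)
    (g := fun x => (W * π a) x) (by fun_prop) (by fun_prop)) (fun b => ?_) x
  rw [mul_apply_eq_comp, mul_apply_eq_comp, hW, ← mul_apply_eq_comp, ← map_mul,
    ← mul_apply_eq_comp (π a) (π b), ← map_mul, hW]

/-- Invariance of the state extends from the algebra to its von Neumann algebra. -/
theorem inner_conjSum_of_mem_repVN (hinv : IsInvariantUnder (cuntzEndo d) ψ) (hG : IsGNS ψ π Ω)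
    {X : H →L[ℂ] H} (hX : X ∈ repVN π) :
    ⟪Ω, conjSum (fun k => π (cuntzGen d k)) X Ω⟫_ℂ = ⟪Ω, X Ω⟫_ℂ := by
  choose W hWc hW using exists_commutant_apply_eq hinv hG
  have hcomm : ∀ k, ∀ Y ∈ repVN π, Y (W k Ω) = W k (Y Ω) := fun k Y hY =>
    congrArg (fun Z : H →L[ℂ] H => Z Ω) (VonNeumannAlgebra.mem_commutant_iff.1 (hWc k) Y hY)
  have key : ∀ y, ∑ k, ⟪W k Ω, W k y⟫_ℂ = ⟪Ω, y⟫_ℂ := by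
    refine isClosed_property hG.2 (isClosed_eq (by fun_prop) (by fun_prop)) fun b => ?_
    simp only [← hcomm _ _ (rep_mem_repVN π b), hW]
    rw [← inner_conjSum (fun k => π (cuntzGen d k))]
    have h2 : conjSum (fun k => π (cuntzGen d k)) (π b) = π (cuntzEndo d b) :=
      (map_conjSum π _ _).symm
    rw [h2, hG.1, hG.1, hinv]
  rw [inner_conjSum]
  simp only [← hW, hcomm _ X hX]
  exact key _

/-- The support projection of an invariant state is invariant under the operators `S_k^*`: the
projection `Λ(P)` has full expectation, hence dominates `P`. -/
theorem isCuntzDilation_of_isSupportProjection (hinv : IsInvariantUnder (cuntzEndo d) ψ)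
    (hG : IsGNS ψ π Ω)
    (hP : IsSupportProjection (repVN π) (vectorFunctional (repVN π) Ω) (rangeProj V))
    (hv : ∀ k, v k = compress V (π (cuntzGen d k))) :
    IsCuntzDilation v V fun k => π (cuntzGen d k) where
  cuntz := isCuntzFamily_rep π
  intertwine := fun k f => by
    have hC := isCuntzFamily_rep π
    obtain ⟨hPM, hPs, hPΩ, hmin⟩ := isSupportProjection_iff.1 hP
    have hΛs := hC.isStarProjection_conjSum hPs
    have hΛΩ := hΛs.apply_eq_self_of_inner (ξ := Ω)
      (by rw [inner_conjSum_of_mem_repVN hinv hG hPM, hPΩ])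
    have hΛM : conjSum (fun k => π (cuntzGen d k)) (rangeProj V) ∈ repVN π :=
      sum_mem fun j _ => mul_mem (mul_mem (rep_mem_repVN π _) hPM)
        (star_mem (rep_mem_repVN π _))
    have hle := hmin _ hΛM hΛs hΛΩ
    rw [hPs.le_iff_mul_eq_right hΛs] at hle
    have h1 : star (π (cuntzGen d k)) * rangeProj V =
        rangeProj V * star (π (cuntzGen d k)) * rangeProj V := by
      conv_lhs => rw [← hle, ← mul_assoc, hC.star_mul_conjSum]
    have h2 := congrArg (fun Z : H →L[ℂ] H => Z (V f)) h1
    simp only [mul_apply_eq_comp, rangeProj_apply_self] at h2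
    rw [h2, hv, star_compress, rangeProj_apply]
    rfl

/-- The state is faithful on the von Neumann algebra of the compressed family. -/
theorem isFaithful_of_isSupportProjection
    (hp : IsPopescuDilation v V fun k => π (cuntzGen d k)) (hω : V ω = Ω)
    (hP : IsSupportProjection (repVN π) (vectorFunctional (repVN π) Ω) (rangeProj V)) :
    IsFaithful (vectorFunctional (familyVN v) ω) := by
  rw [isFaithful_vectorFunctional_iff]
  intro x hx h0
  have hPM := (isSupportProjection_iff.1 hP).1
  have hX : inflate V x ∈ repVN π := by
    rw [repVN_eq_familyVN] at hPM ⊢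
    exact hp.inflate_mem hPM hx
  have h1 := hP.mul_eq_zero hX (by rw [← hω, inflate_apply_self, h0, map_zero])
  ext f
  have h2 := congrArg (fun Z : H →L[ℂ] H => Z (V f)) h1
  simp only [mul_apply_eq_comp, rangeProj_apply_self, inflate_apply_self, zero_apply] at h2
  rw [zero_apply]
  exact V.injective (by rw [h2, map_zero])

theorem rangeProj_subtype (E : Submodule ℂ H) [CompleteSpace E] :
    rangeProj E.subtypeₗᵢ = E.starProjection := by
  show E.subtypeL ∘L E.subtypeL.adjoint = _
  rw [Submodule.adjoint_subtypeL]
  rfl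

end Support

/-! ### Positive functionals -/

section Positive

variable {A : Type*} [Ring A] [StarRing A] [Algebra ℂ A] [StarModule ℂ A]

/-- The Cauchy–Schwarz inequality against the unit. -/
theorem norm_sq_le_of_isState {ω : A →ₗ[ℂ] ℂ} (hω : IsState ω) (a : A) :
    ‖ω a‖ ^ 2 ≤ (ω (star a * a)).re := by
  have hr : ∀ b, 0 ≤ (ω (star b * b)).re ∧ 0 = (ω (star b * b)).im := fun b =>
    Complex.nonneg_iff.1 (hω.2 b)
  have hexp : ∀ c : ℂ, ω (star (a - c • 1) * (a - c • 1)) =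
      ω (star a * a) - c * ω (star a) - (starRingEnd ℂ c) * ω a + (starRingEnd ℂ c) * c := by
    intro c
    have : star (a - c • (1 : A)) * (a - c • 1) =
        star a * a - c • star a - (starRingEnd ℂ c) • a + ((starRingEnd ℂ c) * c) • 1 := by
      rw [star_sub, star_smul, star_one, sub_mul, mul_sub, mul_sub, mul_smul_comm, mul_one,
        smul_mul_assoc, one_mul, smul_mul_assoc, one_mul, smul_smul]
      simp only [Complex.star_def]
      abel
    rw [this]
    simp [hω.1]
  have him : ∀ c : ℂ, (-(c * ω (star a)) - (starRingEnd ℂ c) * ω a).im = 0 := by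
    intro c
    have h1 := (hr (a - c • 1)).2
    have h2 := (hr a).2
    rw [hexp] at h1
    have h3 : ((starRingEnd ℂ c) * c).im = 0 := by simp; ring
    simp only [Complex.add_im, Complex.sub_im, h3, ← h2] at h1
    simp only [Complex.sub_im, Complex.neg_im]
    linarith
  have hstar : ω (star a) = starRingEnd ℂ (ω a) := by
    have h1 := him 1
    have h2 := him Complex.I
    simp at h1 h2
    apply Complex.ext <;> simp <;> linarith
  have h1 := (hr (a - ω a • 1)).1
  rw [hexp, hstar] at h1
  have h4 : (ω a * starRingEnd ℂ (ω a)).re = ‖ω a‖ ^ 2 := by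
    rw [Complex.mul_conj, Complex.ofReal_re, Complex.normSq_eq_norm_sq]
  have h5 : ((starRingEnd ℂ (ω a)) * ω a).re = ‖ω a‖ ^ 2 := by rw [mul_comm, h4]
  simp only [Complex.add_re, Complex.sub_re, h4, h5] at h1
  linarith

end Positive

/-! ### Ergodicity -/

section Ergodic

variable {A : Type*} [Ring A] [StarRing A] [Algebra ℂ A]
  {H : Type*} [NormedAddCommGroup H] [InnerProductSpace ℂ H] [CompleteSpace H]
  {d : ℕ} {w : Fin d → A} {π : A →⋆ₐ[ℂ] (H →L[ℂ] H)} {Ω : H} {φ : A →ₗ[ℂ] ℂ}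

theorem isState_of_inner (hφ : ∀ a, ⟪Ω, π a Ω⟫_ℂ = φ a) (hΩ : ⟪Ω, Ω⟫_ℂ = 1) : IsState φ := by
  refine ⟨by rw [← hφ, map_one]; exact hΩ, fun a => ?_⟩
  rw [← hφ, map_mul, map_star, inner_star_mul_self]
  exact Complex.zero_le_real.2 (sq_nonneg _)

theorem map_conjSum_iterate (n : ℕ) (a : A) :
    π ((conjSum w)^[n] a) = (conjSum fun k => π (w k))^[n] (π a) := by
  induction n with
  | zero => rfl
  | succ n ih => rw [Function.iterate_succ_apply', Function.iterate_succ_apply', map_conjSum, ih]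

/-- A `T`-invariant state dominated by a multiple of `φ` equals `φ`, if all fixed points in the
von Neumann algebra are scalars: the value of either state at `a` is the scalar which is a weak
limit point of the Cesàro means of the orbit of `a`. -/
theorem eq_of_dominated [StarModule ℂ A] (hS : ∑ k, π (w k) * star (π (w k)) = 1)
    (hφ : ∀ a, ⟪Ω, π a Ω⟫_ℂ = φ a) (hφs : IsState φ) (hφi : IsInvariantUnder (conjSum w) φ)
    (hfix : ∀ z ∈ repVN π, conjSum (fun k => π (w k)) z = z →
      ∃ c : ℂ, z = c • (1 : H →L[ℂ] H))
    {ω : A →ₗ[ℂ] ℂ} (hω : IsState ω) (hωi : IsInvariantUnder (conjSum w) ω) {t : ℝ}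
    (ht : ∀ a, (ω (star a * a)).re ≤ t * (φ (star a * a)).re) : ω = φ := by
  have hsq : ∀ a, (φ (star a * a)).re = ‖π a Ω‖ ^ 2 := fun a => by
    rw [← hφ, map_mul, map_star, inner_star_mul_self, Complex.ofReal_re]
  have ht0 : 0 ≤ t := by
    have h1 := ht 1
    simp only [star_one, mul_one, hω.1, hφs.1, Complex.one_re] at h1
    linarith
  -- the dominated state is implemented by a vector
  obtain ⟨η, hη⟩ : ∃ η : H, ∀ a, ⟪η, π a Ω⟫_ℂ = ω a := by
    let f : A →ₗ[ℂ] H :=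
      (ContinuousLinearMap.apply ℂ H Ω).toLinearMap ∘ₗ π.toAlgHom.toLinearMap
    have hf : ∀ a, f a = π a Ω := fun a => rfl
    obtain ⟨W, hW⟩ := exists_clm_comp_eq f ω (Real.sqrt t) fun a => by
      rw [hf, ← Real.sqrt_sq (norm_nonneg (π a Ω)), ← Real.sqrt_mul ht0]
      refine Real.le_sqrt_of_sq_le ((norm_sq_le_of_isState hω a).trans ?_)
      rw [← hsq]
      exact ht a
    refine ⟨(InnerProductSpace.toDual ℂ H).symm W, fun a => ?_⟩
    rw [InnerProductSpace.toDual_symm_apply]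
    exact hW a
  have hφn : ∀ n a, φ ((conjSum w)^[n] a) = φ a := fun n a => by
    induction n with
    | zero => rfl
    | succ n ih => rw [Function.iterate_succ_apply', hφi, ih]
  have hωn : ∀ n a, ω ((conjSum w)^[n] a) = ω a := fun n a => by
    induction n with
    | zero => rfl
    | succ n ih => rw [Function.iterate_succ_apply', hωi, ih]
  ext a
  let b : ℕ → A := fun n => ((n + 1 : ℕ) : ℂ)⁻¹ • ∑ k ∈ Finset.range (n + 1), (conjSum w)^[k] a
  have hn0 : ∀ n : ℕ, ((n + 1 : ℕ) : ℂ) ≠ 0 := fun n => Nat.cast_ne_zero.2 n.succ_ne_zero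
  have hmean : ∀ (χ : A →ₗ[ℂ] ℂ), (∀ n, χ ((conjSum w)^[n] a) = χ a) → ∀ n, χ (b n) = χ a := by
    intro χ hχ n
    simp only [b, map_smul, map_sum, hχ, Finset.sum_const, Finset.card_range, nsmul_eq_mul,
      smul_eq_mul]
    rw [inv_mul_cancel_left₀ (hn0 n)]
  have hpw : ∀ n, ‖π ((conjSum w)^[n] a)‖ ≤ ‖π a‖ := fun n => by
    rw [map_conjSum_iterate]
    exact norm_conjSum_iterate_le hS _ n
  have hbn : ∀ n, ‖π (b n)‖ ≤ ‖π a‖ := by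
    intro n
    simp only [b, map_smul, map_sum]
    rw [norm_smul, norm_inv, Complex.norm_natCast]
    have h1 : ‖∑ k ∈ Finset.range (n + 1), π ((conjSum w)^[k] a)‖ ≤ ((n + 1 : ℕ) : ℝ) * ‖π a‖ := by
      refine (norm_sum_le _ _).trans ((Finset.sum_le_sum fun k _ => hpw k).trans ?_)
      simp
    have h2 : (0 : ℝ) < ((n + 1 : ℕ) : ℝ) := by positivity
    rw [inv_mul_le_iff₀ h2]
    exact h1
  obtain ⟨z, hz⟩ := exists_weak_limit (hyperfilter ℕ) (fun n => π (b n)) ‖π a‖ hbn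
  have hzmem : z ∈ repVN π := by
    rw [VonNeumannAlgebra.mem_iff_forall_commutant]
    intro y hy
    ext ξ
    refine ext_inner_left ℂ fun ζ => ?_
    rw [mul_apply_eq_comp, mul_apply_eq_comp, ← inner_star_left]
    refine tendsto_nhds_unique (hz (star y ζ) ξ) ((hz ζ (y ξ)).congr fun n => ?_)
    rw [inner_star_left, ← mul_apply_eq_comp, ← mul_apply_eq_comp, mem_commutant_repVN.1 hy]
  have hzfix : conjSum (fun k => π (w k)) z = z := by
    ext ξ
    refine ext_inner_left ℂ fun ζ => ?_
    have hdiff : ∀ n, conjSum w (b n) - b n =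
        ((n + 1 : ℕ) : ℂ)⁻¹ • ((conjSum w)^[n + 1] a - a) := by
      intro n
      have h1 : conjSum w (∑ k ∈ Finset.range (n + 1), (conjSum w)^[k] a) =
          ∑ k ∈ Finset.range (n + 1), (conjSum w)^[k + 1] a := by
        simp only [Function.iterate_succ_apply']
        exact map_sum (AddMonoidHom.mk' (conjSum w) (conjSum_add w)) _ _
      simp only [b]
      rw [conjSum_smul, h1, ← smul_sub, ← Finset.sum_sub_distrib, Finset.sum_range_sub
        (fun k => (conjSum w)^[k] a)]
      rfl
    have hlim : Tendsto (fun n : ℕ => ⟪ζ, π (conjSum w (b n) - b n) ξ⟫_ℂ) atTop (𝓝 0) := by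
      have hB : Tendsto (fun n : ℕ => (((n + 1 : ℕ) : ℝ))⁻¹ * (‖ζ‖ * (2 * ‖π a‖ * ‖ξ‖)))
          atTop (𝓝 0) := by
        have := ((tendsto_add_atTop_iff_nat 1).2 (tendsto_inv_atTop_nhds_zero_nat (𝕜 := ℝ))).mul_const
          (‖ζ‖ * (2 * ‖π a‖ * ‖ξ‖))
        simpa using this
      refine squeeze_zero_norm (fun n => ?_) hB
      rw [hdiff, map_smul, smul_apply, inner_smul_right, norm_mul, norm_inv, Complex.norm_natCast]
      gcongr
      refine (norm_inner_le_norm _ _).trans ?_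
      gcongr
      refine ContinuousLinearMap.le_of_opNorm_le _ ?_ ξ
      rw [map_sub]
      exact (norm_sub_le _ _).trans (by linarith [hpw (n + 1)])
    have h1 := tendsto_inner_conjSum (S := fun k => π (w k)) hz ζ ξ
    have h2 := (hz ζ ξ).add (hlim.mono_left Nat.hyperfilter_le_atTop)
    rw [add_zero] at h2
    refine tendsto_nhds_unique h1 (h2.congr fun n => ?_)
    rw [← inner_add_right, ← add_apply, ← map_add, add_sub_cancel, map_conjSum]
  obtain ⟨c, rfl⟩ := hfix z hzmem hzfix
  have hval : ∀ (χ : A →ₗ[ℂ] ℂ) (ζ : H), χ 1 = 1 → (∀ a, ⟪ζ, π a Ω⟫_ℂ = χ a) →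
      (∀ n, χ ((conjSum w)^[n] a) = χ a) → χ a = c := by
    intro χ ζ h1 hχ hχn
    have h2 : ⟪ζ, (c • (1 : H →L[ℂ] H)) Ω⟫_ℂ = c := by
      have h3 : ⟪ζ, Ω⟫_ℂ = 1 := by rw [← h1, ← hχ, map_one, one_apply_eq_self]
      rw [smul_apply, one_apply_eq_self, inner_smul_right, h3, mul_one]
    have h4 := hz ζ Ω
    rw [h2] at h4
    simp only [hχ, hmean χ hχn] at h4
    exact tendsto_nhds_unique tendsto_const_nhds h4
  rw [hval ω η hω.1 hη fun n => hωn n a, hval φ Ω hφs.1 hφ fun n => hφn n a]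

/-- A state is ergodic if all fixed points in the von Neumann algebra are scalars. -/
theorem isErgodic_of_fixed_scalar [StarModule ℂ A]
    (hS : ∑ k, π (w k) * star (π (w k)) = 1)
    (hφ : ∀ a, ⟪Ω, π a Ω⟫_ℂ = φ a) (hφs : IsState φ) (hφi : IsInvariantUnder (conjSum w) φ)
    (hfix : ∀ z ∈ repVN π, conjSum (fun k => π (w k)) z = z →
      ∃ c : ℂ, z = c • (1 : H →L[ℂ] H)) : IsErgodic (conjSum w) φ := by
  refine ⟨⟨hφs, hφi⟩, ?_⟩
  rintro ω₁ ⟨h₁, h₁'⟩ ω₂ ⟨h₂, h₂'⟩ ⟨s, t, hs, ht, -, rfl⟩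
  refine eq_of_dominated hS hφ hφs hφi hfix h₁ h₁' (t := s⁻¹) fun a => ?_
  have h3 := (Complex.nonneg_iff.1 (h₂.2 a)).1
  have h4 : ((s • ω₁ + t • ω₂ : A →ₗ[ℂ] ℂ) (star a * a)).re =
      s * (ω₁ (star a * a)).re + t * (ω₂ (star a * a)).re := by simp
  rw [h4, mul_add, inv_mul_cancel_left₀ hs.ne']
  have : 0 ≤ s⁻¹ * (t * (ω₂ (star a * a)).re) := by positivity
  linarith

/-- A self-adjoint operator of the commutant with mean zero and implementing an invariant
functional implements zero, if the state is ergodic: otherwise `φ` would be the midpoint of the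
states implemented by `1 ± ε T`. -/
theorem inner_eq_zero_of_isErgodic (hφ : ∀ a, ⟪Ω, π a Ω⟫_ℂ = φ a)
    (hE : IsErgodic (conjSum w) φ) {T : H →L[ℂ] H} (hTs : IsSelfAdjoint T)
    (hTc : ∀ a, π a * T = T * π a)
    (hTi : ∀ a, ⟪Ω, T (π (conjSum w a) Ω)⟫_ℂ = ⟪Ω, T (π a Ω)⟫_ℂ)
    (hT0 : ⟪Ω, T Ω⟫_ℂ = 0) (a : A) : ⟪Ω, T (π a Ω)⟫_ℂ = 0 := by
  obtain ⟨⟨hφs, hφi⟩, hext⟩ := hE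
  let χ : A →ₗ[ℂ] ℂ :=
    { toFun := fun a => ⟪Ω, T (π a Ω)⟫_ℂ
      map_add' := fun a b => by simp
      map_smul' := fun c a => by simp }
  have hχ : ∀ a, χ a = ⟪Ω, T (π a Ω)⟫_ℂ := fun a => rfl
  have hpos : ∀ a, χ (star a * a) = ⟪π a Ω, T (π a Ω)⟫_ℂ := by
    intro a
    rw [hχ, map_mul, map_star, ← mul_apply_eq_comp, ← mul_assoc, ← map_star, ← hTc,
      mul_assoc, map_star, mul_apply_eq_comp, inner_star_right, mul_apply_eq_comp]
  have hreal : ∀ y, (⟪y, T y⟫_ℂ).im = 0 := by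
    intro y
    have h1 : (starRingEnd ℂ) ⟪y, T y⟫_ℂ = ⟪y, T y⟫_ℂ := by
      rw [inner_conj_symm, ← inner_star_right, hTs.star_eq]
    exact Complex.conj_eq_iff_im.1 h1
  have hstate : ∀ r : ℝ, |r| * ‖T‖ ≤ 1 →
      IsState (φ + (r : ℂ) • χ) ∧ IsInvariantUnder (conjSum w) (φ + (r : ℂ) • χ) := by
    intro r hr
    refine ⟨⟨?_, fun b => ?_⟩, fun b => ?_⟩
    · have : χ 1 = 0 := by rw [hχ, map_one]; exact hT0
      simp [this, hφs.1]
    · rw [LinearMap.add_apply, LinearMap.smul_apply, hpos, ← hφ, map_mul, map_star,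
        inner_star_mul_self]
      set y := π b Ω
      have h1 : ‖⟪y, T y⟫_ℂ‖ ≤ ‖T‖ * ‖y‖ ^ 2 := by
        refine (norm_inner_le_norm _ _).trans ?_
        nlinarith [T.le_opNorm y, norm_nonneg y]
      have h2 : |(⟪y, T y⟫_ℂ).re| ≤ ‖T‖ * ‖y‖ ^ 2 := (Complex.abs_re_le_norm _).trans h1
      have h3 : |r * (⟪y, T y⟫_ℂ).re| ≤ ‖y‖ ^ 2 := by
        rw [abs_mul]
        calc |r| * |(⟪y, T y⟫_ℂ).re| ≤ |r| * (‖T‖ * ‖y‖ ^ 2) := by gcongr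
          _ = (|r| * ‖T‖) * ‖y‖ ^ 2 := by ring
          _ ≤ 1 * ‖y‖ ^ 2 := by gcongr
          _ = ‖y‖ ^ 2 := one_mul _
      rw [Complex.nonneg_iff]
      constructor
      · simp only [Complex.add_re, Complex.ofReal_re, smul_eq_mul, Complex.re_ofReal_mul]
        linarith [neg_abs_le (r * (⟪y, T y⟫_ℂ).re)]
      · simp [hreal, -Complex.ofReal_pow]
    · simp only [LinearMap.add_apply, LinearMap.smul_apply, hχ, hTi, hφi b]
  -- a radius for which the perturbed functionals stay positive
  set ε : ℝ := (‖T‖ + 1)⁻¹ with hε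
  have hT1 : 0 < ‖T‖ + 1 := by positivity
  have hε0 : 0 < ε := inv_pos.2 hT1
  have hεT : ε * ‖T‖ ≤ 1 := by
    rw [hε, inv_mul_le_iff₀ hT1]
    linarith
  have h1 := hstate ε (by rwa [abs_of_pos hε0])
  have h2 := hstate (-ε) (by rwa [abs_neg, abs_of_pos hε0])
  have h3 := hext h1 h2 ⟨1 / 2, 1 / 2, by norm_num, by norm_num, by norm_num, by
    ext b
    simp
    ring⟩
  have h4 := congrArg (fun f : A →ₗ[ℂ] ℂ => f a) h3
  simp only [LinearMap.add_apply, LinearMap.smul_apply, smul_eq_mul, add_eq_left,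
    mul_eq_zero, Complex.ofReal_eq_zero, hε0.ne', false_or] at h4
  exact h4

end Ergodic

/-! ### Ergodicity and factors -/

section Factor

variable {H : Type*} [NormedAddCommGroup H] [InnerProductSpace ℂ H] [CompleteSpace H]
  {K : Type*} [NormedAddCommGroup K] [InnerProductSpace ℂ K] [CompleteSpace K]
  {d : ℕ}

/-- A von Neumann algebra with a separating unit vector is a factor if every self-adjoint central
element with mean zero annihilates that vector. -/
theorem VonNeumannAlgebra.isFactor_of_forall_mean_zero {M : VonNeumannAlgebra K} {ω : K}
    (hω : ⟪ω, ω⟫_ℂ = 1) (hf : ∀ x ∈ M, x ω = 0 → x = 0)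
    (h : ∀ T ∈ M, T ∈ M.commutant → IsSelfAdjoint T → ⟪ω, T ω⟫_ℂ = 0 → T ω = 0) :
    M.IsFactor := by
  have smul_mem : ∀ {N : VonNeumannAlgebra K} (c : ℂ) {x : K →L[ℂ] K}, x ∈ N → c • x ∈ N :=
    fun {N} c {x} hx => N.toStarSubalgebra.smul_mem hx c
  have hsa : ∀ D ∈ M, D ∈ M.commutant → IsSelfAdjoint D →
      ∃ c : ℂ, D = c • (1 : K →L[ℂ] K) := by
    intro D hD hD' hDs
    refine ⟨⟪ω, D ω⟫_ℂ, sub_eq_zero.1 ?_⟩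
    have hreal : (starRingEnd ℂ) ⟪ω, D ω⟫_ℂ = ⟪ω, D ω⟫_ℂ := by
      rw [inner_conj_symm, ← inner_star_right, hDs.star_eq]
    have hmem : D - ⟪ω, D ω⟫_ℂ • (1 : K →L[ℂ] K) ∈ M := sub_mem hD (smul_mem _ (one_mem _))
    refine hf _ hmem (h _ hmem (sub_mem hD' (smul_mem _ (one_mem _))) ?_ ?_)
    · rw [IsSelfAdjoint, star_sub, star_smul, star_one, hDs.star_eq, Complex.star_def, hreal]
    · rw [sub_apply, smul_apply, one_apply_eq_self, inner_sub_right, inner_smul_right, hω,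
        mul_one, sub_self]
  intro x hx hx'
  obtain ⟨a, ha⟩ := hsa (x + star x) (add_mem hx (star_mem hx)) (add_mem hx' (star_mem hx'))
    (IsSelfAdjoint.add_star_self x)
  obtain ⟨b, hb⟩ := hsa (Complex.I • (x - star x)) (smul_mem _ (sub_mem hx (star_mem hx)))
    (smul_mem _ (sub_mem hx' (star_mem hx'))) (by
      rw [IsSelfAdjoint, star_smul, star_sub, star_star, Complex.star_def, Complex.conj_I,
        neg_smul, ← smul_neg, neg_sub])
  refine ⟨(1 / 2 : ℂ) * (a - Complex.I * b), ?_⟩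
  have h1 : x - star x = -(Complex.I • (b • (1 : K →L[ℂ] K))) := by
    rw [← hb, smul_smul, Complex.I_mul_I, neg_smul, one_smul, neg_neg]
  have h2 : x = (1 / 2 : ℂ) • ((x + star x) + (x - star x)) := by
    rw [add_add_sub_cancel, ← two_smul ℂ x, smul_smul]
    norm_num
  rw [h2, ha, h1, smul_smul, ← neg_smul, ← add_smul, smul_smul]
  congr 1

theorem mem_of_mem_repVN_subtype {M : VonNeumannAlgebra K} {z : K →L[ℂ] K}
    (hz : z ∈ repVN M.toStarSubalgebra.subtype) : z ∈ M := by
  rw [VonNeumannAlgebra.mem_iff_forall_commutant] at hz ⊢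
  intro y hy
  exact hz y (mem_commutant_repVN.2 fun a => VonNeumannAlgebra.mem_commutant_iff.1 hy a a.2)

variable {ψ : CuntzAlgebra d →ₗ[ℂ] ℂ} {π : CuntzAlgebra d →⋆ₐ[ℂ] (H →L[ℂ] H)} {Ω : H}
  {V : K →ₗᵢ[ℂ] H} {v : Fin d → (K →L[ℂ] K)} {ω : K}

namespace IsSupportSystem

variable (h : IsSupportSystem ψ π Ω V v ω) (hG : IsGNS ψ π Ω)
include h

theorem isPopescuDilation : IsPopescuDilation v V fun k => π (cuntzGen d k) where
  cuntz := h.intertwine.cuntz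
  intertwine := h.intertwine.intertwine
  total := h.total

theorem rangeProj_mem_familyVN : rangeProj V ∈ familyVN fun k => π (cuntzGen d k) := by
  rw [← repVN_eq_familyVN]; exact h.proj_mem

include hG

theorem inner_self (hψ : IsState ψ) : ⟪ω, ω⟫_ℂ = 1 := by
  rw [← V.inner_map_map, h.embed, ← hψ.1, ← hG.1, map_one, one_apply_eq_self]

/-- The vector state of a support system is invariant under the Markov map. -/
theorem inner_conjSum_eq (hinv : IsInvariantUnder (cuntzEndo d) ψ) {x : K →L[ℂ] K}
    (hx : x ∈ familyVN v) : ⟪ω, conjSum v x ω⟫_ℂ = ⟪ω, x ω⟫_ℂ := by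
  have hX : inflate V x ∈ repVN π := by
    rw [repVN_eq_familyVN]
    exact h.isPopescuDilation.inflate_mem h.rangeProj_mem_familyVN hx
  have h1 := inner_conjSum_of_mem_repVN hinv hG hX
  rw [← h.embed, ← inner_compress, ← inner_compress, h.intertwine.compress_conjSum,
    compress_inflate] at h1
  exact h1

/-- A self-adjoint central element `D` of mean zero lifts to the commutant of the representation,
where it implements a `λ`-invariant functional, which vanishes by ergodicity. -/
theorem isFactor_of_isErgodic_cuntz (hψ : IsState ψ) (hinv : IsInvariantUnder (cuntzEndo d) ψ)
    (hE : IsErgodic (cuntzEndo d) ψ) : (familyVN v).IsFactor := by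
  have hp := h.isPopescuDilation
  have hP := h.rangeProj_mem_familyVN
  refine VonNeumannAlgebra.isFactor_of_forall_mean_zero (h.inner_self hG hψ)
    (isFaithful_vectorFunctional_iff.1 h.faithful) fun D hD hD' hDs hD0 => ?_
  have hDfix : conjSum v D = D := by
    rw [← SetLike.mem_coe, h.commutant_eq] at hD'; exact hD'
  obtain ⟨T, ⟨hTc, hTs⟩, rfl⟩ := h.lift_bij.surjOn ⟨hDfix, hDs⟩
  have hTc' := commutant_rep_iff.1 hTc
  have hcomm := IsPopescuDilation.commute_rangeProj hP hTc'
  have hval : ∀ X : H →L[ℂ] H, ⟪Ω, T (X Ω)⟫_ℂ = ⟪ω, (compress V T * compress V X) ω⟫_ℂ := by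
    intro X
    rw [← compress_mul_of_commute_left hcomm, inner_compress, h.embed]
    rfl
  have hcompmem : ∀ a, compress V (π a) ∈ familyVN v := fun a => by
    rw [← SetLike.mem_coe, ← h.corner]
    exact ⟨_, rep_mem_repVN π a, rfl⟩
  have key := inner_eq_zero_of_isErgodic (w := cuntzGen d) hG.1 hE hTs
    (fun a => hTc _ ⟨a, rfl⟩) (fun a => by
      rw [hval, hval, map_conjSum, h.intertwine.compress_conjSum,
        ← conjSum_mul_left fun k => (mem_commutant_familyVN.1 hD' k).1]
      exact h.inner_conjSum_eq hG hinv (mul_mem hD (hcompmem a))) (by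
      have := hval 1
      rw [one_apply_eq_self, compress_one, mul_one, hD0] at this
      exact this)
  have hTΩ : T Ω = 0 := by
    refine ext_inner_left ℂ fun y => ?_
    rw [inner_zero_right, ← inner_star_left, hTs.star_eq]
    refine isClosed_property hG.2 (isClosed_eq (f := fun y => ⟪T y, Ω⟫_ℂ) (g := fun _ => (0 : ℂ))
      (by fun_prop) (by fun_prop)) (fun a => ?_) y
    rw [← inner_conj_symm, key, map_zero]
  rw [compress_apply, h.embed, hTΩ, map_zero]

/-- A fixed point of `Λ` in `π(O_d)''` compresses into `M ∩ M'` and is determined by its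
compression. -/
theorem isErgodic_cuntz_of_isFactor (hψ : IsState ψ) (hinv : IsInvariantUnder (cuntzEndo d) ψ)
    (hF : (familyVN v).IsFactor) : IsErgodic (cuntzEndo d) ψ := by
  have hp := h.isPopescuDilation
  refine isErgodic_of_fixed_scalar (w := cuntzGen d) hp.cuntz.2 hG.1 hψ hinv fun z hz hfix => ?_
  have hcomp : compress V z ∈ (familyVN v).commutant := by
    rw [← SetLike.mem_coe, h.commutant_eq]
    show conjSum v (compress V z) = compress V z
    rw [← h.intertwine.compress_conjSum, hfix]
  obtain ⟨c, hc⟩ := hF (compress V z) (by rw [← SetLike.mem_coe, ← h.corner]; exact ⟨z, hz, rfl⟩)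
    hcomp
  refine ⟨c, hp.eq_of_compress_eq hfix ?_ ?_⟩
  · rw [conjSum_smul, conjSum_one hp.cuntz.2]
  · rw [hc]
    ext f
    simp [compress_apply, adjoint_apply_self]

theorem isState_vectorFunctional (hψ : IsState ψ) :
    IsState (vectorFunctional (familyVN v) ω) :=
  isState_of_inner (π := (familyVN v).toStarSubalgebra.subtype) (Ω := ω)
    (fun _ => rfl) (h.inner_self hG hψ)

theorem isInvariantUnder_markovMap (hinv : IsInvariantUnder (cuntzEndo d) ψ) :
    IsInvariantUnder (markovMap v) (vectorFunctional (familyVN v) ω) := fun a => by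
  have h1 : ((markovMap v a : (familyVN v).Elem) : K →L[ℂ] K) = conjSum v (a : K →L[ℂ] K) :=
    map_conjSum (familyVN v).toStarSubalgebra.subtype (famElem v) a
  rw [vectorFunctional_apply, vectorFunctional_apply, h1]
  exact h.inner_conjSum_eq hG hinv a.2

/-- The fixed points of `τ` in `M` are exactly the centre of `M`. -/
theorem isErgodic_markovMap_of_isFactor (hψ : IsState ψ)
    (hinv : IsInvariantUnder (cuntzEndo d) ψ) (hF : (familyVN v).IsFactor) :
    IsErgodic (markovMap v) (vectorFunctional (familyVN v) ω) := by
  refine isErgodic_of_fixed_scalar (w := famElem v) (π := (familyVN v).toStarSubalgebra.subtype)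
    (Ω := ω) h.sum_eq_one (fun a => rfl) (h.isState_vectorFunctional hG hψ)
    (h.isInvariantUnder_markovMap hG hinv) fun z hz hfix => ?_
  refine hF z (mem_of_mem_repVN_subtype hz) ?_
  rw [← SetLike.mem_coe, h.commutant_eq]
  exact hfix

theorem isFactor_of_isErgodic_markovMap (hψ : IsState ψ)
    (hinv : IsInvariantUnder (cuntzEndo d) ψ)
    (hE : IsErgodic (markovMap v) (vectorFunctional (familyVN v) ω)) :
    (familyVN v).IsFactor := by
  refine VonNeumannAlgebra.isFactor_of_forall_mean_zero (h.inner_self hG hψ)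
    (isFaithful_vectorFunctional_iff.1 h.faithful) fun D hD hD' hDs hD0 => ?_
  have key := inner_eq_zero_of_isErgodic (w := famElem v)
    (π := (familyVN v).toStarSubalgebra.subtype) (Ω := ω) (fun a => rfl) hE hDs
    (fun a => VonNeumannAlgebra.mem_commutant_iff.1 hD' a a.2) (fun a => by
      have h1 : (familyVN v).toStarSubalgebra.subtype (conjSum (famElem v) a) =
        conjSum v (a : K →L[ℂ] K) := map_conjSum _ (famElem v) a
      rw [h1, ← mul_apply_eq_comp,
        ← conjSum_mul_left fun k => (mem_commutant_familyVN.1 hD' k).1]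
      exact h.inner_conjSum_eq hG hinv (mul_mem hD a.2)) hD0 ⟨D, hD⟩
  have h2 : ⟪ω, D (D ω)⟫_ℂ = 0 := key
  rw [← inner_star_left, hDs.star_eq] at h2
  exact inner_self_eq_zero.1 h2

end IsSupportSystem

theorem isNormalFunctional_vectorFunctional (M : VonNeumannAlgebra K) (ω : K) :
    IsNormalFunctional M (vectorFunctional M ω) := by
  refine ⟨fun n => if n = 0 then ω else 0, ?_, fun x => ?_⟩
  · refine (hasSum_single 0 fun n hn => ?_).summable
    simp [hn]
  · refine (hasSum_single (f := fun n => ⟪(if n = 0 then ω else 0 : K),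
      (x : K →L[ℂ] K) (if n = 0 then ω else 0)⟫_ℂ) 0 fun n hn => ?_)
    simp [hn]

/-- The system carried by the support projection of an invariant state. -/
theorem exists_isSupportSystem_of_isSupportProjection
    (hinv : IsInvariantUnder (cuntzEndo d) ψ) (hG : IsGNS ψ π Ω) (hω : V ω = Ω)
    (hP : IsSupportProjection (repVN π) (vectorFunctional (repVN π) Ω) (rangeProj V))
    (hv : ∀ k, v k = compress V (π (cuntzGen d k))) : IsSupportSystem ψ π Ω V v ω := by
  have hD := isCuntzDilation_of_isSupportProjection hinv hG hP hv
  exact hD.isSupportSystem hG hω (isSupportProjection_iff.1 hP).1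
    (isFaithful_of_isSupportProjection (hD.isPopescuDilation_of_isGNS hG hω) hω hP)

end Factor

/-! ### Uniqueness of the support system -/

section Uniqueness

variable {d : ℕ}
  {H₁ : Type*} [NormedAddCommGroup H₁] [InnerProductSpace ℂ H₁] [CompleteSpace H₁]
  {K₁ : Type*} [NormedAddCommGroup K₁] [InnerProductSpace ℂ K₁] [CompleteSpace K₁]
  {H₂ : Type*} [NormedAddCommGroup H₂] [InnerProductSpace ℂ H₂] [CompleteSpace H₂]
  {K₂ : Type*} [NormedAddCommGroup K₂] [InnerProductSpace ℂ K₂] [CompleteSpace K₂]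
  {ψ : CuntzAlgebra d →ₗ[ℂ] ℂ}
  {π₁ : CuntzAlgebra d →⋆ₐ[ℂ] (H₁ →L[ℂ] H₁)} {Ω₁ : H₁}
  {V₁ : K₁ →ₗᵢ[ℂ] H₁} {v₁ : Fin d → (K₁ →L[ℂ] K₁)} {ω₁ : K₁}
  {π₂ : CuntzAlgebra d →⋆ₐ[ℂ] (H₂ →L[ℂ] H₂)} {Ω₂ : H₂}
  {V₂ : K₂ →ₗᵢ[ℂ] H₂} {v₂ : Fin d → (K₂ →L[ℂ] K₂)} {ω₂ : K₂}

theorem inner_rep_apply {A : Type*} [Ring A] [StarRing A] [Algebra ℂ A] {φ : A →ₗ[ℂ] ℂ}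
    {H : Type*} [NormedAddCommGroup H] [InnerProductSpace ℂ H] [CompleteSpace H]
    {π : A →⋆ₐ[ℂ] (H →L[ℂ] H)} {Ω : H} (hφ : ∀ a, ⟪Ω, π a Ω⟫_ℂ = φ a) (a b : A) :
    ⟪π a Ω, π b Ω⟫_ℂ = φ (star a * b) := by
  rw [← hφ, map_mul, map_star, mul_apply_eq_comp, inner_star_right]

theorem dense_span_of_denseRange {ι H : Type*} [NormedAddCommGroup H] [InnerProductSpace ℂ H]
    {e : ι → H} (h : DenseRange e) : Dense (Submodule.span ℂ (Set.range e) : Set H) :=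
  Dense.mono Submodule.subset_span h

/-- GNS representations of the same state are unitarily equivalent. -/
theorem exists_gns_equiv (h₁ : IsGNS ψ π₁ Ω₁) (h₂ : IsGNS ψ π₂ Ω₂) :
    ∃ R : H₁ ≃ₗᵢ[ℂ] H₂, R Ω₁ = Ω₂ ∧ ∀ a x, R (π₁ a x) = π₂ a (R x) := by
  obtain ⟨R, hR⟩ := exists_linearIsometryEquiv_of_gram (fun a => π₁ a Ω₁) (fun a => π₂ a Ω₂)
    (fun a b => by rw [inner_rep_apply h₁.1, inner_rep_apply h₂.1])
    (dense_span_of_denseRange h₁.2) (dense_span_of_denseRange h₂.2)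
  refine ⟨R, by simpa using hR 1, fun a x => ?_⟩
  refine isClosed_property h₁.2 (isClosed_eq (f := fun x => R (π₁ a x))
    (g := fun x => π₂ a (R x)) (by fun_prop) (by fun_prop)) (fun b => ?_) x
  rw [← mul_apply_eq_comp, ← map_mul, hR, hR, map_mul, mul_apply_eq_comp]

theorem conjStarAlgEquiv_mem_familyVN (U : K₁ ≃ₗᵢ[ℂ] K₂)
    (hU : ∀ k, U.conjStarAlgEquiv (v₁ k) = v₂ k) {x : K₁ →L[ℂ] K₁} (hx : x ∈ familyVN v₁) :
    U.conjStarAlgEquiv x ∈ familyVN v₂ := by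
  rw [VonNeumannAlgebra.mem_iff_forall_commutant] at hx ⊢
  intro y hy
  obtain ⟨y, rfl⟩ : ∃ z, U.conjStarAlgEquiv z = y :=
    ⟨U.conjStarAlgEquiv.symm y, U.conjStarAlgEquiv.apply_symm_apply y⟩
  rw [← map_mul, ← map_mul, hx y]
  rw [mem_commutant_familyVN] at hy ⊢
  intro k
  obtain ⟨h1, h2⟩ := hy k
  rw [← hU, ← map_star, ← map_mul, ← map_mul] at h2
  rw [← hU, ← map_mul, ← map_mul] at h1
  exact ⟨U.conjStarAlgEquiv.injective h1, U.conjStarAlgEquiv.injective h2⟩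

theorem image_conjStarAlgEquiv_familyVN (U : K₁ ≃ₗᵢ[ℂ] K₂)
    (hU : ∀ k, U.conjStarAlgEquiv (v₁ k) = v₂ k) :
    U.conjStarAlgEquiv '' (familyVN v₁ : Set (K₁ →L[ℂ] K₁)) =
      (familyVN v₂ : Set (K₂ →L[ℂ] K₂)) := by
  ext y
  constructor
  · rintro ⟨x, hx, rfl⟩
    exact conjStarAlgEquiv_mem_familyVN U hU hx
  · intro hy
    have hU' : ∀ k, U.symm.conjStarAlgEquiv (v₂ k) = v₁ k := fun k => by
      rw [← hU, ← LinearIsometryEquiv.symm_conjStarAlgEquiv]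
      exact U.conjStarAlgEquiv.symm_apply_apply _
    refine ⟨_, conjStarAlgEquiv_mem_familyVN U.symm hU' hy, ?_⟩
    rw [← LinearIsometryEquiv.symm_conjStarAlgEquiv]
    exact U.conjStarAlgEquiv.apply_symm_apply _

/-- A unitary equivalence of GNS representations maps the small space of one support system into
that of any other, since both are supports of the same state. -/
theorem IsSupportSystem.apply_mem_range (R : H₁ ≃ₗᵢ[ℂ] H₂) (hRΩ : R Ω₁ = Ω₂)
    (hR : ∀ a x, R (π₁ a x) = π₂ a (R x)) (h₁ : IsSupportSystem ψ π₁ Ω₁ V₁ v₁ ω₁)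
    (h₂ : IsSupportSystem ψ π₂ Ω₂ V₂ v₂ ω₂) (f : K₁) : R (V₁ f) ∈ Set.range V₂ := by
  have hgen : ∀ k, R.symm.conjStarAlgEquiv (π₂ (cuntzGen d k)) = π₁ (cuntzGen d k) := by
    intro k
    ext x
    rw [LinearIsometryEquiv.conjStarAlgEquiv_apply_apply]
    simp [← hR]
  obtain ⟨-, hPs, -, hmin⟩ := isSupportProjection_iff.1 h₁.isSupportProjection
  set q := R.symm.conjStarAlgEquiv (rangeProj V₂) with hq
  have hqs : IsStarProjection q := (isStarProjection_rangeProj V₂).map _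
  have hqM : q ∈ repVN π₁ := by
    have := h₂.proj_mem
    rw [repVN_eq_familyVN] at this ⊢
    exact conjStarAlgEquiv_mem_familyVN R.symm hgen this
  have hqΩ : q Ω₁ = Ω₁ := by
    rw [hq, LinearIsometryEquiv.conjStarAlgEquiv_apply_apply, LinearIsometryEquiv.symm_symm, hRΩ,
      ← h₂.embed, rangeProj_apply_self, h₂.embed, ← hRΩ, LinearIsometryEquiv.symm_apply_apply]
  have hle := hmin q hqM hqs hqΩ
  rw [hPs.le_iff_mul_eq_right hqs] at hle
  have h3 := congrArg (fun Z : H₁ →L[ℂ] H₁ => Z (V₁ f)) hle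
  simp only [mul_apply_eq_comp, rangeProj_apply_self] at h3
  rw [hq, LinearIsometryEquiv.conjStarAlgEquiv_apply_apply] at h3
  rw [mem_range_iff_rangeProj]
  have h4 := congrArg R h3
  simpa using h4

/-- The unitary equivalence of the GNS representations restricts to the small spaces. -/
theorem IsSupportSystem.exists_equiv (hG₁ : IsGNS ψ π₁ Ω₁) (h₁ : IsSupportSystem ψ π₁ Ω₁ V₁ v₁ ω₁)
    (hG₂ : IsGNS ψ π₂ Ω₂) (h₂ : IsSupportSystem ψ π₂ Ω₂ V₂ v₂ ω₂) :
    ∃ U : K₁ ≃ₗᵢ[ℂ] K₂, U ω₁ = ω₂ ∧ ∀ k, U.conjStarAlgEquiv (v₁ k) = v₂ k := by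
  obtain ⟨R, hRΩ, hR⟩ := exists_gns_equiv hG₁ hG₂
  have hRs : ∀ a x, R.symm (π₂ a x) = π₁ a (R.symm x) := fun a x => by
    rw [LinearIsometryEquiv.symm_apply_eq, hR, LinearIsometryEquiv.apply_symm_apply]
  have hrange : Set.range (R.toLinearIsometry.comp V₁) = Set.range V₂ := by
    refine Set.Subset.antisymm ?_ ?_
    · rintro _ ⟨f, rfl⟩
      exact h₁.apply_mem_range R hRΩ hR h₂ f
    · rintro _ ⟨g, rfl⟩
      obtain ⟨f, hf⟩ := h₂.apply_mem_range R.symm (by rw [← hRΩ, R.symm_apply_apply]) hRs h₁ g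
      exact ⟨f, by simp [hf]⟩
  obtain ⟨U, hU⟩ := exists_linearIsometryEquiv_of_range_eq _ _ hrange
  have hU' : ∀ f, V₂ (U f) = R (V₁ f) := hU
  refine ⟨U, V₂.injective (by rw [hU', h₁.embed, h₂.embed, hRΩ]), fun k => ?_⟩
  have hstar : U.conjStarAlgEquiv (star (v₁ k)) = star (v₂ k) := by
    ext g
    refine V₂.injective ?_
    rw [LinearIsometryEquiv.conjStarAlgEquiv_apply_apply, hU', ← h₁.intertwine.intertwine,
      ← h₂.intertwine.intertwine, ← map_star, hR, ← hU', LinearIsometryEquiv.apply_symm_apply, map_star]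
  rw [← star_star (v₁ k), map_star, hstar, star_star]

end Uniqueness

/-! ### Separable Hilbert spaces and unitary extensions -/

section Separable

variable {E : Type*} [NormedAddCommGroup E] [InnerProductSpace ℂ E]
  {F : Type*} [NormedAddCommGroup F] [InnerProductSpace ℂ F]
  {K : Type*} [NormedAddCommGroup K] [InnerProductSpace ℂ K]

theorem Orthonormal.countable_of_separable [TopologicalSpace.SeparableSpace E] {ι : Type*}
    {e : ι → E} (he : Orthonormal ℂ e) : Countable ι := by
  have hdist : ∀ i j, i ≠ j → (1 : ℝ) < dist (e i) (e j) := by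
    intro i j hij
    have h1 : ‖e i - e j‖ ^ 2 = 2 := by
      rw [@norm_sub_sq ℂ, he.2 hij, he.1, he.1]
      norm_num
    rw [dist_eq_norm]
    nlinarith [norm_nonneg (e i - e j)]
  have hc := Set.PairwiseDisjoint.countable_of_isOpen (s := fun i => Metric.ball (e i) (1 / 2))
    (a := (Set.univ : Set ι)) (fun i _ j _ hij => Metric.ball_disjoint_ball (by
      have := hdist i j hij
      linarith)) (fun i _ => Metric.isOpen_ball) (fun i _ => ⟨e i, by simp⟩)
  exact Set.countable_univ_iff.1 hc

theorem inner_eq_of_orthonormal {ι : Type*} {e : ι → E} {g : ι → F} (he : Orthonormal ℂ e)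
    (hg : Orthonormal ℂ g) (i j : ι) : ⟪e i, e j⟫_ℂ = ⟪g i, g j⟫_ℂ := by
  classical
  rw [orthonormal_iff_ite.1 he, orthonormal_iff_ite.1 hg]

/-- The standard Hilbert basis of `ℓ²(ℕ)`. -/
noncomputable def SeqHilbert.basis : HilbertBasis ℕ ℂ SeqHilbert :=
  ⟨LinearIsometryEquiv.refl ℂ SeqHilbert⟩

theorem dense_span_range_hilbertBasis {ι : Type*} (b : HilbertBasis ι ℂ E) :
    Dense (Submodule.span ℂ (Set.range b) : Set E) :=
  (Submodule.dense_iff_topologicalClosure_eq_top).2 b.dense_span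

instance : TopologicalSpace.SeparableSpace SeqHilbert := by
  have h1 : TopologicalSpace.IsSeparable
      (Submodule.span ℂ (Set.range SeqHilbert.basis) : Set SeqHilbert) :=
    (Set.countable_range _).isSeparable.span
  have h2 := h1.closure
  rw [(dense_span_range_hilbertBasis SeqHilbert.basis).closure_eq] at h2
  exact TopologicalSpace.isSeparable_univ_iff.1 h2

theorem SeqHilbert.not_finiteDimensional : ¬ FiniteDimensional ℂ SeqHilbert := by
  intro h
  have := SeqHilbert.basis.orthonormal.linearIndependent.finite
  exact not_finite ℕ

variable [CompleteSpace E] [CompleteSpace F]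

/-- A separable Hilbert space of infinite dimension is isomorphic to `ℓ²(ℕ)`. -/
theorem exists_equiv_seqHilbert [TopologicalSpace.SeparableSpace E]
    (hE : ¬ FiniteDimensional ℂ E) : Nonempty (E ≃ₗᵢ[ℂ] SeqHilbert) := by
  obtain ⟨w, b, -⟩ := exists_hilbertBasis ℂ E
  have hc : Countable w := b.orthonormal.countable_of_separable
  have hinf : Infinite w := by
    by_contra hfin
    rw [not_infinite_iff_finite] at hfin
    refine hE ?_
    have hfd : FiniteDimensional ℂ (Submodule.span ℂ (Set.range b)) :=
      FiniteDimensional.span_of_finite ℂ (Set.finite_range b)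
    have h1 := b.dense_span
    rw [(Submodule.closed_of_finiteDimensional _).submodule_topologicalClosure_eq] at h1
    rw [h1] at hfd
    exact Module.Finite.equiv (Submodule.topEquiv (R := ℂ) (M := E))
  obtain ⟨e⟩ := nonempty_equiv_of_countable (α := w) (β := ℕ)
  have ho : Orthonormal ℂ (fun i : w => SeqHilbert.basis (e i)) :=
    SeqHilbert.basis.orthonormal.comp e e.injective
  obtain ⟨U, -⟩ := exists_linearIsometryEquiv_of_gram b (fun i => SeqHilbert.basis (e i))
    (inner_eq_of_orthonormal b.orthonormal ho) (dense_span_range_hilbertBasis b) (by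
      have : Set.range (fun i : w => SeqHilbert.basis (e i)) = Set.range SeqHilbert.basis :=
        e.surjective.range_comp SeqHilbert.basis
      rw [this]
      exact dense_span_range_hilbertBasis _)
  exact ⟨U⟩

/-- A separable Hilbert space embeds in `ℓ²(ℕ)` leaving room for another copy of `ℓ²(ℕ)`: use the
even and the odd members of a basis. -/
theorem exists_isometry_seqHilbert [CompleteSpace K] [TopologicalSpace.SeparableSpace K] :
    ∃ (V : K →ₗᵢ[ℂ] SeqHilbert) (W : SeqHilbert →ₗᵢ[ℂ] SeqHilbert), ∀ f y, ⟪V f, W y⟫_ℂ = 0 := by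
  obtain ⟨w, b, -⟩ := exists_hilbertBasis ℂ K
  have hc : Countable w := b.orthonormal.countable_of_separable
  obtain ⟨enc, henc⟩ := exists_injective_nat w
  have ho : Orthonormal ℂ (fun i : w => SeqHilbert.basis (2 * enc i)) :=
    SeqHilbert.basis.orthonormal.comp _ fun i j h => henc (by simpa using h)
  have ho' : Orthonormal ℂ (fun n : ℕ => SeqHilbert.basis (2 * n + 1)) :=
    SeqHilbert.basis.orthonormal.comp _ fun i j h => by simpa using h
  obtain ⟨V, hV⟩ := exists_linearIsometry_of_gram b _
    (inner_eq_of_orthonormal b.orthonormal ho) (dense_span_range_hilbertBasis b)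
  obtain ⟨W, hW⟩ := exists_linearIsometry_of_gram SeqHilbert.basis _
    (inner_eq_of_orthonormal SeqHilbert.basis.orthonormal ho')
    (dense_span_range_hilbertBasis SeqHilbert.basis)
  have h1 : ∀ i y, ⟪V (b i), W y⟫_ℂ = 0 := by
    intro i y
    have hle : Submodule.span ℂ (Set.range SeqHilbert.basis) ≤
        LinearMap.ker ((innerSL ℂ (V (b i))).toLinearMap ∘ₗ W.toLinearMap) := by
      rw [Submodule.span_le]
      rintro _ ⟨n, rfl⟩
      show ⟪V (b i), W (SeqHilbert.basis n)⟫_ℂ = 0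
      rw [hV, hW]
      exact SeqHilbert.basis.orthonormal.2 (by omega)
    refine closure_minimal (s := (Submodule.span ℂ (Set.range SeqHilbert.basis) : Set SeqHilbert))
      (t := {y | ⟪V (b i), W y⟫_ℂ = 0}) (fun y hy => hle hy)
      (isClosed_eq (by fun_prop) (by fun_prop)) ?_
    exact dense_span_range_hilbertBasis SeqHilbert.basis y
  refine ⟨V, W, fun f y => ?_⟩
  have hle : Submodule.span ℂ (Set.range b) ≤
      LinearMap.ker ((innerSL ℂ (W y)).toLinearMap ∘ₗ V.toLinearMap) := by
    rw [Submodule.span_le]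
    rintro _ ⟨i, rfl⟩
    show ⟪W y, V (b i)⟫_ℂ = 0
    rw [← inner_conj_symm, h1, map_zero]
  have h2 : ⟪W y, V f⟫_ℂ = 0 :=
    closure_minimal (s := (Submodule.span ℂ (Set.range b) : Set K))
      (t := {f | ⟪W y, V f⟫_ℂ = 0}) (fun f hf => hle hf)
      (isClosed_eq (by fun_prop) (by fun_prop)) (dense_span_range_hilbertBasis b f)
  rw [← inner_conj_symm, h2, map_zero]

theorem nonempty_orthogonal_range_equiv [TopologicalSpace.SeparableSpace E] (i : K →ₗᵢ[ℂ] E)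
    (W : SeqHilbert →ₗᵢ[ℂ] E) (h : ∀ f y, ⟪i f, W y⟫_ℂ = 0) :
    Nonempty ((LinearMap.range i.toLinearMap)ᗮ ≃ₗᵢ[ℂ] SeqHilbert) := by
  refine exists_equiv_seqHilbert fun hfd => SeqHilbert.not_finiteDimensional ?_
  have hW : ∀ y, W y ∈ (LinearMap.range i.toLinearMap)ᗮ := by
    intro y
    rw [Submodule.mem_orthogonal]
    rintro _ ⟨f, rfl⟩
    exact h f y
  refine FiniteDimensional.of_injective
    (W.toLinearMap.codRestrict (LinearMap.range i.toLinearMap)ᗮ hW) fun x y hxy => ?_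
  exact W.injective (congrArg Subtype.val hxy)

variable [CompleteSpace K]

theorem dense_span_range_sumElim (i : K →ₗᵢ[ℂ] E) {ι : Type*}
    (θ : ι → (LinearMap.range i.toLinearMap)ᗮ) (hθ : Function.Surjective θ) :
    Dense (Submodule.span ℂ (Set.range (Sum.elim i fun z => (θ z : E))) : Set E) := by
  have : CompleteSpace (LinearMap.range i.toLinearMap) :=
    (i.isometry.isClosedEmbedding.isClosed_range).completeSpace_coe
  have htop : Submodule.span ℂ (Set.range (Sum.elim i fun z => (θ z : E))) = ⊤ := by
    rw [eq_top_iff, ← Submodule.sup_orthogonal_of_hasOrthogonalProjection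
      (K := LinearMap.range i.toLinearMap), sup_le_iff]
    constructor
    · rintro _ ⟨f, rfl⟩
      exact Submodule.subset_span ⟨Sum.inl f, rfl⟩
    · intro y hy
      obtain ⟨z, hz⟩ := hθ ⟨y, hy⟩
      exact Submodule.subset_span ⟨Sum.inr z, by simp [hz]⟩
  rw [htop]
  exact dense_univ

/-- Two isometric embeddings of a Hilbert space into separable Hilbert spaces, with orthogonal
complements of infinite dimension, are related by a unitary. -/
theorem exists_unitary_extension [TopologicalSpace.SeparableSpace E]
    [TopologicalSpace.SeparableSpace F] (i₁ : K →ₗᵢ[ℂ] E) (i₂ : K →ₗᵢ[ℂ] F)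
    (W₁ : SeqHilbert →ₗᵢ[ℂ] E) (W₂ : SeqHilbert →ₗᵢ[ℂ] F)
    (h₁ : ∀ f y, ⟪i₁ f, W₁ y⟫_ℂ = 0) (h₂ : ∀ f y, ⟪i₂ f, W₂ y⟫_ℂ = 0) :
    ∃ U : E ≃ₗᵢ[ℂ] F, ∀ f, U (i₁ f) = i₂ f := by
  obtain ⟨θ₁⟩ := nonempty_orthogonal_range_equiv i₁ W₁ h₁
  obtain ⟨θ₂⟩ := nonempty_orthogonal_range_equiv i₂ W₂ h₂
  obtain ⟨U, hU⟩ := exists_linearIsometryEquiv_of_gram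
    (Sum.elim i₁ fun y => (θ₁.symm y : E)) (Sum.elim i₂ fun y => (θ₂.symm y : F)) (by
      rintro (f | y) (g | z)
      · simp
      · exact ((Submodule.mem_orthogonal _ _).1 (θ₁.symm z).2 _ ⟨f, rfl⟩).trans
          ((Submodule.mem_orthogonal _ _).1 (θ₂.symm z).2 _ ⟨f, rfl⟩).symm
      · exact ((Submodule.mem_orthogonal' _ _).1 (θ₁.symm y).2 _ ⟨g, rfl⟩).trans
          ((Submodule.mem_orthogonal' _ _).1 (θ₂.symm y).2 _ ⟨g, rfl⟩).symm
      · exact (θ₁.symm.inner_map_map y z).trans (θ₂.symm.inner_map_map y z).symm)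
    (dense_span_range_sumElim i₁ _ θ₁.symm.surjective)
    (dense_span_range_sumElim i₂ _ θ₂.symm.surjective)
  exact ⟨U, fun f => hU (Sum.inl f)⟩

end Separable

/-! ### Cuntz dilations on the standard Hilbert space -/

section SeqDilation

variable {K : Type*} [NormedAddCommGroup K] [InnerProductSpace ℂ K] [CompleteSpace K]
  {d : ℕ}

/-- A unitary `U : H → H^d` gives a Cuntz family whose adjoints are the components of `U`. -/
theorem exists_isCuntzFamily_of_equiv {H : Type*} [NormedAddCommGroup H] [InnerProductSpace ℂ H]
    [CompleteSpace H] (U : H ≃ₗᵢ[ℂ] PiLp 2 fun _ : Fin d => H) :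
    ∃ S : Fin d → (H →L[ℂ] H), IsCuntzFamily S ∧ ∀ k x, star (S k) x = U x k := by
  let T : Fin d → (H →L[ℂ] H) := fun k =>
    (PiLp.proj 2 (fun _ : Fin d => H) k : (PiLp 2 fun _ : Fin d => H) →L[ℂ] H) ∘L
      (U : H →L[ℂ] PiLp 2 fun _ : Fin d => H)
  have hT : ∀ k x, T k x = U x k := fun k x => rfl
  have hTs : ∀ k x, star (T k) x = U.symm (WithLp.toLp 2 (Pi.single k x)) := by
    intro k x
    refine ext_inner_left ℂ fun y => ?_
    rw [inner_star_right, hT, ← U.inner_map_map y, LinearIsometryEquiv.apply_symm_apply,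
      PiLp.inner_apply]
    rw [Finset.sum_eq_single k]
    · simp
    · intro j _ hj; simp [hj]
    · simp
  refine ⟨fun k => star (T k), ⟨fun i j => ?_, ?_⟩, fun k x => by rw [star_star, hT]⟩
  · ext x
    rw [star_star, mul_apply_eq_comp, hTs, hT, LinearIsometryEquiv.apply_symm_apply]
    by_cases hij : i = j
    · subst hij; simp
    · simp [hij]
  · ext x
    rw [sum_apply]
    simp only [star_star, mul_apply_eq_comp, hTs, hT]
    rw [← map_sum, LinearIsometryEquiv.symm_apply_eq]
    ext j
    simp [Finset.sum_apply, Pi.single_apply]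

/-- A coisometric family on a separable Hilbert space dilates to a Cuntz family on `ℓ²(ℕ)`: the
isometry `f ↦ (v_k^* f)_k` extends to a unitary of `ℓ²(ℕ)` onto its `d`-fold sum. -/
theorem exists_isCuntzDilation_seqHilbert [TopologicalSpace.SeparableSpace K] (k₀ : Fin d)
    {v : Fin d → (K →L[ℂ] K)} (hv : ∑ k, v k * star (v k) = 1) :
    ∃ (V : K →ₗᵢ[ℂ] SeqHilbert) (S : Fin d → (SeqHilbert →L[ℂ] SeqHilbert)),
      IsCuntzDilation v V S := by
  obtain ⟨V, W, hVW⟩ := exists_isometry_seqHilbert (K := K)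
  let J : K →ₗᵢ[ℂ] PiLp 2 fun _ : Fin d => SeqHilbert :=
    { toFun := fun f => WithLp.toLp 2 fun k => V (star (v k) f)
      map_add' := fun f g => by ext k : 1; simp
      map_smul' := fun c f => by ext k : 1; simp
      norm_map' := fun f => by
        rw [← sq_eq_sq₀ (norm_nonneg _) (norm_nonneg _), ← sum_norm_star_sq hv f]
        simp [PiLp.norm_sq_eq_of_L2] }
  let W' : SeqHilbert →ₗᵢ[ℂ] PiLp 2 fun _ : Fin d => SeqHilbert :=
    { toFun := fun y => WithLp.toLp 2 (Pi.single k₀ (W y))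
      map_add' := fun f g => by ext k : 1; by_cases hk : k = k₀ <;> simp [hk]
      map_smul' := fun c f => by ext k : 1; by_cases hk : k = k₀ <;> simp [hk]
      norm_map' := fun f => by
        simp }
  have hort : ∀ f y, ⟪J f, W' y⟫_ℂ = 0 := by
    intro f y
    show ⟪WithLp.toLp 2 fun k => V (star (v k) f), WithLp.toLp 2 (Pi.single k₀ (W y))⟫_ℂ = 0
    rw [PiLp.inner_apply]
    refine Finset.sum_eq_zero fun k _ => ?_
    by_cases hk : k = k₀
    · subst hk; simp [hVW]
    · simp [hk]
  obtain ⟨U, hU⟩ := exists_unitary_extension V J W W' hVW hort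
  obtain ⟨S, hS, hSU⟩ := exists_isCuntzFamily_of_equiv U
  exact ⟨V, S, hS, fun k f => by rw [hSU, hU]; rfl⟩

end SeqDilation

/-! ### The GNS representation of a normal faithful state -/

section NormalGNS

variable {K : Type*} [NormedAddCommGroup K] [InnerProductSpace ℂ K] [CompleteSpace K]
  {L : Type*} [NormedAddCommGroup L] [InnerProductSpace ℂ L] [CompleteSpace L]
  {M : VonNeumannAlgebra K} {φ : M.Elem →ₗ[ℂ] ℂ} {ρ : M.Elem →⋆ₐ[ℂ] (L →L[ℂ] L)} {ξ : L}

/-- `W` intertwines the representation `ρ` of `M` with its identity representation. -/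
def IsIntertwiner (ρ : M.Elem →⋆ₐ[ℂ] (L →L[ℂ] L)) (W : L →L[ℂ] K) : Prop :=
  ∀ (x : M.Elem) l, W (ρ x l) = (x : K →L[ℂ] K) (W l)

theorem IsIntertwiner.adjoint_apply {W : L →L[ℂ] K} (hW : IsIntertwiner ρ W) (x : M.Elem) (f : K) :
    W.adjoint ((x : K →L[ℂ] K) f) = ρ x (W.adjoint f) := by
  refine ext_inner_left ℂ fun l => ?_
  rw [ContinuousLinearMap.adjoint_inner_right, ← inner_star_left, ← inner_star_left, ← map_star,
    ContinuousLinearMap.adjoint_inner_right, hW]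
  rfl

/-- The GNS representation of a normal state embeds in a multiple of the identity
representation: there are jointly injective intertwiners. -/
theorem exists_intertwiners (hG : IsGNS φ ρ ξ) (hN : IsNormalFunctional M φ) :
    ∃ W : ℕ → (L →L[ℂ] K), (∀ n, IsIntertwiner ρ (W n)) ∧
      (∀ l, (∀ n, W n l = 0) → l = 0) ∧
      ∀ x : M.Elem, (∀ n, (x : K →L[ℂ] K) (W n ξ) = 0) → φ (star x * x) = 0 := by
  obtain ⟨η, hη, hφ⟩ := hN
  let g : M.Elem → lp (fun _ : ℕ => K) 2 := fun x =>
    ⟨fun n => (x : K →L[ℂ] K) (η n), by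
      refine memℓp_gen ?_
      have h1 : Summable fun n => ‖(x : K →L[ℂ] K)‖ ^ 2 * ‖η n‖ ^ 2 := hη.mul_left _
      refine Summable.of_nonneg_of_le (fun n => by positivity) (fun n => ?_) h1
      simp only [ENNReal.toReal_ofNat, Real.rpow_ofNat]
      rw [← mul_pow]
      gcongr
      exact (x : K →L[ℂ] K).le_opNorm _⟩
  have hg : ∀ x n, g x n = (x : K →L[ℂ] K) (η n) := fun x n => rfl
  have hgram : ∀ x y, ⟪ρ x ξ, ρ y ξ⟫_ℂ = ⟪g x, g y⟫_ℂ := by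
    intro x y
    rw [inner_rep_apply hG.1]
    refine (hφ (star x * y)).unique ?_
    have h1 := lp.hasSum_inner (g x) (g y) (𝕜 := ℂ)
    have h2 : (fun n => ⟪g x n, g y n⟫_ℂ) =
        fun n => ⟪η n, ((star x * y : M.Elem) : K →L[ℂ] K) (η n)⟫_ℂ := by
      funext n
      rw [hg, hg, ← inner_star_right]
      rfl
    rwa [h2] at h1
  obtain ⟨V, hV⟩ := exists_linearIsometry_of_gram (fun x => ρ x ξ) g hgram
    (dense_span_of_denseRange hG.2)
  let W : ℕ → (L →L[ℂ] K) := fun n =>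
    lp.evalCLM ℂ (fun _ : ℕ => K) 2 n ∘L V.toContinuousLinearMap
  have hW : ∀ n l, W n l = V l n := fun n l => rfl
  have hWξ : ∀ n, W n ξ = η n := fun n => by
    have := hV 1
    rw [map_one, one_apply_eq_self] at this
    rw [hW, this, hg]; rfl
  refine ⟨W, fun n x l => ?_, fun l hl => ?_, fun x hx => ?_⟩
  · refine isClosed_property hG.2 (isClosed_eq (f := fun l => W n (ρ x l))
      (g := fun l => (x : K →L[ℂ] K) (W n l)) (by fun_prop) (by fun_prop)) (fun y => ?_) l
    rw [← mul_apply_eq_comp, ← map_mul, hW, hW, hV, hV, hg, hg]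
    rfl
  · refine V.injective ?_
    rw [map_zero]
    ext n
    exact hl n
  · simp only [hWξ] at hx
    rw [← inner_rep_apply hG.1, hgram]
    have : g x = 0 := by ext n; exact hx n
    rw [this, inner_zero_left]

theorem IsFaithful.eq_zero_of_gns (hf : IsFaithful φ) (hG : IsGNS φ ρ ξ) {x : M.Elem}
    (hx : ρ x ξ = 0) : x = 0 :=
  hf x (by rw [← inner_rep_apply hG.1, hx, inner_zero_left])

theorem VonNeumannAlgebra.isClosed (M : VonNeumannAlgebra K) :
    IsClosed (M.toStarSubalgebra : Set (K →L[ℂ] K)) := by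
  rw [VonNeumannAlgebra.coe_toStarSubalgebra, ← M.centralizer_centralizer]
  exact Set.isClosed_centralizer _

/-- The GNS representation of a faithful normal state has a von Neumann algebra as its image. For a
unitary `y` of the bicommutant, `A l ↦ A (y l)`, with `A` running over all intertwiners, is a
unitary of `M` mapped to `y`. -/
theorem range_eq_repVN (hG : IsGNS φ ρ ξ) (hN : IsNormalFunctional M φ) (hf : IsFaithful φ) :
    Set.range ρ = (repVN ρ : Set (L →L[ℂ] L)) := by
  refine Set.Subset.antisymm (by rintro _ ⟨x, rfl⟩; exact rep_mem_repVN ρ x) ?_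
  obtain ⟨W, hW, hinj, hker⟩ := exists_intertwiners hG hN
  have hunit : ∀ y ∈ repVN ρ, star y * y = 1 → y ∈ Set.range ρ := by
    intro y hy hyu
    let ι := {A : L →L[ℂ] K // IsIntertwiner ρ A} × L
    let e : ι → K := fun i => i.1.1 i.2
    let g : ι → K := fun i => i.1.1 (y i.2)
    have hcomm : ∀ A B : {A : L →L[ℂ] K // IsIntertwiner ρ A},
        A.1.adjoint ∘L B.1 ∈ (repVN ρ).commutant := by
      intro A B
      rw [mem_commutant_repVN]
      intro x
      ext l
      show ρ x (A.1.adjoint (B.1 l)) = A.1.adjoint (B.1 (ρ x l))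
      rw [B.2, A.2.adjoint_apply]
    have hgram : ∀ i j, ⟪e i, e j⟫_ℂ = ⟪g i, g j⟫_ℂ := by
      rintro ⟨A, l⟩ ⟨B, m⟩
      have h1 : y (A.1.adjoint (B.1 m)) = A.1.adjoint (B.1 (y m)) :=
        congrArg (fun Z : L →L[ℂ] L => Z m)
          (VonNeumannAlgebra.mem_commutant_iff.1 (hcomm A B) y hy)
      show ⟪A.1 l, B.1 m⟫_ℂ = ⟪A.1 (y l), B.1 (y m)⟫_ℂ
      rw [← ContinuousLinearMap.adjoint_inner_right, ← ContinuousLinearMap.adjoint_inner_right,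
        ← h1, ← inner_star_right, ← mul_apply_eq_comp, hyu, one_apply_eq_self]
    have htot : Dense (Submodule.span ℂ (Set.range e) : Set K) := by
      let E := (Submodule.span ℂ (Set.range e)).topologicalClosure
      have hEc : IsClosed (E : Set K) := Submodule.isClosed_topologicalClosure _
      have : CompleteSpace E := hEc.completeSpace_coe
      have hE : E.starProjection ∈ M := by
        refine starProjection_mem_of_invariant E fun D hD x hx => ?_
        have hm : Set.MapsTo D (Submodule.span ℂ (Set.range e) : Set K)
            (Submodule.span ℂ (Set.range e) : Set K) := by
          have hle : Submodule.span ℂ (Set.range e) ≤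
              (Submodule.span ℂ (Set.range e)).comap D.toLinearMap := by
            rw [Submodule.span_le]
            rintro _ ⟨⟨A, l⟩, rfl⟩
            refine Submodule.subset_span ⟨⟨⟨D ∘L A.1, fun x m => ?_⟩, l⟩, rfl⟩
            show D (A.1 (ρ x m)) = (x : K →L[ℂ] K) (D (A.1 m))
            rw [A.2]
            exact (congrArg (fun Z : K →L[ℂ] K => Z (A.1 m))
              (VonNeumannAlgebra.mem_commutant_iff.1 hD x x.2)).symm
          exact fun z hz => hle hz
        exact hm.closure D.continuous hx
      have hmem : ∀ n, W n ξ ∈ E := fun n =>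
        Submodule.le_topologicalClosure _ (Submodule.subset_span ⟨⟨⟨W n, hW n⟩, ξ⟩, rfl⟩)
      let q : M.Elem := ⟨1 - E.starProjection, sub_mem (one_mem _) hE⟩
      have hq : q = 0 := hf q (hker q fun n => by
        show (1 - E.starProjection) (W n ξ) = 0
        rw [sub_apply, Submodule.starProjection_eq_self_iff.2 (hmem n), one_apply_eq_self,
          sub_self])
      intro x
      have h1 : (1 - E.starProjection) x = 0 :=
        congrArg (fun z : M.Elem => (z : K →L[ℂ] K) x) hq
      rw [sub_apply, one_apply_eq_self, sub_eq_zero] at h1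
      exact Submodule.starProjection_eq_self_iff.1 h1.symm
    obtain ⟨V, hV⟩ := exists_linearIsometry_of_gram e g hgram htot
    have hVA : ∀ A : L →L[ℂ] K, IsIntertwiner ρ A → ∀ l, V (A l) = A (y l) :=
      fun A hA l => hV ⟨⟨A, hA⟩, l⟩
    have hVM : V.toContinuousLinearMap ∈ M := by
      rw [VonNeumannAlgebra.mem_iff_forall_commutant]
      intro D hD
      refine ContinuousLinearMap.ext_on htot ?_
      rintro _ ⟨⟨A, l⟩, rfl⟩
      have hDA : IsIntertwiner ρ (D ∘L A.1) := fun x m => by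
        show D (A.1 (ρ x m)) = (x : K →L[ℂ] K) (D (A.1 m))
        rw [A.2]
        exact (congrArg (fun Z : K →L[ℂ] K => Z (A.1 m))
          (VonNeumannAlgebra.mem_commutant_iff.1 hD x x.2)).symm
      show D (V (A.1 l)) = V (D (A.1 l))
      rw [hVA A.1 A.2]
      exact (hVA _ hDA l).symm
    refine ⟨⟨V.toContinuousLinearMap, hVM⟩, ?_⟩
    ext l
    rw [← sub_eq_zero]
    refine hinj _ fun n => ?_
    rw [map_sub, hW n, sub_eq_zero]
    exact hVA _ (hW n) l
  intro y hy
  let N := (repVN ρ).toStarSubalgebra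
  let _ : CStarAlgebra N := StarSubalgebra.cstarAlgebra N
    (h_closed := (repVN ρ).isClosed)
  have hspan : (⟨y, hy⟩ : N) ∈ Submodule.span ℂ (unitary N : Set N) := by
    rw [CStarAlgebra.span_unitary]; trivial
  have hle : Submodule.span ℂ (unitary N : Set N) ≤
      (LinearMap.range ρ.toAlgHom.toLinearMap).comap N.subtype.toAlgHom.toLinearMap := by
    rw [Submodule.span_le]
    intro u hu
    exact hunit u u.2 (congrArg Subtype.val (Unitary.star_mul_self_of_mem hu))
  exact hle hspan

variable {d : ℕ}

/-- Two-sided invariance of a closed subspace under an operator and its adjoint. -/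
theorem commute_starProjection (E : Submodule ℂ L) [E.HasOrthogonalProjection] {a : L →L[ℂ] L}
    (h1 : ∀ x ∈ E, a x ∈ E) (h2 : ∀ x ∈ E, star a x ∈ E) : a * E.starProjection = E.starProjection * a := by
  have hsa : star E.starProjection = E.starProjection :=
    (isStarProjection_starProjection (U := E)).isSelfAdjoint.star_eq
  have key : ∀ b : L →L[ℂ] L, (∀ x ∈ E, b x ∈ E) →
      E.starProjection * (b * E.starProjection) = b * E.starProjection := by
    intro b hb
    ext x
    exact Submodule.starProjection_eq_self_iff.2 (hb _ (Submodule.starProjection_apply_mem E x))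
  have h3 := congrArg star (key _ h2)
  simp only [star_mul, star_star, hsa] at h3
  rw [← key a h1, ← mul_assoc, h3]

variable {v : Fin d → (K →L[ℂ] K)} {φ : (familyVN v).Elem →ₗ[ℂ] ℂ}
  {ρ : (familyVN v).Elem →⋆ₐ[ℂ] (L →L[ℂ] L)}

theorem sum_famElem (hv : ∑ k, v k * star (v k) = 1) :
    ∑ k, famElem v k * star (famElem v k) = 1 := by
  refine Subtype.ext ?_
  refine Eq.trans ?_ hv
  exact map_sum (familyVN v).toStarSubalgebra.subtype
    (fun k => famElem v k * star (famElem v k)) Finset.univ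

theorem sum_rep_famElem (hv : ∑ k, v k * star (v k) = 1) :
    ∑ k, ρ (famElem v k) * star (ρ (famElem v k)) = 1 := by
  simp_rw [← map_star, ← map_mul, ← map_sum, sum_famElem hv, map_one]

/-- The identity `M' = B_τ` passes to the GNS representation: for intertwiners `W_n`, the
operators `W_n D W_m^*` are fixed points on the original space. -/
theorem mem_commutant_of_conjSum_eq (hG : IsGNS φ ρ ξ) (hN : IsNormalFunctional (familyVN v) φ)
    (hM : ((familyVN v).commutant : Set (K →L[ℂ] K)) = {x | conjSum v x = x})
    {D : L →L[ℂ] L} (hD : conjSum (fun k => ρ (famElem v k)) D = D) :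
    D ∈ (repVN ρ).commutant := by
  obtain ⟨W, hW, hinj, -⟩ := exists_intertwiners hG hN
  have hfix : ∀ n m, W n ∘L D ∘L (W m).adjoint ∈ (familyVN v).commutant := by
    intro n m
    rw [← SetLike.mem_coe, hM]
    show conjSum v _ = _
    ext f
    have h1 : ∀ k g, v k (W n g) = W n (ρ (famElem v k) g) := fun k g =>
      (hW n (famElem v k) g).symm
    have h2 : ∀ k g, (W m).adjoint (star (v k) g) = star (ρ (famElem v k)) ((W m).adjoint g) := by
      intro k g
      rw [← map_star]
      exact (hW m).adjoint_apply (star (famElem v k)) g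
    rw [conjSum_apply]
    simp only [ContinuousLinearMap.comp_apply, h1, h2]
    rw [← map_sum, ← conjSum_apply (fun k => ρ (famElem v k)), hD]
  rw [mem_commutant_repVN]
  intro x
  rw [← sub_eq_zero]
  set C := ρ x * D - D * ρ x with hC
  have h0 : ∀ n m f, W n (C ((W m).adjoint f)) = 0 := by
    intro n m f
    have h1 := congrArg (fun Z : K →L[ℂ] K => Z f)
      (VonNeumannAlgebra.mem_commutant_iff.1 (hfix n m) x x.2)
    have h2 : (x : K →L[ℂ] K) (W n (D ((W m).adjoint f))) =
      W n (D ((W m).adjoint ((x : K →L[ℂ] K) f))) := h1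
    rw [(hW m).adjoint_apply, ← hW n] at h2
    rw [hC, sub_apply, map_sub, mul_apply_eq_comp, mul_apply_eq_comp, h2, sub_self]
  have h1 : ∀ m f, C ((W m).adjoint f) = 0 := fun m f => hinj _ fun n => h0 n m f
  have h2 : star C = 0 := by
    ext l
    refine hinj _ fun m => ?_
    refine ext_inner_right ℂ fun f => ?_
    rw [← ContinuousLinearMap.adjoint_inner_right, inner_star_left, h1, inner_zero_right,
      inner_zero_left]
  exact star_eq_zero.1 h2

theorem commutant_gns_eq (hv : ∑ k, v k * star (v k) = 1) (hG : IsGNS φ ρ ξ)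
    (hN : IsNormalFunctional (familyVN v) φ)
    (hM : ((familyVN v).commutant : Set (K →L[ℂ] K)) = {x | conjSum v x = x}) :
    (repVN ρ).commutant = (familyVN fun k => ρ (famElem v k)).commutant ∧
      ((familyVN fun k => ρ (famElem v k)).commutant : Set (L →L[ℂ] L)) =
        {x | conjSum (fun k => ρ (famElem v k)) x = x} := by
  have h1 : ∀ D ∈ (repVN ρ).commutant, D ∈ (familyVN fun k => ρ (famElem v k)).commutant := by
    intro D hD
    rw [mem_commutant_repVN] at hD
    rw [mem_commutant_familyVN]
    intro k
    refine ⟨hD _, ?_⟩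
    rw [← map_star]
    exact hD _
  have h2 : ∀ D ∈ (familyVN fun k => ρ (famElem v k)).commutant,
      conjSum (fun k => ρ (famElem v k)) D = D := by
    intro D hD
    rw [mem_commutant_familyVN] at hD
    have h := sum_rep_famElem (ρ := ρ) hv
    exact conjSum_eq_self_of_commute (w := fun k => ρ (famElem v k)) h fun k => (hD k).1
  have h3 : ∀ D, conjSum (fun k => ρ (famElem v k)) D = D → D ∈ (repVN ρ).commutant :=
    fun _ hD => mem_commutant_of_conjSum_eq hG hN hM hD
  constructor
  · ext D
    exact ⟨h1 D, fun hD => h3 D (h2 D hD)⟩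
  · ext D
    exact ⟨h2 D, fun hD => h1 D (h3 D hD)⟩

theorem range_gns_eq (hv : ∑ k, v k * star (v k) = 1) (hG : IsGNS φ ρ ξ)
    (hN : IsNormalFunctional (familyVN v) φ) (hf : IsFaithful φ)
    (hM : ((familyVN v).commutant : Set (K →L[ℂ] K)) = {x | conjSum v x = x}) :
    Set.range ρ = (familyVN (fun k => ρ (famElem v k)) : Set (L →L[ℂ] L)) := by
  rw [range_eq_repVN hG hN hf, ← (repVN ρ).commutant_commutant,
    (commutant_gns_eq hv hG hN hM).1, VonNeumannAlgebra.commutant_commutant]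

/-- The GNS space is separable: words in the generators and their adjoints applied to the cyclic
vector span a dense subspace. -/
theorem separableSpace_gns (hv : ∑ k, v k * star (v k) = 1) (hG : IsGNS φ ρ ξ)
    (hN : IsNormalFunctional (familyVN v) φ)
    (hM : ((familyVN v).commutant : Set (K →L[ℂ] K)) = {x | conjSum v x = x}) :
    TopologicalSpace.SeparableSpace L := by
  let a : Fin d ⊕ Fin d → (L →L[ℂ] L) :=
    Sum.elim (fun k => ρ (famElem v k)) fun k => star (ρ (famElem v k))
  let X : List (Fin d ⊕ Fin d) → L := fun I => (I.map a).prod ξ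
  let E := (Submodule.span ℂ (Set.range X)).topologicalClosure
  have hEc : IsClosed (E : Set L) := Submodule.isClosed_topologicalClosure _
  have : CompleteSpace E := hEc.completeSpace_coe
  have hinv : ∀ i, ∀ x ∈ E, a i x ∈ E := by
    intro i x hx
    have hle : Submodule.span ℂ (Set.range X) ≤
        (Submodule.span ℂ (Set.range X)).comap (a i).toLinearMap := by
      rw [Submodule.span_le]
      rintro _ ⟨I, rfl⟩
      exact Submodule.subset_span ⟨i :: I, by simp [X]⟩
    have hm : Set.MapsTo (a i) (Submodule.span ℂ (Set.range X) : Set L)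
        (Submodule.span ℂ (Set.range X) : Set L) := fun z hz => hle hz
    exact hm.closure (a i).continuous hx
  have hmem : E.starProjection ∈ (repVN ρ).commutant := by
    rw [(commutant_gns_eq hv hG hN hM).1, mem_commutant_familyVN]
    intro k
    exact ⟨commute_starProjection E (hinv (Sum.inl k)) (hinv (Sum.inr k)),
      commute_starProjection E (hinv (Sum.inr k))
        (by rw [star_star]; exact hinv (Sum.inl k))⟩
  have hξ : ξ ∈ E := Submodule.le_topologicalClosure _ (Submodule.subset_span ⟨[], by simp [X]⟩)
  have htop : ∀ l, l ∈ E := by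
    have hsub : ∀ x, ρ x ξ ∈ E := fun x => by
      refine Submodule.starProjection_eq_self_iff.1 ?_
      have h1 : ρ x (E.starProjection ξ) = E.starProjection (ρ x ξ) :=
        congrArg (fun Z : L →L[ℂ] L => Z ξ) (mem_commutant_repVN.1 hmem x)
      rw [← h1, Submodule.starProjection_eq_self_iff.2 hξ]
    exact fun l => closure_minimal (by rintro _ ⟨x, rfl⟩; exact hsub x) hEc (hG.2 l)
  have h1 : TopologicalSpace.IsSeparable (Submodule.span ℂ (Set.range X) : Set L) :=
    (Set.countable_range X).isSeparable.span
  have h2 := h1.closure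
  have h3 : closure (Submodule.span ℂ (Set.range X) : Set L) = Set.univ :=
    Set.eq_univ_of_forall htop
  rw [h3] at h2
  exact TopologicalSpace.isSeparable_univ_iff.1 h2

end NormalGNS

/-! ### The state of the Cuntz algebra attached to a coisometric family -/

universe u

section GNSExistence

/-- Every state of a unital `C^*`-algebra has a GNS triple. -/
theorem exists_isGNS {A : Type u} [CStarAlgebra A] {φ : A →ₗ[ℂ] ℂ} (hφ : IsState φ) :
    ∃ (L : Type u) (_ : NormedAddCommGroup L) (_ : InnerProductSpace ℂ L) (_ : CompleteSpace L)
      (ρ : A →⋆ₐ[ℂ] (L →L[ℂ] L)) (ξ : L), IsGNS φ ρ ξ := by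
  let _ : PartialOrder A := CStarAlgebra.spectralOrder A
  have : StarOrderedRing A := CStarAlgebra.spectralOrderedRing A
  let f : A →ₚ[ℂ] ℂ := PositiveLinearMap.mk₀ φ (by
    intro a ha
    obtain ⟨b, rfl⟩ := CStarAlgebra.nonneg_iff_eq_star_mul_self.1 ha
    exact hφ.2 b)
  have hρ : ∀ a, f.gnsStarAlgHom a ((f.toPreGNS 1 : f.PreGNS) : f.GNS) =
      ((f.toPreGNS a : f.PreGNS) : f.GNS) := by
    intro a
    refine (f.gnsNonUnitalStarAlgHom_apply_coe (a := a) (b := f.toPreGNS 1)).trans ?_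
    congr 1
    exact congrArg f.toPreGNS (mul_one a)
  refine ⟨f.GNS, inferInstance, inferInstance, inferInstance, f.gnsStarAlgHom,
    ((f.toPreGNS 1 : f.PreGNS) : f.GNS), fun a => ?_, ?_⟩
  · rw [hρ, UniformSpace.Completion.inner_coe, PositiveLinearMap.preGNS_inner_def]
    simp only [PositiveLinearMap.ofPreGNS_toPreGNS, star_one, one_mul]
    rfl
  · have h1 : (fun a => f.gnsStarAlgHom a ((f.toPreGNS 1 : f.PreGNS) : f.GNS)) =
        (fun x : f.PreGNS => (x : f.GNS)) ∘ f.toPreGNS := funext hρ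
    rw [h1]
    exact UniformSpace.Completion.denseRange_coe.comp f.toPreGNS.surjective.denseRange
      (UniformSpace.Completion.continuous_coe _)

end GNSExistence

section Converse

variable {d : ℕ} {K : Type u} [NormedAddCommGroup K] [InnerProductSpace ℂ K] [CompleteSpace K]
  {v : Fin d → (K →L[ℂ] K)} {φ : (familyVN v).Elem →ₗ[ℂ] ℂ}
  {L : Type*} [NormedAddCommGroup L] [InnerProductSpace ℂ L] [CompleteSpace L]
  {ρ : (familyVN v).Elem →⋆ₐ[ℂ] (L →L[ℂ] L)} {ξ : L} {ψ : CuntzAlgebra d →ₗ[ℂ] ℂ}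

theorem exists_isGNS_elem (hφ : IsState φ) :
    ∃ (L : Type u) (_ : NormedAddCommGroup L) (_ : InnerProductSpace ℂ L) (_ : CompleteSpace L)
      (ρ : (familyVN v).Elem →⋆ₐ[ℂ] (L →L[ℂ] L)) (ξ : L), IsGNS φ ρ ξ := by
  let _ : CStarAlgebra (familyVN v).Elem :=
    StarSubalgebra.cstarAlgebra (familyVN v).toStarSubalgebra
      (h_closed := (familyVN v).isClosed)
  exact exists_isGNS hφ

theorem eq_of_moments {ψ' : CuntzAlgebra d →ₗ[ℂ] ℂ} (hψ : IsState ψ) (hψ' : IsState ψ')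
    (h : ∀ I J, ψ (word (cuntzGen d) I * star (word (cuntzGen d) J)) =
      ψ' (word (cuntzGen d) I * star (word (cuntzGen d) J))) : ψ = ψ' :=
  CuntzAlgebra.ext_of_continuous hψ.continuous hψ'.continuous h

/-- Invariance under `τ` of the moments gives invariance under `λ`. -/
theorem isInvariantUnder_cuntzEndo_of_moments (hψ : IsState ψ)
    (hinv : IsInvariantUnder (markovMap v) φ)
    (h : ∀ I J, ψ (word (cuntzGen d) I * star (word (cuntzGen d) J)) =
      φ (word (famElem v) I * star (word (famElem v) J))) :
    IsInvariantUnder (cuntzEndo d) ψ := by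
  let T : CuntzAlgebra d →ₗ[ℂ] CuntzAlgebra d :=
    ∑ k, LinearMap.mulRight ℂ (star (cuntzGen d k)) ∘ₗ LinearMap.mulLeft ℂ (cuntzGen d k)
  have hT : ∀ x, T x = cuntzEndo d x := fun x => by
    simp only [T, LinearMap.sum_apply]
    rfl
  have hTc : Continuous T := by
    have h1 : (T : CuntzAlgebra d → CuntzAlgebra d) =
        fun x => ∑ k, cuntzGen d k * x * star (cuntzGen d k) := funext hT
    rw [h1]
    fun_prop
  have heq : ψ ∘ₗ T = ψ := by
    refine CuntzAlgebra.ext_of_continuous (hψ.continuous.comp hTc) hψ.continuous fun I J => ?_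
    rw [LinearMap.comp_apply, hT, cuntzEndo, conjSum_word_mul_star_word, map_sum, h I J,
      ← hinv, markovMap, conjSum_word_mul_star_word, map_sum]
    exact Finset.sum_congr rfl fun k _ => h _ _
  intro a
  rw [← hT]
  exact congrArg (fun f : CuntzAlgebra d →ₗ[ℂ] ℂ => f a) heq

theorem inner_word_gns (hG : IsGNS φ ρ ξ) (I J : List (Fin d)) :
    ⟪ξ, (word (fun k => ρ (famElem v k)) I * star (word (fun k => ρ (famElem v k)) J)) ξ⟫_ℂ =
      φ (word (famElem v) I * star (word (famElem v) J)) := by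
  rw [← hG.1, map_mul, map_star, map_word, map_word]

/-- The GNS representation of the state on `{v_k, v_k^*}''` dilates to a representation of the
Cuntz algebra on `ℓ²(ℕ)`. -/
theorem exists_rep_isCuntzDilation (hd : 0 < d) (hv : ∑ k, v k * star (v k) = 1)
    (hG : IsGNS φ ρ ξ) (hN : IsNormalFunctional (familyVN v) φ)
    (hM : ((familyVN v).commutant : Set (K →L[ℂ] K)) = {x | conjSum v x = x}) :
    ∃ (V : L →ₗᵢ[ℂ] SeqHilbert) (π : CuntzAlgebra d →⋆ₐ[ℂ] (SeqHilbert →L[ℂ] SeqHilbert)),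
      IsCuntzDilation (fun k => ρ (famElem v k)) V fun k => π (cuntzGen d k) := by
  have := separableSpace_gns hv hG hN hM
  obtain ⟨V, S, hS⟩ := exists_isCuntzDilation_seqHilbert ⟨0, hd⟩ (sum_rep_famElem (ρ := ρ) hv)
  obtain ⟨π, hπ⟩ := exists_cuntzRep S hS.cuntz
  refine ⟨V, π, ?_⟩
  simp only [hπ]
  exact hS

theorem IsCuntzDilation.moments_gns {H : Type*} [NormedAddCommGroup H] [InnerProductSpace ℂ H]
    [CompleteSpace H] {π : CuntzAlgebra d →⋆ₐ[ℂ] (H →L[ℂ] H)} {V : L →ₗᵢ[ℂ] H}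
    (h : IsCuntzDilation (fun k => ρ (famElem v k)) V fun k => π (cuntzGen d k))
    (hG : IsGNS φ ρ ξ) (I J : List (Fin d)) :
    ⟪V ξ, π (word (cuntzGen d) I * star (word (cuntzGen d) J)) (V ξ)⟫_ℂ =
      φ (word (famElem v) I * star (word (famElem v) J)) := by
  rw [← inner_word_gns hG, ← h.inner_word, map_mul, map_star, map_word, map_word]

/-- The functional `a ↦ ⟨Ω, π(a) Ω⟩` on the Cuntz algebra, a state when `Ω` is a unit vector. -/
noncomputable def vectorState {H : Type*} [NormedAddCommGroup H] [InnerProductSpace ℂ H]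
    [CompleteSpace H] (π : CuntzAlgebra d →⋆ₐ[ℂ] (H →L[ℂ] H)) (Ω : H) :
    CuntzAlgebra d →ₗ[ℂ] ℂ where
  toFun a := ⟪Ω, π a Ω⟫_ℂ
  map_add' a b := by simp
  map_smul' c a := by simp

theorem IsGNS.inner_self {A : Type*} [Ring A] [StarRing A] [Algebra ℂ A] {φ : A →ₗ[ℂ] ℂ}
    {ρ : A →⋆ₐ[ℂ] (L →L[ℂ] L)} (hG : IsGNS φ ρ ξ) (hφ : IsState φ) : ⟪ξ, ξ⟫_ℂ = 1 := by
  have := hG.1 1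
  rwa [map_one, one_apply_eq_self, hφ.1] at this

/-- Any Cuntz dilation of the GNS representation realizes the state of the Cuntz
algebra with the given moments. -/
theorem IsCuntzDilation.inner_rep_eq {H : Type*} [NormedAddCommGroup H] [InnerProductSpace ℂ H]
    [CompleteSpace H] {π : CuntzAlgebra d →⋆ₐ[ℂ] (H →L[ℂ] H)} {V : L →ₗᵢ[ℂ] H}
    (h : IsCuntzDilation (fun k => ρ (famElem v k)) V fun k => π (cuntzGen d k))
    (hG : IsGNS φ ρ ξ) (hφ : IsState φ) (hψ : IsState ψ)
    (hm : ∀ I J, ψ (word (cuntzGen d) I * star (word (cuntzGen d) J)) =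
      φ (word (famElem v) I * star (word (famElem v) J))) (a : CuntzAlgebra d) :
    ⟪V ξ, π a (V ξ)⟫_ℂ = ψ a := by
  have hs : IsState (vectorState π (V ξ)) := isState_of_inner (π := π) (fun _ => rfl) (by
    rw [V.inner_map_map, hG.inner_self hφ])
  have := eq_of_moments hs hψ fun I J => (h.moments_gns hG I J).trans (hm I J).symm
  exact congrArg (fun f : CuntzAlgebra d →ₗ[ℂ] ℂ => f a) this

/-- There is exactly one state of the Cuntz algebra with the moments of `φ`. -/
theorem existsUnique_state_of_moments (hd : 0 < d) (hv : ∑ k, v k * star (v k) = 1)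
    (hφ : IsState φ) (hN : IsNormalFunctional (familyVN v) φ)
    (hM : ((familyVN v).commutant : Set (K →L[ℂ] K)) = {x | conjSum v x = x}) :
    ∃! ψ : CuntzAlgebra d →ₗ[ℂ] ℂ, IsState ψ ∧
      ∀ I J, ψ (word (cuntzGen d) I * star (word (cuntzGen d) J)) =
        φ (word (famElem v) I * star (word (famElem v) J)) := by
  obtain ⟨L, _, _, _, ρ, ξ, hG⟩ := exists_isGNS_elem hφ
  obtain ⟨V, π, h⟩ := exists_rep_isCuntzDilation hd hv hG hN hM
  refine ⟨vectorState π (V ξ), ⟨isState_of_inner (π := π) (fun _ => rfl) (by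
    rw [V.inner_map_map, hG.inner_self hφ]), h.moments_gns hG⟩, ?_⟩
  rintro ψ ⟨hψ, hm⟩
  exact LinearMap.ext fun a => (h.inner_rep_eq hG hφ hψ hm a).symm

/-- The GNS space of `φ` embeds in the GNS space of `ψ`. In the model on `ℓ²(ℕ)` the projection `Q`
onto the cyclic subspace of `ψ` commutes with the Cuntz family, so its compression to `L` is a fixed
point of the Markov map, hence lies in the commutant of the GNS representation. As it fixes the
cyclic vector, it is the identity, that is, `L` lies in the range of `Q`. -/
theorem exists_isometry_isCuntzDilation (hd : 0 < d) (hv : ∑ k, v k * star (v k) = 1)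
    (hφ : IsState φ) (hN : IsNormalFunctional (familyVN v) φ)
    (hM : ((familyVN v).commutant : Set (K →L[ℂ] K)) = {x | conjSum v x = x})
    (hG : IsGNS φ ρ ξ) (hψ : IsState ψ)
    (hm : ∀ I J, ψ (word (cuntzGen d) I * star (word (cuntzGen d) J)) =
      φ (word (famElem v) I * star (word (famElem v) J)))
    {H : Type*} [NormedAddCommGroup H] [InnerProductSpace ℂ H] [CompleteSpace H]
    {π : CuntzAlgebra d →⋆ₐ[ℂ] (H →L[ℂ] H)} {Ω : H} (hGπ : IsGNS ψ π Ω) :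
    ∃ V : L →ₗᵢ[ℂ] H, V ξ = Ω ∧
      IsCuntzDilation (fun k => ρ (famElem v k)) V fun k => π (cuntzGen d k) := by
  obtain ⟨V', π', h⟩ := exists_rep_isCuntzDilation hd hv hG hN hM
  have hψ' := h.inner_rep_eq hG hφ hψ hm
  obtain ⟨R, hR⟩ := exists_linearIsometry_of_gram (fun a => π a Ω) (fun a => π' a (V' ξ))
    (fun a b => by rw [inner_rep_apply hGπ.1, inner_rep_apply hψ'])
    (dense_span_of_denseRange hGπ.2)
  have hRΩ : R Ω = V' ξ := by simpa using hR 1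
  have hRπ : ∀ a x, R (π a x) = π' a (R x) := fun a x => by
    refine isClosed_property hGπ.2 (isClosed_eq (f := fun x => R (π a x))
      (g := fun x => π' a (R x)) (by fun_prop) (by fun_prop)) (fun b => ?_) x
    rw [← mul_apply_eq_comp, ← map_mul, hR, hR, map_mul, mul_apply_eq_comp]
  have hQ : ∀ a, π' a * rangeProj R = rangeProj R * π' a := by
    have key : ∀ b, rangeProj R * (π' b * rangeProj R) = π' b * rangeProj R := by
      intro b
      refine ContinuousLinearMap.ext fun x => ?_
      refine (mem_range_iff_rangeProj R _).1 ⟨π b (R.toContinuousLinearMap.adjoint x), ?_⟩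
      rw [hRπ]
      rfl
    have hsa : star (rangeProj R) = rangeProj R := (isStarProjection_rangeProj R).isSelfAdjoint
    intro a
    have h3 := congrArg star (key (star a))
    simp only [star_mul, map_star, star_star, hsa] at h3
    rw [← key a, ← mul_assoc, h3]
  have hQc : rangeProj R ∈ (familyVN fun k => π' (cuntzGen d k)).commutant := by
    rw [← repVN_commutant_eq, mem_commutant_repVN]
    exact hQ
  have hclos : ∀ x, R x ∈ closure (dilationSpan V' fun k => π' (cuntzGen d k) :
      Set SeqHilbert) := by
    refine isClosed_property hGπ.2 (isClosed_closure.preimage R.continuous) fun a => ?_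
    show R (π a Ω) ∈ _
    rw [hRπ, hRΩ]
    exact h.rep_apply_mem_closure ξ a
  have hcompr : compress V' (rangeProj R) ∈
      (familyVN fun k => ρ (famElem v k)).commutant := by
    rw [← SetLike.mem_coe, (commutant_gns_eq hv hG hN hM).2]
    show conjSum _ _ = _
    rw [← h.compress_conjSum, conjSum_eq_self_of_commute h.cuntz.2 fun k => hQ _]
  have hfix : ∀ f, rangeProj R (V' f) = V' (compress V' (rangeProj R) f) := fun f =>
    h.apply_eq_of_compress_mem_commutant hQc hcompr (hclos _)
  have hξ : compress V' (rangeProj R) ξ = ξ := V'.injective (by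
    rw [← hfix, ← hRΩ, rangeProj_apply_self])
  rw [← (commutant_gns_eq hv hG hN hM).1, mem_commutant_repVN] at hcompr
  have hone : ∀ f, compress V' (rangeProj R) f = f := fun f => by
    refine isClosed_property hG.2 (isClosed_eq (by fun_prop) continuous_id) (fun x => ?_) f
    have := congrArg (fun Z : L →L[ℂ] L => Z ξ) (hcompr x)
    simp only [mul_apply_eq_comp, hξ] at this
    exact this.symm
  have hrange : ∀ f, ∃ x, R x = V' f := fun f =>
    (mem_range_iff_rangeProj R _).2 (by rw [hfix, hone])
  choose V hV using hrange
  let V₀ : L →ₗᵢ[ℂ] H :=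
    { toFun := V
      map_add' := fun f g => R.injective (by rw [map_add, hV, hV, hV, map_add])
      map_smul' := fun c f => R.injective (by
        rw [RingHom.id_apply, map_smul, hV, hV, map_smul])
      norm_map' := fun f => by
        show ‖V f‖ = ‖f‖
        rw [← R.norm_map, hV, V'.norm_map] }
  have hV₀ : ∀ f, R (V₀ f) = V' f := hV
  refine ⟨V₀, R.injective (by rw [hV₀, hRΩ]), isCuntzFamily_rep π, fun k f => R.injective ?_⟩
  rw [← map_star, hRπ, hV₀, hV₀, map_star, h.intertwine]

end Converse

/-! ### The support system of an invariant state -/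

theorem proposition2p4 (d : ℕ) (hd : 2 ≤ d) :
    -- the system on the support projection of a `λ`-invariant state
    (∀ (ψ : CuntzAlgebra d →ₗ[ℂ] ℂ), IsState ψ → IsInvariantUnder (cuntzEndo d) ψ →
      ∀ (H : Type u₁) [NormedAddCommGroup H] [InnerProductSpace ℂ H] [CompleteSpace H]
        (π : CuntzAlgebra d →⋆ₐ[ℂ] (H →L[ℂ] H)) (Ω : H), IsGNS ψ π Ω →
      ∀ (K : Submodule ℂ H) [CompleteSpace K],
        IsSupportProjection (repVN π) (vectorFunctional (repVN π) Ω) K.starProjection →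
      ∀ (v : Fin d → (K →L[ℂ] K)), (∀ k, v k = compress K.subtypeₗᵢ (π (cuntzGen d k))) →
      ∃ hΩ : Ω ∈ K,
        IsSupportSystem ψ π Ω K.subtypeₗᵢ v ⟨Ω, hΩ⟩ ∧
        IsState (vectorFunctional (familyVN v) ⟨Ω, hΩ⟩) ∧
        IsFaithful (vectorFunctional (familyVN v) ⟨Ω, hΩ⟩) ∧
        IsNormalFunctional (familyVN v) (vectorFunctional (familyVN v) ⟨Ω, hΩ⟩) ∧
        IsInvariantUnder (markovMap v) (vectorFunctional (familyVN v) ⟨Ω, hΩ⟩) ∧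
        List.TFAE [
          IsErgodic (cuntzEndo d) ψ,
          IsErgodic (markovMap v) (vectorFunctional (familyVN v) ⟨Ω, hΩ⟩),
          (familyVN v).IsFactor]) ∧
    -- converse
    (∀ (K : Type u₁) [NormedAddCommGroup K] [InnerProductSpace ℂ K] [CompleteSpace K]
        (v : Fin d → (K →L[ℂ] K)), ∑ k, v k * star (v k) = 1 →
        ((familyVN v).commutant : Set (K →L[ℂ] K)) = {x | conjSum v x = x} →
      (∀ (H : Type u₂) [NormedAddCommGroup H] [InnerProductSpace ℂ H] [CompleteSpace H]
          (V : K →ₗᵢ[ℂ] H) (S : Fin d → (H →L[ℂ] H)), IsPopescuDilation v V S →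
          rangeProj V ∈ familyVN S) ∧
      (∀ (φ : (familyVN v).Elem →ₗ[ℂ] ℂ), IsState φ → IsFaithful φ →
          IsNormalFunctional (familyVN v) φ → IsInvariantUnder (markovMap v) φ →
        (∃! ψ : CuntzAlgebra d →ₗ[ℂ] ℂ, IsState ψ ∧
          ∀ I J, ψ (word (cuntzGen d) I * star (word (cuntzGen d) J)) =
            φ (word (famElem v) I * star (word (famElem v) J))) ∧
        ∀ ψ : CuntzAlgebra d →ₗ[ℂ] ℂ, IsState ψ →
          (∀ I J, ψ (word (cuntzGen d) I * star (word (cuntzGen d) J)) =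
            φ (word (famElem v) I * star (word (famElem v) J))) →
          IsInvariantUnder (cuntzEndo d) ψ ∧
          ∀ (H : Type u₂) [NormedAddCommGroup H] [InnerProductSpace ℂ H] [CompleteSpace H]
            (π : CuntzAlgebra d →⋆ₐ[ℂ] (H →L[ℂ] H)) (Ω : H), IsGNS ψ π Ω →
          ∀ (L : Type u₃) [NormedAddCommGroup L] [InnerProductSpace ℂ L] [CompleteSpace L]
            (ρ : (familyVN v).Elem →⋆ₐ[ℂ] (L →L[ℂ] L)) (ξ : L), IsGNS φ ρ ξ →
          ∃ V : L →ₗᵢ[ℂ] H,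
            IsSupportProjection (repVN π) (vectorFunctional (repVN π) Ω) (rangeProj V) ∧
            IsSupportSystem ψ π Ω V (fun k => ρ (famElem v k)) ξ ∧
            Set.range ρ = (familyVN (fun k => ρ (famElem v k)) : Set (L →L[ℂ] L)))) ∧
    -- uniqueness of the system up to unitary conjugation
    (∀ (ψ : CuntzAlgebra d →ₗ[ℂ] ℂ), IsState ψ → IsInvariantUnder (cuntzEndo d) ψ →
      ∀ (H₁ : Type u₁) [NormedAddCommGroup H₁] [InnerProductSpace ℂ H₁] [CompleteSpace H₁]
        (K₁ : Type u₂) [NormedAddCommGroup K₁] [InnerProductSpace ℂ K₁] [CompleteSpace K₁]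
        (π₁ : CuntzAlgebra d →⋆ₐ[ℂ] (H₁ →L[ℂ] H₁)) (Ω₁ : H₁)
        (V₁ : K₁ →ₗᵢ[ℂ] H₁) (v₁ : Fin d → (K₁ →L[ℂ] K₁)) (ω₁ : K₁)
        (H₂ : Type u₃) [NormedAddCommGroup H₂] [InnerProductSpace ℂ H₂] [CompleteSpace H₂]
        (K₂ : Type u₄) [NormedAddCommGroup K₂] [InnerProductSpace ℂ K₂] [CompleteSpace K₂]
        (π₂ : CuntzAlgebra d →⋆ₐ[ℂ] (H₂ →L[ℂ] H₂)) (Ω₂ : H₂)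
        (V₂ : K₂ →ₗᵢ[ℂ] H₂) (v₂ : Fin d → (K₂ →L[ℂ] K₂)) (ω₂ : K₂),
        IsGNS ψ π₁ Ω₁ → IsSupportSystem ψ π₁ Ω₁ V₁ v₁ ω₁ →
        IsGNS ψ π₂ Ω₂ → IsSupportSystem ψ π₂ Ω₂ V₂ v₂ ω₂ →
        ∃ U : K₁ ≃ₗᵢ[ℂ] K₂,
          (∀ k, U.conjStarAlgEquiv (v₁ k) = v₂ k) ∧
          U.conjStarAlgEquiv '' (familyVN v₁ : Set (K₁ →L[ℂ] K₁)) =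
            (familyVN v₂ : Set (K₂ →L[ℂ] K₂)) ∧
          ∀ (x₁ : (familyVN v₁).Elem) (x₂ : (familyVN v₂).Elem),
            (x₂ : K₂ →L[ℂ] K₂) = U.conjStarAlgEquiv (x₁ : K₁ →L[ℂ] K₁) →
            vectorFunctional (familyVN v₂) ω₂ x₂ = vectorFunctional (familyVN v₁) ω₁ x₁) := by
  refine ⟨?_, ?_, ?_⟩
  · intro ψ hψ hinv H _ _ _ π Ω hG K _ hP v hv
    have hΩ : Ω ∈ K :=
      Submodule.starProjection_eq_self_iff.1 (isSupportProjection_iff.1 hP).2.2.1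
    have h : IsSupportSystem ψ π Ω K.subtypeₗᵢ v ⟨Ω, hΩ⟩ :=
      exists_isSupportSystem_of_isSupportProjection hinv hG rfl
        (by rw [rangeProj_subtype]; exact hP) hv
    refine ⟨hΩ, h, h.isState_vectorFunctional hG hψ, h.faithful,
      isNormalFunctional_vectorFunctional _ _, h.isInvariantUnder_markovMap hG hinv, ?_⟩
    tfae_have 1 → 3 := h.isFactor_of_isErgodic_cuntz hG hψ hinv
    tfae_have 3 → 1 := h.isErgodic_cuntz_of_isFactor hG hψ hinv
    tfae_have 2 → 3 := h.isFactor_of_isErgodic_markovMap hG hψ hinv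
    tfae_have 3 → 2 := h.isErgodic_markovMap_of_isFactor hG hψ hinv
    tfae_finish
  · intro K _ _ _ v hv hM
    refine ⟨fun H _ _ _ V S hS => hS.rangeProj_mem hM, fun φ hφ hf hN hinv => ?_⟩
    have hd' : 0 < d := by omega
    refine ⟨existsUnique_state_of_moments hd' hv hφ hN hM, fun ψ hψ hm => ?_⟩
    refine ⟨isInvariantUnder_cuntzEndo_of_moments hψ hinv hm, ?_⟩
    intro H _ _ _ π Ω hGπ L _ _ _ ρ ξ hG
    obtain ⟨V, hVξ, hD⟩ := exists_isometry_isCuntzDilation hd' hv hφ hN hM hG hψ hm hGπ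
    have hrange := range_gns_eq hv hG hN hf hM
    have hP : rangeProj V ∈ repVN π := by
      rw [repVN_eq_familyVN]
      exact (hD.isPopescuDilation_of_isGNS hGπ hVξ).rangeProj_mem (commutant_gns_eq hv hG hN hM).2
    have hfaith : IsFaithful (vectorFunctional (familyVN fun k => ρ (famElem v k)) ξ) := by
      rw [isFaithful_vectorFunctional_iff]
      intro x hx hxξ
      rw [← SetLike.mem_coe, ← hrange] at hx
      obtain ⟨y, rfl⟩ := hx
      rw [hf.eq_zero_of_gns hG hxξ, map_zero]
    have h := hD.isSupportSystem hGπ hVξ hP hfaith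
    exact ⟨V, h.isSupportProjection, h, hrange⟩
  · intro ψ _ _ H₁ _ _ _ K₁ _ _ _ π₁ Ω₁ V₁ v₁ ω₁ H₂ _ _ _ K₂ _ _ _ π₂ Ω₂ V₂ v₂ ω₂ hG₁ h₁ hG₂ h₂
    obtain ⟨U, hUω, hU⟩ := h₁.exists_equiv hG₁ hG₂ h₂
    refine ⟨U, hU, image_conjStarAlgEquiv_familyVN U hU, fun x₁ x₂ hx => ?_⟩
    rw [vectorFunctional_apply, vectorFunctional_apply, hx,
      LinearIsometryEquiv.conjStarAlgEquiv_apply_apply, ← hUω, U.inner_map_map,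
      U.symm_apply_apply]
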